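/- **Setting.** Let $h>0$ and let either $Y=\mathbb R$, $\varphi(y)=y^3/3$, or $Y=S^1=\mathbb R/2\pi\mathbb Z$, $\varphi(y)=\sin y$. For real $\xi$ let $P_\xi=h\partial_y+\xi+\partial_y\varphi$ on $L^2(Y)$, with domain $\{u\in L^2(\mathbb R):(1+y^4)^{1/2}u\in L^2,\ \partial_yu\in L^2\}$ if $Y=\mathbb R$ and $H^1(S^1)$ if $Y=S^1$. Its singular values are the numbers $t\ge 0$ such that $t^2$ is an eigenvalue of $P_\xi^*P_\xi$. Let $\xi\in\,]-\infty,0[$ if $Y=\mathbb R$ and $\xi\in\,]-1,1[$ if $Y=S^1$. Let $y_\pm=y_\pm(\xi)\in Y$ be the two solutions of $\partial_y\varphi(y)=-\xi$, labelled so that $\pm\partial_y^2\varphi(y_\pm)>0$; if $Y=S^1$, identify $y_+,y_-$ with points of $]-\pi,0[$ and $]0,\pi[$. Let $p_\xi(y,\eta)=i\eta+\xi+\partial_y\varphi(y)$, let $\{p,q\}=\partial_\eta p\,\partial_yq-\partial_yp\,\partial_\eta q$, and put $$A(\xi)=\Big(\tfrac{|\{p_\xi,\overline p_\xi\}(y_+,0)|}{2\pi}\Big)^{1/4}\Big(\tfrac{|\{p_\xi,\overline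 p_\xi\}(y_-,0)|}{2\pi}\Big)^{1/4}.$$ Let $d$ be the Lithner–Agmon distance on $Y$, i.e. the distance (infimum of lengths of $C^1$ curves) for the metric $(\xi+\partial_y\varphi(y))^2dy^2$, and $S_0(\xi)=d(y_+,y_-)$. If $Y=S^1$, let $d_J$ be the Lithner–Agmon distance in the interval $J$ from $y_--2\pi$ to $y_-$ (end points included). Put $$E(\xi;h)=\begin{cases}e^{-S_0/h},&Y=\mathbb R,\\ e^{-d_J(y_+,\,y_--2\pi)/h}-e^{-d_J(y_+,\,y_-)/h},&Y=S^1.\end{cases}$$ **Theorem.** In each of the two cases there are real numbers $m_+(\xi;h)$ and $b(\xi;h)$, and real functions $c_0=A,c_1,c_2,\dots$ of $\xi$, such that the following hold. (0) For all $h>0$ and all $\xi$ as above, the smallest singular value of $P_\xi$ exists and equals $|m_+|$, and there are normalized $e_\pm\in L^2(Y)$ with $P_\xi e_+=m_+e_-$, $P_\xi^*e_-=m_+e_+$. (1) For every compact set $K\subset\,]-\infty,0[$ (if $Y=\mathbb R$), respectively $K\subset\,]-1,1[$ (if $Y=S^1$), there is $h_0>0$ such that, uniformly for $\xi\in K$,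 $0<h\le h_0$: $b(\xi;h)\sim\sum_{j\ge0}c_j(\xi)h^j$ (a full asymptotic expansion; in particular $b=A+\mathcal O(h)$), and for every $\varepsilon>0$ $$m_+=h^{1/2}\,b(\xi;h)\Big(E(\xi;h)+\mathcal O_\varepsilon\big(e^{\varepsilon/h-3S_0/h}\big)\Big).$$ (2) Let $Y=\mathbb R$. For every $C_0>0$ there are $h_0>0$, $C>0$ such that, if $0<h\le h_0$ and either $-1/C_0\le\xi\le-C_0h^{2/3}$ or $\xi\le-C_0$, then, the $\mathcal O$'s being bounded with the constant $C$, $$m_+=h^{1/2}\big(A(\xi)+\mathcal O(h|\xi|^{-5/4})\big)e^{-S_0/h}=\frac{\sqrt{2h}\,|\xi|^{1/4}}{\sqrt\pi}\big(1+\mathcal O(h|\xi|^{-3/2})\big)e^{-4|\xi|^{3/2}/(3h)}.$$ (3) Let $Y=S^1$. For every $C_0>1$ there are $h_0>0$, $C>0$ such that, if $0<h\le h_0$, the sign $\sigma$ is $+$ or $-$, $\delta:=1-\sigma\xi$ and $C_0h^{2/3}\le\delta\le1/C_0$, then, with the $\mathcal O$ bounded with the constant $C$, $$m_+=\sigma\,h^{1/2}\big(A(\xi)+\mathcal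 O(h\delta^{-5/4})\big)e^{-S_0/h}.$$ -/

import Mathlib

open MeasureTheory Set
open scoped ContDiff ComplexConjugate

/-! ## Operators `h ∂_y + w` on `L²(Y)`

A one-dimensional `Y` is handled together with its universal covering `c : ℝ → Y`:
the identity if `Y = ℝ`, the quotient map if `Y = ℝ / 2πℤ`. A function `χ` on `Y` is smooth
when `χ ∘ c` is, and its derivative is computed upstairs. -/

/-- The circle `ℝ / 2πℤ`; its `volume` is Lebesgue measure, of total mass `2π`. -/
noncomputable abbrev Circ : Type := AddCircle (2 * Real.pi)

instance twoPiFact : Fact (0 < 2 * Real.pi) := ⟨Real.two_pi_pos⟩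

/-- The quotient map `ℝ → ℝ / 2πℤ`. -/
noncomputable def circCover (x : ℝ) : Circ := (x : Circ)

/-- `L²(Y)`, complex valued. -/
abbrev L2 (Y : Type) [MeasureSpace Y] : Type := Lp ℂ 2 (volume : Measure Y)

/-- `g` is the weak (distributional) derivative `∂_y u` on `Y`: `∫ u χ' = - ∫ g χ` for all
smooth compactly supported `χ` (with derivative `χ'`). -/
def IsWeakDeriv {Y : Type} [TopologicalSpace Y] [MeasureSpace Y] (c : ℝ → Y)
    (u g : Y → ℂ) : Prop :=
  ∀ χ χ' : Y → ℂ, HasCompactSupport χ → ContDiff ℝ ∞ (χ ∘ c) →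
    (∀ x : ℝ, HasDerivAt (χ ∘ c) (χ' (c x)) x) →
      ∫ y, u y * χ' y = -∫ y, g y * χ y

/-- The graph of the unbounded operator `h ∂_y + w` on `L²(Y)` with domain
`{u ∈ L² : ρ u ∈ L², ∂_y u ∈ L²}`: `OpGraph c w ρ h u v` says that `u` is in the domain and
`(h ∂_y + w) u = v`. -/
def OpGraph {Y : Type} [TopologicalSpace Y] [MeasureSpace Y] (c : ℝ → Y)
    (w ρ : Y → ℝ) (h : ℝ) (u v : L2 Y) : Prop :=
  MemLp (fun y => (ρ y : ℂ) * u y) 2 volume ∧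
    ∃ g : L2 Y, IsWeakDeriv c u g ∧ ∀ᵐ y, v y = (h : ℂ) * g y + (w y : ℂ) * u y

/-- The graph of the Hilbert space adjoint of the (densely defined) operator with graph `G`:
`v` is in the domain of the adjoint, and the adjoint maps `v` to `z`. -/
def AdjGraph {H : Type} [NormedAddCommGroup H] [InnerProductSpace ℂ H]
    (G : H → H → Prop) (v z : H) : Prop :=
  ∀ u Pu : H, G u Pu → inner ℂ Pu v = inner ℂ u z

/-- The singular values of the operator `P` with graph `G`: the `t ≥ 0` such that `t ^ 2` is an
eigenvalue of `P* P`, whose domain is `{u ∈ D(P) : P u ∈ D(P*)}`. -/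
def singularValues {H : Type} [NormedAddCommGroup H] [InnerProductSpace ℂ H]
    (G : H → H → Prop) : Set ℝ :=
  {t | 0 ≤ t ∧ ∃ u v : H, u ≠ 0 ∧ G u v ∧ AdjGraph G v (((t ^ 2 : ℝ) : ℂ) • u)}

/-- `P e₊ = m e₋` and `P* e₋ = m e₊` with `e₊`, `e₋` normalized (`m` real), where `P` has
graph `G`. -/
def IsSingularTriple {H : Type} [NormedAddCommGroup H] [InnerProductSpace ℂ H]
    (G : H → H → Prop) (m : ℝ) (ePlus eMinus : H) : Prop :=
  ‖ePlus‖ = 1 ∧ ‖eMinus‖ = 1 ∧ G ePlus ((m : ℂ) • eMinus) ∧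
    AdjGraph G eMinus ((m : ℂ) • ePlus)

/-! ## The two models -/

/-- `φ(y) = y³ / 3` on `ℝ`. -/
noncomputable def linePhi (y : ℝ) : ℝ := y ^ 3 / 3

/-- `φ(y) = sin y`, as a `2π`-periodic function. -/
noncomputable def circPhi (y : ℝ) : ℝ := Real.sin y

/-- `ξ + ∂_y φ`. -/
noncomputable def drift (φ : ℝ → ℝ) (ξ y : ℝ) : ℝ := ξ + deriv φ y

theorem circDrift_periodic (ξ : ℝ) :
    Function.Periodic (drift circPhi ξ) (2 * Real.pi) := by
  intro y
  have hs : circPhi = Real.sin := rfl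
  simp [drift, hs]

/-- `P_ξ = h ∂_y + ξ + ∂_y φ` on `L²(ℝ)`, `φ = y³ / 3`, with domain
`{u : (1 + y⁴)^{1/2} u ∈ L², ∂_y u ∈ L²}`. -/
noncomputable def lineP (h ξ : ℝ) : L2 ℝ → L2 ℝ → Prop :=
  OpGraph id (drift linePhi ξ) (fun y => Real.sqrt (1 + y ^ 4)) h

/-- `P_ξ = h ∂_y + ξ + ∂_y φ` on `L²(ℝ / 2πℤ)`, `φ = sin y`, with domain `H¹`. -/
noncomputable def circP (h ξ : ℝ) : L2 Circ → L2 Circ → Prop :=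
  OpGraph circCover (circDrift_periodic ξ).lift (fun _ => 1) h

/-- `yp`, `ym` solve `∂_y φ = -ξ`, with `∂_y² φ (yp) > 0` and `∂_y² φ (ym) < 0`. -/
def IsCritPair (φ : ℝ → ℝ) (ξ yp ym : ℝ) : Prop :=
  deriv φ yp = -ξ ∧ 0 < deriv (deriv φ) yp ∧ deriv φ ym = -ξ ∧ deriv (deriv φ) ym < 0

/-- The principal symbol `p_ξ(y, η) = i η + ξ + ∂_y φ(y)`. -/
noncomputable def symb (φ : ℝ → ℝ) (ξ y η : ℝ) : ℂ :=
  Complex.I * (η : ℂ) + (drift φ ξ y : ℂ)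

/-- The Poisson bracket `{p, q} = ∂_η p ∂_y q - ∂_y p ∂_η q` of functions of `(y, η)`. -/
noncomputable def poisson (p q : ℝ → ℝ → ℂ) (y η : ℝ) : ℂ :=
  deriv (fun s => p y s) η * deriv (fun s => q s η) y
    - deriv (fun s => p s η) y * deriv (fun s => q y s) η

/-- `(|{p_ξ, \bar p_ξ}(yp, 0)| / 2π)^{1/4} (|{p_ξ, \bar p_ξ}(ym, 0)| / 2π)^{1/4}`. -/
noncomputable def amp (φ : ℝ → ℝ) (ξ yp ym : ℝ) : ℝ :=
  (‖poisson (symb φ ξ) (fun y η => conj (symb φ ξ y η)) yp 0‖ / (2 * Real.pi)) ^ (1 / 4 : ℝ) *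
  (‖poisson (symb φ ξ) (fun y η => conj (symb φ ξ y η)) ym 0‖ / (2 * Real.pi)) ^ (1 / 4 : ℝ)

/-- The Lithner-Agmon distance from `a` to `b` for the metric `w² dy²`: the infimum of the
lengths of the `C¹` curves from `a` to `b`. A curve in `Y` is given by its lift `γ` through
`c : ℝ → Y`; lifts are required to stay in `J`, and `w` is written upstairs. -/
noncomputable def agmonDist {Y : Type} (c : ℝ → Y) (J : Set ℝ) (w : ℝ → ℝ) (a b : Y) : ℝ :=
  sInf {L : ℝ | ∃ γ : ℝ → ℝ, ContDiff ℝ 1 γ ∧ (∀ t ∈ Icc (0 : ℝ) 1, γ t ∈ J) ∧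
    c (γ 0) = a ∧ c (γ 1) = b ∧ L = ∫ t in (0 : ℝ)..1, |w (γ t)| * |deriv γ t|}

/-- `S₀ = d(yp, ym)` for `Y = ℝ`. -/
noncomputable def lineS0 (ξ yp ym : ℝ) : ℝ :=
  agmonDist id univ (drift linePhi ξ) yp ym

/-- `S₀ = d(yp, ym)` for `Y = ℝ / 2πℤ`. -/
noncomputable def circS0 (ξ yp ym : ℝ) : ℝ :=
  agmonDist circCover univ (drift circPhi ξ) (circCover yp) (circCover ym)

/-- The Lithner-Agmon distance `d_J(a, b)` in the interval `J` from `ym - 2π` to `ym`, both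
ends included, for `φ = sin y`. -/
noncomputable def circDJ (ξ ym a b : ℝ) : ℝ :=
  agmonDist id (Icc (ym - 2 * Real.pi) ym) (drift circPhi ξ) a b

/-- `b(h, ξ) ∼ ∑ c_j(ξ) h^j` as `h → 0`, uniformly for `ξ ∈ K`. -/
def HasExpansion (b : ℝ → ℝ → ℝ) (c : ℕ → ℝ → ℝ) (K : Set ℝ) (h₀ : ℝ) : Prop :=
  ∀ N : ℕ, ∃ C : ℝ, ∀ h ∈ Ioc 0 h₀, ∀ ξ ∈ K,
    |b h ξ - ∑ j ∈ Finset.range N, c j ξ * h ^ j| ≤ C * h ^ N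

/-! ## Uniform Laplace asymptotics -/

/-! The operator `P = h ∂ + w` is scalar and of first order, so its inverse is an explicit integral
operator. With `Φ' = w`, the kernel on the line is `h⁻¹ exp ((Φ(s) - Φ(y)) / h)` for `s < y`. On a
fundamental interval of the circle the same exponential appears, with weight `1` for `s < y` and `q`
otherwise, and the prefactor is `1 / (h (1 - q))`, where `q = exp (-2πξ / h)` is the Floquet
multiplier. The inverse is Hilbert-Schmidt, hence compact, so the smallest singular value of `P` is
the reciprocal of the norm of the inverse, and it is attained (`isLeast_singularValues`). At `ξ = 0`
on the circle `q = 1`, and `exp (∓ sin / h)` span the kernels of `P` and `P*`; there `m = 0`.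

The norm is squeezed between a rank-one minorant (`HSKernel.le_norm_op`) and the Hilbert-Schmidt
norm (`HSKernel.norm_op_sq_le`). On the line the kernel is a product for `s ≤ 0 < y`, and this
quadrant alone gives the lower bound `∫₀^∞ exp (-2Φ/h)`, of size `exp (S₀/h)`. The square of the
Hilbert-Schmidt norm exceeds the square of this integral only by the contribution of `0 < s < y` and
`s < y < 0`, where `Φ` drops half as far; that excess is of size `exp (S₀/h)` against `exp (2S₀/h)`.
On the circle the part of weight `q` plays the role of the quadrant. So the norm is a Laplace
integral up to an exponentially small relative error, which is what `IsReducedNorm` records after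
division by the explicit factors.

Now `m` is, exactly, `√h · (s/κ)` times the exponential factor of the theorem, with `κ` the reduced
norm and `s` an explicit function of `ξ`. Taking `b = s/κ` moves the whole exponentially small
excess into `b`, where it is invisible to the power expansion, and the remainder next to `E` in (1)
can be taken to be `0`.

All uniformity comes from one rescaling. Moving the nondegenerate minimum to `0` and measuring
lengths in units of its coordinate `ρ` turns the phase into `v² modelPhase θ v`. The line is `θ = 0`
with `ξ = -x²`, `ρ = x`, `ε² = h/(2x³)`; the circle is `|ξ| = cos θ`, `ρ = θ`, `ε² = h/θ³`, and `θ →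
0`, where the critical points merge, degenerates to the cubic of the line. The angle runs over a
compact interval on which the phases are bounded with all derivatives and bounded below
(`modelFamily`), so a single Laplace expansion in powers of `ε²` (`LaplaceFamily.expansion`),
inverted as a power series (`inv_expansion`), gives (1), (2) and (3). The ranges of (2) and (3) just
say that `ε` is bounded; it need not be small, because the Laplace integral is bounded below for
bounded `ε` (`LaplaceFamily.laplaceInt_lower`). -/

theorem abs_sub_taylor_sum_le {f : ℝ → ℝ} (hf : ContDiff ℝ ∞ f) (n : ℕ) {x B : ℝ}
    (hB : ∀ y ∈ uIcc 0 x, |iteratedDeriv n f y| ≤ B) :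
    |f x - ∑ k ∈ Finset.range n, iteratedDeriv k f 0 / k.factorial * x ^ k| ≤ B * |x| ^ n := by
  have hB0 : 0 ≤ B := (abs_nonneg _).trans (hB 0 left_mem_uIcc)
  rcases eq_or_ne (0 : ℝ) x with rfl | hx
  · cases n with
    | zero => simpa using hB 0 left_mem_uIcc
    | succ n => simp [Finset.sum_range_succ']
  cases n with
  | zero => simpa using hB x right_mem_uIcc
  | succ n =>
    have hfn : ContDiff ℝ (n + 1 : ℕ) f := hf.of_le (by exact_mod_cast le_top)
    obtain ⟨y, hy, h⟩ := taylor_mean_remainder_lagrange_iteratedDeriv (n := n) hx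
      (f := f) (by exact_mod_cast hfn.contDiffOn)
    have hT : taylorWithinEval f n (uIcc 0 x) 0 x =
        ∑ k ∈ Finset.range (n + 1), iteratedDeriv k f 0 / k.factorial * x ^ k := by
      rw [taylor_within_apply]
      refine Finset.sum_congr rfl fun k hk => ?_
      rw [iteratedDerivWithin_eq_iteratedDeriv (uniqueDiffOn_uIcc hx)
        (hf.contDiffAt.of_le (by exact_mod_cast le_top)) left_mem_uIcc]
      simp only [sub_zero, smul_eq_mul]
      field_simp
    rw [← hT, h, sub_zero, abs_div, abs_mul, abs_pow]
    have h1 := hB y (Ioo_subset_Icc_self hy)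
    have h2 : (1 : ℝ) ≤ |((n + 1).factorial : ℝ)| := by
      rw [abs_of_nonneg (by positivity)]; exact_mod_cast Nat.factorial_pos _
    calc _ ≤ |iteratedDeriv (n + 1) f y| * |x| ^ (n + 1) := div_le_self (by positivity) h2
      _ ≤ _ := by gcongr

/-- Each of the `n` factors costs a small Gaussian `exp (b x²)`, and together they use up at most
half of the available decay. The alternative `A < 0` spares a sign hypothesis here and is ruled out
by the user of the lemma. -/
theorem exists_poly_mul_gauss_le (A : ℝ) {c : ℝ} (hc : 0 < c) (n : ℕ) :
    ∃ K : ℝ, 0 ≤ K ∧ ∀ x : ℝ, (1 + A * x ^ 2) ^ n * Real.exp (-(2 * c * x ^ 2)) ≤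
      K * Real.exp (-(c * x ^ 2)) ∨ A < 0 := by
  by_cases hA : A < 0
  · exact ⟨0, le_rfl, fun x => Or.inr hA⟩
  push Not at hA
  -- Dividing by `n + 1` rather than `n` covers `n = 0`.
  set b : ℝ := c / (n + 1) with hb
  have hb0 : 0 < b := by positivity
  set K : ℝ := max 1 (A / b)
  have hK1 : 1 ≤ K := le_max_left _ _
  refine ⟨K ^ n, by positivity, fun x => Or.inl ?_⟩
  have h1 : 1 + A * x ^ 2 ≤ K * Real.exp (b * x ^ 2) := by
    have h2 : A ≤ K * b := by
      have : A / b ≤ K := le_max_right _ _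
      rwa [div_le_iff₀ hb0] at this
    have h3 := Real.add_one_le_exp (b * x ^ 2)
    calc 1 + A * x ^ 2 ≤ K + K * b * x ^ 2 := by gcongr
      _ = K * (b * x ^ 2 + 1) := by ring
      _ ≤ _ := by gcongr
  have h4 : Real.exp (b * x ^ 2) ^ n ≤ Real.exp (c * x ^ 2) := by
    rw [← Real.exp_nat_mul]
    apply Real.exp_le_exp.2
    have : (n : ℝ) * b ≤ c := by
      rw [hb, mul_div_assoc', div_le_iff₀ (by positivity)]; nlinarith
    nlinarith [sq_nonneg x]
  calc (1 + A * x ^ 2) ^ n * Real.exp (-(2 * c * x ^ 2))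
      ≤ (K * Real.exp (b * x ^ 2)) ^ n * Real.exp (-(2 * c * x ^ 2)) := by gcongr
    _ ≤ K ^ n * Real.exp (c * x ^ 2) * Real.exp (-(2 * c * x ^ 2)) := by
        rw [mul_pow]; gcongr
    _ = K ^ n * Real.exp (-(c * x ^ 2)) := by
        rw [mul_assoc, ← Real.exp_add]; congr 2; ring

theorem integrable_poly_mul_gauss {A : ℝ} (hA : 0 ≤ A) {c : ℝ} (hc : 0 < c) (n : ℕ) :
    Integrable fun x : ℝ => (1 + A * x ^ 2) ^ n * Real.exp (-(2 * c * x ^ 2)) := by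
  obtain ⟨K, hK, h⟩ := exists_poly_mul_gauss_le A hc n
  have hg : Integrable fun x : ℝ => K * Real.exp (-(c * x ^ 2)) := by
    simpa [neg_mul] using (integrable_exp_neg_mul_sq hc).const_mul K
  refine hg.mono' (by fun_prop) (.of_forall fun x => ?_)
  rw [Real.norm_of_nonneg (by positivity)]
  exact (h x).resolve_right (not_lt.2 hA)

/-- `v ↦ exp (-2 p G(v))`. -/
noncomputable def gaussPhase (G : ℝ → ℝ) (p v : ℝ) : ℝ := Real.exp (-(2 * p * G v))

theorem contDiff_gaussPhase {G : ℝ → ℝ} (hG : ContDiff ℝ ∞ G) (p : ℝ) :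
    ContDiff ℝ ∞ (gaussPhase G p) := by
  unfold gaussPhase; fun_prop

/-- The function is jointly smooth in `(p, v)`, and differentiating in `v` is differentiating in the
direction `(0, 1)`, so joint smoothness survives each step of the induction. This supplies
measurability in `x` when `p = x²`. -/
theorem continuous_iteratedDeriv_gaussPhase {G : ℝ → ℝ} (hG : ContDiff ℝ ∞ G) (k : ℕ) (v : ℝ) :
    Continuous fun p => iteratedDeriv k (gaussPhase G p) v := by
  have key : ∀ k : ℕ, ∃ F : ℝ × ℝ → ℝ, ContDiff ℝ ∞ F ∧
      ∀ p v, iteratedDeriv k (gaussPhase G p) v = F (p, v) := by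
    intro k
    induction k with
    | zero =>
      refine ⟨fun z => gaussPhase G z.1 z.2, ?_, fun p v => by simp⟩
      unfold gaussPhase; fun_prop
    | succ k ih =>
      obtain ⟨F, hF, h⟩ := ih
      refine ⟨fun z => fderiv ℝ F z (0, 1), ?_, fun p v => ?_⟩
      · exact (hF.fderiv_right (m := ∞) (by simp)).clm_apply contDiff_const
      · rw [iteratedDeriv_succ]
        have : iteratedDeriv k (gaussPhase G p) = fun v => F (p, v) := funext (h p)
        rw [this]
        have hd : HasDerivAt (fun v : ℝ => (p, v)) ((0 : ℝ), (1 : ℝ)) v :=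
          (hasDerivAt_const v p).prodMk (hasDerivAt_id v)
        exact (((hF.differentiable (by simp)) (p, v)).hasFDerivAt.comp_hasDerivAt v hd).deriv
  obtain ⟨F, hF, h⟩ := key k
  simp_rw [h]
  exact hF.continuous.comp (by fun_prop)

/-- The Faà di Bruno estimate needs the `i`-th derivative of the exponent to be at most `D ^ i`.
With `D = 1 + 2 M p ≥ 1` a bound by `D` is enough. The value of `G` itself enters only through the
exponential, so `M` need not control it. -/
theorem abs_iteratedDeriv_gaussPhase_le {G : ℝ → ℝ} (hG : ContDiff ℝ ∞ G) {p M v : ℝ}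
    (hp : 0 ≤ p) (hM0 : 0 ≤ M) (n : ℕ)
    (hM : ∀ k, 1 ≤ k → k ≤ n → |iteratedDeriv k G v| ≤ M) :
    |iteratedDeriv n (gaussPhase G p) v| ≤
      n.factorial * (1 + 2 * M * p) ^ n * Real.exp (-(2 * p * G v)) := by
  have h := norm_iteratedFDeriv_comp_le (𝕜 := ℝ) (g := Real.exp)
    (f := fun v => -(2 * p * G v)) (n := n) (N := ∞) Real.contDiff_exp
    (by fun_prop) (by exact_mod_cast le_top) v
    (C := Real.exp (-(2 * p * G v))) (D := 1 + 2 * M * p) ?_ ?_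
  · rw [norm_iteratedFDeriv_eq_norm_iteratedDeriv, Real.norm_eq_abs] at h
    calc _ ≤ _ := h
      _ = _ := by ring
  · intro i _
    rw [norm_iteratedFDeriv_eq_norm_iteratedDeriv, iteratedDeriv_eq_iterate, Real.iter_deriv_exp,
      Real.norm_of_nonneg (Real.exp_pos _).le]
  · intro i hi hin
    rw [norm_iteratedFDeriv_eq_norm_iteratedDeriv]
    have : (fun v => -(2 * p * G v)) = fun v => (-(2 * p)) * G v := by ext; ring
    rw [this, iteratedDeriv_const_mul_field, norm_mul, Real.norm_eq_abs, Real.norm_eq_abs, abs_neg,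
      abs_of_nonneg (by positivity)]
    calc 2 * p * |iteratedDeriv i G v| ≤ 2 * p * M := by gcongr; exact hM i hi hin
      _ ≤ 1 + 2 * M * p := by nlinarith
      _ ≤ (1 + 2 * M * p) ^ i := le_self_pow₀ (by nlinarith [mul_nonneg hM0 hp]) (by omega)

/-- The coefficients of the Laplace expansion of `∫ exp (-2 x² G(ε x)) dx` in powers of `ε²`. -/
noncomputable def laplaceCoeff (G : ℝ → ℝ) (j : ℕ) : ℝ :=
  ∫ x : ℝ, iteratedDeriv (2 * j) (gaussPhase G (x ^ 2)) 0 / (2 * j).factorial * x ^ (2 * j)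

/-- `∫ exp (-2 x² G(ε x)) dx` over `{x : ε x ∈ s}`. -/
noncomputable def laplaceInt (G : ℝ → ℝ) (s : Set ℝ) (ε : ℝ) : ℝ :=
  ∫ x in {x | ε * x ∈ s}, gaussPhase G (x ^ 2) (ε * x)

/-- A family of phases to which the Laplace method applies uniformly. -/
structure LaplaceFamily {ι : Type} (G : ι → ℝ → ℝ) (s : ι → Set ℝ) (c : ℝ) : Prop where
  smooth : ∀ i, ContDiff ℝ ∞ (G i)
  bound : ∀ n : ℕ, ∃ M, 0 ≤ M ∧ ∀ i k, 1 ≤ k → k ≤ n → ∀ v ∈ s i, |iteratedDeriv k (G i) v| ≤ M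
  bound_zero : ∃ M, ∀ i, ∀ v ∈ Icc (0:ℝ) 1, G i v ≤ M
  conn : ∀ i, (s i).OrdConnected
  sub : ∀ i, Icc (-1) 1 ⊆ s i
  pos : 0 < c
  le : ∀ i, ∀ v ∈ s i, c ≤ G i v

namespace LaplaceFamily
variable {ι : Type} {G : ι → ℝ → ℝ} {s : ι → Set ℝ} {c : ℝ}

theorem measurableSet (H : LaplaceFamily G s c) (i : ι) (ε : ℝ) :
    MeasurableSet {x | ε * x ∈ s i} := by
  have := (H.conn i).measurableSet
  exact this.preimage (measurable_const_mul ε)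

theorem zero_mem (H : LaplaceFamily G s c) (i : ι) : (0 : ℝ) ∈ s i := H.sub i (by simp)

/-- With `p = x²` the factor produced by differentiation is polynomial in `x`, and `c ≤ G` makes the
exponential a fixed Gaussian. Both are uniform in the index and in `v`. The normalisation `1 ≤ A`
lets the same factor dominate powers of `x` in `abs_pow_le`. -/
theorem bound_at (H : LaplaceFamily G s c) (n : ℕ) : ∃ A, 1 ≤ A ∧ ∀ i, ∀ k ≤ n, ∀ v ∈ s i, ∀ x : ℝ,
    |iteratedDeriv k (gaussPhase (G i) (x ^ 2)) v| ≤
      k.factorial * (1 + A * x ^ 2) ^ n * Real.exp (-(2 * c * x ^ 2)) := by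
  obtain ⟨M, hM0, hM⟩ := H.bound n
  refine ⟨max 1 (2 * M), le_max_left _ _, fun i k hk v hv x => ?_⟩
  have h := abs_iteratedDeriv_gaussPhase_le (H.smooth i) (sq_nonneg x) hM0 k
    (fun l hl hlk => hM i l hl (hlk.trans hk) v hv)
  refine h.trans ?_
  have h1 : 1 + 2 * M * x ^ 2 ≤ 1 + max 1 (2 * M) * x ^ 2 := by
    gcongr; exact le_max_right _ _
  have h2 : (1 + 2 * M * x ^ 2) ^ k ≤ (1 + max 1 (2 * M) * x ^ 2) ^ n := by
    calc _ ≤ (1 + max 1 (2 * M) * x ^ 2) ^ k := by gcongr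
      _ ≤ _ := pow_le_pow_right₀ (by
        have : 0 ≤ max 1 (2 * M) * x ^ 2 := by positivity
        linarith) hk
  have h3 : -(2 * x ^ 2 * G i v) ≤ -(2 * c * x ^ 2) := by
    nlinarith [H.le i v hv, sq_nonneg x]
  gcongr

theorem abs_pow_le {A x : ℝ} (hA : 1 ≤ A) {k n : ℕ} (hk : k ≤ n) :
    |x| ^ k ≤ (1 + A * x ^ 2) ^ n := by
  have h0 : |x| ≤ 1 + A * x ^ 2 := by
    have := sq_abs x
    nlinarith [sq_nonneg (|x| - 1), abs_nonneg x, sq_nonneg x]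
  calc |x| ^ k ≤ (1 + A * x ^ 2) ^ k := by gcongr
    _ ≤ _ := pow_le_pow_right₀ (by nlinarith [sq_nonneg x]) hk

theorem integrable_term (H : LaplaceFamily G s c) (i : ι) (k : ℕ) :
    Integrable fun x : ℝ =>
      iteratedDeriv k (gaussPhase (G i) (x ^ 2)) 0 / k.factorial * x ^ k := by
  obtain ⟨A, hA, h⟩ := H.bound_at k
  refine (integrable_poly_mul_gauss (by linarith : 0 ≤ A) H.pos (k + k)).mono' ?_
    (.of_forall fun x => ?_)
  · have := continuous_iteratedDeriv_gaussPhase (H.smooth i) k 0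
    exact (((this.comp (continuous_pow 2)).div_const _).mul (continuous_pow k)).aestronglyMeasurable
  · have h1 := h i k le_rfl 0 (H.zero_mem i) x
    rw [norm_mul, norm_div, Real.norm_eq_abs, Real.norm_natCast, norm_pow, Real.norm_eq_abs]
    have h2 : |iteratedDeriv k (gaussPhase (G i) (x ^ 2)) 0| / (k.factorial : ℝ) ≤
        (1 + A * x ^ 2) ^ k * Real.exp (-(2 * c * x ^ 2)) := by
      rw [div_le_iff₀ (by positivity)]; linarith
    calc _ ≤ (1 + A * x ^ 2) ^ k * Real.exp (-(2 * c * x ^ 2)) * (1 + A * x ^ 2) ^ k := by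
          exact mul_le_mul h2 (abs_pow_le hA le_rfl) (by positivity) (by positivity)
      _ = _ := by rw [pow_add]; ring

theorem abs_laplaceCoeff_le (H : LaplaceFamily G s c) (j : ℕ) :
    ∃ C, ∀ i, |laplaceCoeff (G i) j| ≤ C := by
  obtain ⟨A, hA, h⟩ := H.bound_at (2 * j)
  refine ⟨∫ x : ℝ, (1 + A * x ^ 2) ^ (2 * j + 2 * j) * Real.exp (-(2 * c * x ^ 2)), fun i => ?_⟩
  rw [← Real.norm_eq_abs, laplaceCoeff]
  refine norm_integral_le_of_norm_le
    (integrable_poly_mul_gauss (by linarith : 0 ≤ A) H.pos _) (.of_forall fun x => ?_)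
  have h1 := h i (2 * j) le_rfl 0 (H.zero_mem i) x
  rw [norm_mul, norm_div, Real.norm_eq_abs, Real.norm_natCast, norm_pow, Real.norm_eq_abs]
  have h2 : |iteratedDeriv (2 * j) (gaussPhase (G i) (x ^ 2)) 0| / ((2 * j).factorial : ℝ) ≤
      (1 + A * x ^ 2) ^ (2 * j) * Real.exp (-(2 * c * x ^ 2)) := by
    rw [div_le_iff₀ (by positivity)]; linarith
  calc _ ≤ (1 + A * x ^ 2) ^ (2 * j) * Real.exp (-(2 * c * x ^ 2)) * (1 + A * x ^ 2) ^ (2 * j) := by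
        exact mul_le_mul h2 (abs_pow_le hA le_rfl) (by positivity) (by positivity)
    _ = _ := by rw [pow_add]; ring

/-- Inside the domain this is Taylor's formula. Outside, the integrand is `0` and every Taylor term
has to be an error; there `|ε x| ≥ 1` because the domain contains `[-1, 1]`, so `|ε x| ^ k ≤ |ε x| ^
n` and each term already carries `ε ^ n`. No separate tail estimate is needed. -/
theorem pointwise (H : LaplaceFamily G s c) (n : ℕ) : ∃ A B, 1 ≤ A ∧ 0 ≤ B ∧ ∀ i, ∀ ε > 0, ∀ x : ℝ,
    |({x | ε * x ∈ s i}.indicator (fun x => gaussPhase (G i) (x ^ 2) (ε * x)) x)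
      - ∑ k ∈ Finset.range n,
        iteratedDeriv k (gaussPhase (G i) (x ^ 2)) 0 / k.factorial * (ε * x) ^ k| ≤
      ε ^ n * (B * ((1 + A * x ^ 2) ^ (n + n) * Real.exp (-(2 * c * x ^ 2)))) := by
  obtain ⟨A, hA, h⟩ := H.bound_at n
  -- `n!` serves the Taylor remainder inside the domain, `n` counts the Taylor terms outside it.
  refine ⟨A, n.factorial + n, hA, by positivity, fun i ε hε x => ?_⟩
  have hA0 : 1 ≤ 1 + A * x ^ 2 := by nlinarith [sq_nonneg x]
  have hxn : |ε * x| ^ n ≤ ε ^ n * (1 + A * x ^ 2) ^ n := by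
    rw [abs_mul, mul_pow, abs_of_pos hε]; exact mul_le_mul_of_nonneg_left (abs_pow_le hA le_rfl) (by positivity)
  by_cases hx : ε * x ∈ s i
  · rw [indicator_of_mem (by exact hx)]
    refine (abs_sub_taylor_sum_le (contDiff_gaussPhase (H.smooth i) _) n (fun y hy =>
      h i n le_rfl y ((H.conn i).uIcc_subset (H.zero_mem i) hx hy) x)).trans ?_
    calc _ ≤ (n.factorial + n : ℝ) * (1 + A * x ^ 2) ^ n * Real.exp (-(2 * c * x ^ 2)) *
          (ε ^ n * (1 + A * x ^ 2) ^ n) := by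
          gcongr; linarith [(Nat.cast_nonneg n : (0:ℝ) ≤ n)]
      _ = _ := by rw [pow_add]; ring
  · rw [indicator_of_notMem (by exact hx), zero_sub, abs_neg]
    have h1 : 1 ≤ |ε * x| := by
      by_contra hlt
      push Not at hlt
      exact hx (H.sub i ⟨(abs_lt.1 hlt).1.le, (abs_lt.1 hlt).2.le⟩)
    calc _ ≤ ∑ k ∈ Finset.range n, (1 + A * x ^ 2) ^ n * Real.exp (-(2 * c * x ^ 2)) *
          (ε ^ n * (1 + A * x ^ 2) ^ n) := by
          refine (Finset.abs_sum_le_sum_abs _ _).trans (Finset.sum_le_sum fun k hk => ?_)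
          have hk' := (Finset.mem_range.1 hk).le
          rw [abs_mul, abs_div, Nat.abs_cast, abs_pow]
          have h2 : |iteratedDeriv k (gaussPhase (G i) (x ^ 2)) 0| / (k.factorial : ℝ) ≤
              (1 + A * x ^ 2) ^ n * Real.exp (-(2 * c * x ^ 2)) := by
            rw [div_le_iff₀ (by positivity)]; linarith [h i k hk' 0 (H.zero_mem i) x]
          have h3 : |ε * x| ^ k ≤ ε ^ n * (1 + A * x ^ 2) ^ n :=
            (pow_le_pow_right₀ h1 hk').trans hxn
          gcongr
      _ = n * ((1 + A * x ^ 2) ^ n * Real.exp (-(2 * c * x ^ 2)) *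
          (ε ^ n * (1 + A * x ^ 2) ^ n)) := by simp
      _ ≤ (n.factorial + n : ℝ) * ((1 + A * x ^ 2) ^ n * Real.exp (-(2 * c * x ^ 2)) *
          (ε ^ n * (1 + A * x ^ 2) ^ n)) := by
          gcongr; linarith [(Nat.cast_nonneg n.factorial : (0:ℝ) ≤ n.factorial)]
      _ = _ := by rw [pow_add]; ring

theorem integrable_indicator (H : LaplaceFamily G s c) (i : ι) (ε : ℝ) :
    Integrable ({x | ε * x ∈ s i}.indicator (fun x => gaussPhase (G i) (x ^ 2) (ε * x))) := by
  have hg : Integrable fun x : ℝ => Real.exp (-(2 * c * x ^ 2)) := by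
    simpa using integrable_poly_mul_gauss le_rfl H.pos 0
  have hm : Measurable fun x => gaussPhase (G i) (x ^ 2) (ε * x) := by
    have := (H.smooth i).continuous.measurable
    unfold gaussPhase; fun_prop
  refine hg.mono' (hm.indicator (H.measurableSet i ε)).aestronglyMeasurable
    (.of_forall fun x => ?_)
  by_cases hx : ε * x ∈ s i
  · rw [indicator_of_mem (by exact hx), gaussPhase, Real.norm_of_nonneg (Real.exp_pos _).le]
    apply Real.exp_le_exp.2
    nlinarith [H.le i _ hx, sq_nonneg x]
  · rw [indicator_of_notMem (by exact hx)]; simp [(Real.exp_pos _).le]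

theorem integral_odd_term (G : ℝ → ℝ) {k : ℕ} (hk : Odd k) :
    ∫ x : ℝ, iteratedDeriv k (gaussPhase G (x ^ 2)) 0 / k.factorial * x ^ k = 0 := by
  have h := integral_neg_eq_self
    (fun x : ℝ => iteratedDeriv k (gaussPhase G (x ^ 2)) 0 / k.factorial * x ^ k) volume
  simp only [neg_sq, hk.neg_pow, mul_neg, integral_neg] at h
  linarith

/-- Expanding to order `2 N` and integrating term by term leaves only even powers of `ε`: the phase
enters through `x²`, so odd terms are odd functions of `x`. -/
theorem expansion (H : LaplaceFamily G s c) (N : ℕ) : ∃ C, 0 ≤ C ∧ ∀ i, ∀ ε > 0,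
    |laplaceInt (G i) (s i) ε - ∑ j ∈ Finset.range N, laplaceCoeff (G i) j * (ε ^ 2) ^ j| ≤
      C * (ε ^ 2) ^ N := by
  obtain ⟨A, B, hA, hB, h⟩ := H.pointwise (2 * N)
  have hint := integrable_poly_mul_gauss (by linarith : 0 ≤ A) H.pos (2 * N + 2 * N)
  refine ⟨B * ∫ x : ℝ, ((1 + A * x ^ 2) ^ (2 * N + 2 * N) * Real.exp (-(2 * c * x ^ 2))),
    mul_nonneg hB (integral_nonneg fun x => by positivity), fun i ε hε => ?_⟩
  have hterm : ∀ k : ℕ, (fun x : ℝ => iteratedDeriv k (gaussPhase (G i) (x ^ 2)) 0 / k.factorial *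
      (ε * x) ^ k) = fun x => ε ^ k * (iteratedDeriv k (gaussPhase (G i) (x ^ 2)) 0 /
        k.factorial * x ^ k) := by
    intro k; ext x; rw [mul_pow]; ring
  have hti : ∀ k : ℕ, Integrable (fun x : ℝ => iteratedDeriv k (gaussPhase (G i) (x ^ 2)) 0 /
      k.factorial * (ε * x) ^ k) := fun k => by
    rw [hterm]; exact (H.integrable_term i k).const_mul _
  have hsum : ∑ j ∈ Finset.range N, laplaceCoeff (G i) j * (ε ^ 2) ^ j =
      ∫ x : ℝ, ∑ k ∈ Finset.range (2 * N), iteratedDeriv k (gaussPhase (G i) (x ^ 2)) 0 /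
        k.factorial * (ε * x) ^ k := by
    rw [integral_finsetSum _ fun k _ => hti k]
    clear h hint
    -- One step adds the two Taylor terms of orders `2 N` and `2 N + 1`; the second integrates to
    -- zero.
    induction N with
    | zero => simp
    | succ N ih =>
      rw [Finset.sum_range_succ, ih, mul_add, mul_one, Finset.sum_range_succ,
        Finset.sum_range_succ, hterm (2 * N + 1), integral_const_mul,
        integral_odd_term _ (odd_two_mul_add_one N), mul_zero, add_zero, hterm (2 * N),
        integral_const_mul, laplaceCoeff, pow_mul, mul_comm]
      ring
  rw [hsum, laplaceInt, ← integral_indicator (H.measurableSet i ε),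
    ← integral_sub (H.integrable_indicator i ε) (integrable_finsetSum _ fun k _ => hti k)]
  rw [← Real.norm_eq_abs]
  refine (norm_integral_le_of_norm_le ((hint.const_mul B).const_mul (ε ^ (2 * N)))
    (.of_forall fun x => (Real.norm_eq_abs _).trans_le (h i ε hε x))).trans_eq ?_
  rw [integral_const_mul, integral_const_mul, pow_mul]; ring

theorem laplaceCoeff_zero (G : ℝ → ℝ) :
    laplaceCoeff G 0 = Real.sqrt (Real.pi / (2 * G 0)) := by
  rw [← integral_gaussian]
  simp only [laplaceCoeff, gaussPhase, mul_zero, iteratedDeriv_zero, Nat.factorial_zero,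
    Nat.cast_one, div_one, pow_zero, mul_one]
  congr 1; ext x; congr 1; ring

/-- On the interval `]0, 1/(1 + |R|)]` both `x` and `ε x` are at most `1`, so the integrand is
bounded below there. It matters that `ε` is only bounded: this permits dividing by the Laplace
integral for all `ε ≤ R`, where the expansion says nothing about positivity. -/
theorem laplaceInt_lower (H : LaplaceFamily G s c) (R : ℝ) : ∃ δ > 0, ∀ i, ∀ ε > 0, ε ≤ R →
    δ ≤ laplaceInt (G i) (s i) ε := by
  obtain ⟨M, hM⟩ := H.bound_zero
  refine ⟨(1 + |R|)⁻¹ * Real.exp (-(2 * |M|)), by positivity, fun i ε hε hεR => ?_⟩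
  rw [laplaceInt, ← integral_indicator (H.measurableSet i ε)]
  have hsub : ∀ x ∈ Ioc 0 (1 + |R|)⁻¹, ε * x ∈ Icc (0 : ℝ) 1 ∧ x ≤ 1 := by
    intro x hx
    have h1 : 0 < 1 + |R| := by positivity
    have h2 : (1 + |R|) * x ≤ 1 := by
      calc _ ≤ (1 + |R|) * (1 + |R|)⁻¹ := by gcongr; exact hx.2
        _ = 1 := mul_inv_cancel₀ h1.ne'
    have h3 := le_abs_self R
    have h4 := abs_nonneg R
    refine ⟨⟨(mul_pos hε hx.1).le, ?_⟩, ?_⟩ <;> nlinarith [hx.1]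
  calc (1 + |R|)⁻¹ * Real.exp (-(2 * |M|))
      = ∫ x : ℝ, (Ioc 0 (1 + |R|)⁻¹).indicator (fun _ => Real.exp (-(2 * |M|))) x := by
        rw [integral_indicator measurableSet_Ioc]
        simp [(by positivity : 0 ≤ 1 + |R|)]
    _ ≤ _ := by
        refine integral_mono ?_ (H.integrable_indicator i ε) fun x => ?_
        · exact (integrable_indicator_iff measurableSet_Ioc).2 (by simp)
        · by_cases hx : x ∈ Ioc 0 (1 + |R|)⁻¹
          · obtain ⟨h1, h2⟩ := hsub x hx
            have hs : ε * x ∈ s i := H.sub i ⟨by linarith [h1.1], h1.2⟩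
            simp only
            rw [indicator_of_mem hx, indicator_of_mem (by exact hs), gaussPhase]
            apply Real.exp_le_exp.2
            have h3 : x ^ 2 ≤ 1 := by nlinarith [hx.1]
            have h4 := hM i _ h1
            have h5 := H.le i _ hs
            have h6 := H.pos
            have h7 := le_abs_self M
            nlinarith
          · simp only
            rw [indicator_of_notMem hx]
            exact indicator_nonneg (fun _ _ => (Real.exp_pos _).le) x

end LaplaceFamily

/-! ## The second order Hadamard quotient -/

/-- `∫₀¹ (1 - s) g (s v) ds`, so that `v²` times it is the second order Taylor remainder of a second
primitive of `g`. -/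
noncomputable def hadamardQuot (g : ℝ → ℝ) (v : ℝ) : ℝ :=
  ∫ s in (0 : ℝ)..1, (1 - s) * g (s * v)

/-- Differentiation under the integral sign, dominated on the unit ball around `v`; each derivative
in `v` produces one factor `s`. -/
theorem hasDerivAt_hadamard_aux {g : ℝ → ℝ} (hg : ContDiff ℝ ∞ g) (k : ℕ) (v : ℝ) :
    HasDerivAt (fun v => ∫ s in (0 : ℝ)..1, (1 - s) * s ^ k * iteratedDeriv k g (s * v))
      (∫ s in (0 : ℝ)..1, (1 - s) * s ^ (k + 1) * iteratedDeriv (k + 1) g (s * v)) v := by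
  have hc : ∀ k : ℕ, Continuous (iteratedDeriv k g) := fun k =>
    hg.continuous_iteratedDeriv k (by exact_mod_cast le_top)
  obtain ⟨B, hB⟩ := (isCompact_Icc (a := -(|v| + 1)) (b := |v| + 1)).exists_bound_of_continuousOn
    (hc (k + 1)).continuousOn
  have hF : ∀ k : ℕ, ∀ v, Continuous fun s : ℝ => (1 - s) * s ^ k * iteratedDeriv k g (s * v) := by
    intro k v
    have := hc k
    fun_prop
  refine (intervalIntegral.hasDerivAt_integral_of_dominated_loc_of_deriv_le
    (F := fun v s => (1 - s) * s ^ k * iteratedDeriv k g (s * v))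
    (F' := fun v s => (1 - s) * s ^ (k + 1) * iteratedDeriv (k + 1) g (s * v))
    (bound := fun _ => B) (Metric.ball_mem_nhds v one_pos)
    (.of_forall fun x => (hF k x).aestronglyMeasurable) ((hF k v).intervalIntegrable _ _)
    (hF (k + 1) v).aestronglyMeasurable (.of_forall fun s hs x hx => ?_) (by simp)
    (.of_forall fun s hs x hx => ?_)).2
  · rw [uIoc_of_le zero_le_one] at hs
    have hx' : |x| ≤ |v| + 1 := by
      have := abs_sub_abs_le_abs_sub x v
      rw [Metric.mem_ball, Real.dist_eq] at hx
      linarith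
    have h1 : |s * x| ≤ |v| + 1 := by
      rw [abs_mul, abs_of_pos hs.1]
      nlinarith [abs_nonneg x, hs.2, hs.1]
    have h2 := hB (s * x) (abs_le.1 h1)
    rw [norm_mul, Real.norm_of_nonneg (mul_nonneg (by linarith [hs.2]) (by have := hs.1; positivity))]
    have h3 : (1 - s) * s ^ (k + 1) ≤ 1 :=
      mul_le_one₀ (by linarith [hs.1]) (by have := hs.1; positivity) (pow_le_one₀ hs.1.le hs.2)
    nlinarith [norm_nonneg (iteratedDeriv (k + 1) g (s * x))]
  · have h1 : HasDerivAt (iteratedDeriv k g) (iteratedDeriv (k + 1) g (s * x)) (s * x) := by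
      rw [iteratedDeriv_succ]
      exact (hg.differentiable_iteratedDeriv k (by exact_mod_cast WithTop.coe_lt_top _) _).hasDerivAt
    have h2 : HasDerivAt (fun x => s * x) s x := by simpa using (hasDerivAt_id x).const_mul s
    refine ((h1.comp x h2).const_mul ((1 - s) * s ^ k)).congr_deriv ?_
    ring

theorem iteratedDeriv_hadamardQuot {g : ℝ → ℝ} (hg : ContDiff ℝ ∞ g) (k : ℕ) :
    iteratedDeriv k (hadamardQuot g) =
      fun v => ∫ s in (0 : ℝ)..1, (1 - s) * s ^ k * iteratedDeriv k g (s * v) := by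
  induction k with
  | zero => ext v; simp [hadamardQuot]
  | succ k ih => rw [iteratedDeriv_succ, ih]; ext v; exact (hasDerivAt_hadamard_aux hg k v).deriv

theorem contDiff_hadamardQuot {g : ℝ → ℝ} (hg : ContDiff ℝ ∞ g) :
    ContDiff ℝ ∞ (hadamardQuot g) := by
  refine contDiff_of_differentiable_iteratedDeriv fun k _ => ?_
  rw [iteratedDeriv_hadamardQuot hg]
  exact fun v => (hasDerivAt_hadamard_aux hg k v).differentiableAt

/-- The weight `(1 - s) s ^ k` lies in `[0, 1]`, so dividing by `v²` costs nothing in the derivative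
bounds, even near `v = 0`. -/
theorem abs_iteratedDeriv_hadamardQuot_le {g : ℝ → ℝ} (hg : ContDiff ℝ ∞ g) {k : ℕ} {B : ℝ}
    (hB : ∀ t, |iteratedDeriv k g t| ≤ B) (v : ℝ) :
    |iteratedDeriv k (hadamardQuot g) v| ≤ B := by
  rw [iteratedDeriv_hadamardQuot hg, ← Real.norm_eq_abs]
  refine (intervalIntegral.norm_integral_le_of_norm_le_const (C := B) fun s hs => ?_).trans_eq
    (by simp)
  rw [uIoc_of_le zero_le_one] at hs
  have h0 : 0 ≤ B := (abs_nonneg _).trans (hB 0)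
  rw [norm_mul, Real.norm_of_nonneg (mul_nonneg (by linarith [hs.2]) (by have := hs.1; positivity))]
  have h3 : (1 - s) * s ^ k ≤ 1 :=
    mul_le_one₀ (by linarith [hs.1]) (by have := hs.1; positivity) (pow_le_one₀ hs.1.le hs.2)
  have := hB (s * v)
  rw [Real.norm_eq_abs]
  nlinarith [abs_nonneg (iteratedDeriv k g (s * v))]

theorem le_hadamardQuot {g l : ℝ → ℝ} (hg : Continuous g) (hl : Continuous l) {v : ℝ}
    (h : ∀ s ∈ Icc (0 : ℝ) 1, l s ≤ g (s * v)) :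
    ∫ s in (0 : ℝ)..1, (1 - s) * l s ≤ hadamardQuot g v := by
  refine intervalIntegral.integral_mono_on zero_le_one ?_ ?_ fun s hs => ?_
  · exact Continuous.intervalIntegrable (by fun_prop) _ _
  · exact Continuous.intervalIntegrable (by fun_prop) _ _
  · exact mul_le_mul_of_nonneg_left (h s hs) (by linarith [hs.2])

/-! ## The model phase -/

/-- `sin (θ (1 + t)) / θ`, extended by continuity to `θ = 0`. -/
noncomputable def modelCurv (θ t : ℝ) : ℝ :=
  if θ = 0 then 1 + t else Real.sin (θ * (1 + t)) / θ

/-- The model phase is `v² modelPhase θ v`. -/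
noncomputable def modelPhase (θ : ℝ) : ℝ → ℝ := hadamardQuot (modelCurv θ)

/-- The domain of the model phase. -/
def modelDom (θ : ℝ) : Set ℝ := {v | -1 ≤ v ∧ θ * (1 + v) ≤ 2 * Real.pi}

/-- The denominator `θ` cancels, so all derivatives stay bounded as `θ → 0`. This is what joins the
cubic of the line and the sine of the circle in one uniformly smooth family. -/
theorem hasDerivAt_modelCurv (θ t : ℝ) :
    HasDerivAt (modelCurv θ) (Real.cos (θ * (1 + t))) t := by
  by_cases h : θ = 0
  · subst h
    have : modelCurv 0 = fun t => 1 + t := by ext; simp [modelCurv]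
    rw [this]
    simpa using (hasDerivAt_id t).const_add 1
  · have h1 : modelCurv θ = fun t => Real.sin (θ * (1 + t)) / θ := by ext; simp [modelCurv, h]
    rw [h1]
    have h2 : HasDerivAt (fun t => θ * (1 + t)) θ t := by
      simpa using ((hasDerivAt_id t).const_add 1).const_mul θ
    have := h2.sin.div_const θ
    rwa [mul_div_assoc, div_self h, mul_one] at this

theorem deriv_modelCurv (θ : ℝ) : deriv (modelCurv θ) = fun t => Real.cos (θ * (1 + t)) :=
  funext fun t => (hasDerivAt_modelCurv θ t).deriv

theorem contDiff_modelCurv (θ : ℝ) : ContDiff ℝ ∞ (modelCurv θ) := by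
  refine contDiff_infty_iff_deriv.2 ⟨fun t => (hasDerivAt_modelCurv θ t).differentiableAt, ?_⟩
  rw [deriv_modelCurv]; fun_prop

theorem iteratedDeriv_modelCurv (θ : ℝ) (k : ℕ) : iteratedDeriv (k + 1) (modelCurv θ) =
    fun t => θ ^ k * Real.cos (θ * (1 + t) + k * (Real.pi / 2)) := by
  induction k with
  | zero => ext t; simp [iteratedDeriv_one, deriv_modelCurv]
  | succ k ih =>
    rw [iteratedDeriv_succ, ih]
    ext t
    have h2 : HasDerivAt (fun t => θ * (1 + t) + k * (Real.pi / 2)) θ t := by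
      simpa using (((hasDerivAt_id t).const_add 1).const_mul θ).add_const (k * (Real.pi / 2))
    rw [(h2.cos.const_mul (θ ^ k)).deriv]
    have : θ * (1 + t) + ((k + 1 : ℕ) : ℝ) * (Real.pi / 2) =
      θ * (1 + t) + k * (Real.pi / 2) + Real.pi / 2 := by push_cast; ring
    rw [this, Real.cos_add_pi_div_two]
    ring

theorem modelCurv_zero_right (θ : ℝ) : modelCurv θ 0 = if θ = 0 then 1 else Real.sin θ / θ := by
  simp [modelCurv]

theorem modelPhase_zero_right (θ : ℝ) : modelPhase θ 0 = modelCurv θ 0 / 2 := by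
  simp only [modelPhase, hadamardQuot, mul_zero, intervalIntegral.integral_mul_const]
  have : ∫ s in (0 : ℝ)..1, (1 - s) = 1 / 2 := by
    rw [intervalIntegral.integral_sub (by simp) (by simp)]; simp; norm_num
  rw [this]; ring

/-- Up to the factor `2 x³` and the additive constant `-2 x³ / 3`, this is the cubic `lineWeight x`
at `x (1 + v)`. -/
theorem sq_mul_modelPhase_zero (v : ℝ) : v ^ 2 * modelPhase 0 v = v ^ 2 / 2 + v ^ 3 / 6 := by
  have h : ∀ s ∈ uIcc (0 : ℝ) 1, HasDerivAt
      (fun s : ℝ => s - s ^ 2 / 2 + v * (s ^ 2 / 2 - s ^ 3 / 3)) ((1 - s) * modelCurv 0 (s * v)) s := by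
    intro s _
    have h1 := (hasDerivAt_pow 2 s).div_const 2
    have h2 := (hasDerivAt_pow 3 s).div_const 3
    refine (((hasDerivAt_id s).sub h1).add ((h1.sub h2).const_mul v)).congr_deriv ?_
    simp [modelCurv]; ring
  have hc := (contDiff_modelCurv 0).continuous
  rw [modelPhase, hadamardQuot, intervalIntegral.integral_eq_sub_of_hasDerivAt h
    (Continuous.intervalIntegrable (by fun_prop) _ _)]
  ring

/-- The right-hand side is `circWeight θ` at `θ (1 + v)` minus its value at the critical point `θ`.
-/
theorem cube_mul_modelPhase {θ : ℝ} (hθ : θ ≠ 0) (v : ℝ) : θ ^ 3 * (v ^ 2 * modelPhase θ v) =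
    Real.sin θ + θ * v * Real.cos θ - Real.sin (θ * (1 + v)) := by
  rcases eq_or_ne v 0 with rfl | hv
  · simp
  -- The primitive comes from one integration by parts in `s`; it divides by `v`, whence the
  -- separate case `v = 0`.
  have h : ∀ s ∈ uIcc (0 : ℝ) 1, HasDerivAt (fun s : ℝ => -((1 - s) * Real.cos (θ * (1 + s * v)) /
      (θ ^ 2 * v)) - Real.sin (θ * (1 + s * v)) / (θ ^ 3 * v ^ 2))
      ((1 - s) * modelCurv θ (s * v)) s := by
    intro s _
    have h2 : HasDerivAt (fun s => θ * (1 + s * v)) (θ * v) s := by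
      simpa using (((hasDerivAt_id s).mul_const v).const_add 1).const_mul θ
    have h3 : HasDerivAt (fun s : ℝ => 1 - s) (-1) s := by
      simpa using (hasDerivAt_id s).const_sub 1
    refine ((((h3.mul h2.cos).div_const (θ ^ 2 * v)).neg).sub
      (h2.sin.div_const (θ ^ 3 * v ^ 2))).congr_deriv ?_
    simp [modelCurv, hθ]; field_simp; ring
  have hc := (contDiff_modelCurv θ).continuous
  rw [modelPhase, hadamardQuot, intervalIntegral.integral_eq_sub_of_hasDerivAt h
    (Continuous.intervalIntegrable (by fun_prop) _ _)]
  simp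
  field_simp
  ring

/-- The range of angles. -/
abbrev Angle : Type := Icc (0 : ℝ) (Real.pi / 2)

theorem two_div_pi_mul_le_modelCurv {θ t : ℝ} (hθ : θ ∈ Icc 0 (Real.pi / 2)) (ht : t ∈ Icc (-1) 0) :
    2 / Real.pi * (1 + t) ≤ modelCurv θ t := by
  unfold modelCurv
  have hpi := Real.pi_pos
  have ht1 : 0 ≤ 1 + t := by linarith [ht.1]
  split_ifs with h
  · have : 2 / Real.pi ≤ 1 := by rw [div_le_one hpi]; exact Real.two_le_pi
    nlinarith
  · have h0 : 0 < θ := lt_of_le_of_ne hθ.1 (Ne.symm h)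
    rw [le_div_iff₀ h0]
    have := Real.mul_le_sin (x := θ * (1 + t)) (by positivity) (by nlinarith [ht.2, hθ.2])
    linarith

/-- With `u = θ v` the phase is `sin θ (1 - cos u) + cos θ (u - sin u)`, a sum of nonnegative terms.
For `u ≤ π` the first term suffices, by Jordan's inequality and the quadratic bound for the cosine.
For `u > π` the first term can degenerate, but `θ + u ≤ 2π` gives `cos u ≤ cos θ` and `sin u ≤ 0`,
and the second term makes up the loss, so that the total is at least `sin θ`. -/
theorem modelPhase_lower_aux {θ v : ℝ} (hθ : θ ∈ Icc 0 (Real.pi / 2)) (h1 : 0 < θ) (hv0 : 0 < v)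
    (h2 : θ * (1 + v) ≤ 2 * Real.pi) :
    θ * (θ * v) ^ 2 / (2 * Real.pi ^ 3) ≤ Real.sin θ + θ * v * Real.cos θ - Real.sin (θ * (1 + v)) := by
  have hpi := Real.pi_pos
  set u := θ * v with hu
  have hu0 : 0 < u := mul_pos h1 hv0
  have e : Real.sin (θ * (1 + v)) = Real.sin θ * Real.cos u + Real.cos θ * Real.sin u := by
    rw [mul_add, mul_one, Real.sin_add]
  have hs := Real.mul_le_sin hθ.1 hθ.2
  have hs0 : 0 < Real.sin θ := Real.sin_pos_of_pos_of_lt_pi h1 (by linarith [hθ.2])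
  have hc : 0 ≤ Real.cos θ := Real.cos_nonneg_of_neg_pi_div_two_le_of_le (by linarith) hθ.2
  rw [e]
  rcases le_or_gt u Real.pi with hup | hup
  · have hq := Real.cos_le_one_sub_mul_cos_sq (x := u) (by rwa [abs_of_pos hu0])
    have hsu := Real.sin_le hu0.le
    have : θ * u ^ 2 / (2 * Real.pi ^ 3) ≤ (2 / Real.pi * θ) * (2 / Real.pi ^ 2 * u ^ 2) := by
      have e1 : (2 / Real.pi * θ) * (2 / Real.pi ^ 2 * u ^ 2) = 8 * (θ * u ^ 2 / (2 * Real.pi ^ 3)) := by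
        field_simp; ring
      have : 0 ≤ θ * u ^ 2 / (2 * Real.pi ^ 3) := by positivity
      linarith
    have h4 : (2 / Real.pi * θ) * (2 / Real.pi ^ 2 * u ^ 2) ≤ Real.sin θ * (1 - Real.cos u) :=
      mul_le_mul hs (by linarith) (by positivity) hs0.le
    nlinarith [mul_nonneg hc (sub_nonneg.2 hsu)]
  · have hu2 : u ≤ 2 * Real.pi - θ := by linarith
    have h3 : Real.cos u ≤ Real.cos θ := by
      rw [← Real.cos_two_pi_sub u]
      exact Real.cos_le_cos_of_nonneg_of_le_pi h1.le (by linarith) (by linarith)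
    have h4 : Real.sin u ≤ 0 := by
      have := Real.sin_nonneg_of_nonneg_of_le_pi (x := u - Real.pi) (by linarith) (by linarith)
      rw [Real.sin_sub_pi] at this; linarith
    have h5 : θ * u ^ 2 / (2 * Real.pi ^ 3) ≤ 2 / Real.pi * θ := by
      rw [div_le_iff₀ (by positivity)]
      have e1 : 2 / Real.pi * θ * (2 * Real.pi ^ 3) = θ * (2 * Real.pi) ^ 2 := by field_simp
      rw [e1]; gcongr; linarith
    have h6 : Real.sin θ ≤ 1 := Real.sin_le_one θ
    nlinarith [mul_nonneg hs0.le (sub_nonneg.2 h3), mul_nonneg hc (by linarith [Real.pi_gt_three] :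
      0 ≤ u - Real.sin u - Real.sin θ)]

/-- A global and uniform nondegeneracy: on the whole domain, not only near `0`, the phase is at
least a fixed multiple of `v²`. To the left of `0` the curvature `modelCurv` is itself nonnegative
and Jordan's inequality is integrated. To the right it may change sign, and the closed formulas are
used. -/
theorem modelPhase_ge {θ v : ℝ} (hθ : θ ∈ Icc 0 (Real.pi / 2)) (hv : v ∈ modelDom θ) :
    1 / (2 * Real.pi ^ 3) ≤ modelPhase θ v := by
  have hpi := Real.pi_pos
  have hcont := (contDiff_modelCurv θ).continuous
  rcases le_or_gt v 0 with hv0 | hv0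
  · have h := le_hadamardQuot hcont (l := fun s => 2 / Real.pi * (1 - s)) (v := v) (by fun_prop)
      (fun s hs => (by
        have := two_div_pi_mul_le_modelCurv (t := s * v) hθ
          ⟨by nlinarith [hs.1, hs.2, hv.1], by nlinarith [hs.1]⟩
        refine le_trans ?_ this
        gcongr
        nlinarith [hs.1, hs.2, hv.1]))
    have e : ∫ s in (0 : ℝ)..1, (1 - s) * (2 / Real.pi * (1 - s)) = 2 / Real.pi / 3 := by
      have hd : ∀ s ∈ uIcc (0 : ℝ) 1, HasDerivAt (fun s : ℝ => 2 / Real.pi * (s - s ^ 2 + s ^ 3 / 3))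
          ((1 - s) * (2 / Real.pi * (1 - s))) s := by
        intro s _
        refine ((((hasDerivAt_id s).sub (hasDerivAt_pow 2 s)).add
          ((hasDerivAt_pow 3 s).div_const 3)).const_mul (2 / Real.pi)).congr_deriv ?_
        simp; ring
      rw [intervalIntegral.integral_eq_sub_of_hasDerivAt hd
        (Continuous.intervalIntegrable (by fun_prop) _ _)]
      norm_num; ring
    rw [e] at h
    refine le_trans ?_ h
    rw [div_div, div_le_div_iff₀ (by positivity) (by positivity)]
    have : (3 : ℝ) < Real.pi := Real.pi_gt_three
    have : 9 ≤ Real.pi ^ 2 := by nlinarith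
    nlinarith
  · rcases eq_or_ne θ 0 with rfl | h0
    · have h := sq_mul_modelPhase_zero v
      have : modelPhase 0 v = 1 / 2 + v / 6 := by
        have hv2 : v ^ 2 ≠ 0 := by positivity
        apply mul_left_cancel₀ hv2; rw [h]; ring
      rw [this, div_le_iff₀ (by positivity)]
      have : 3 ^ 3 ≤ Real.pi ^ 3 := pow_le_pow_left₀ (by norm_num) Real.pi_gt_three.le 3
      nlinarith
    · have h1 : 0 < θ := lt_of_le_of_ne hθ.1 (Ne.symm h0)
      have h := modelPhase_lower_aux hθ h1 hv0 hv.2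
      rw [← cube_mul_modelPhase h0] at h
      have e : θ * (θ * v) ^ 2 / (2 * Real.pi ^ 3) = θ ^ 3 * v ^ 2 * (1 / (2 * Real.pi ^ 3)) := by
        field_simp
      rw [e, ← mul_assoc] at h
      exact le_of_mul_le_mul_left h (by positivity)

theorem modelCurv_le {θ t : ℝ} (hθ : 0 ≤ θ) (ht : -1 ≤ t) : modelCurv θ t ≤ 1 + t := by
  unfold modelCurv
  split_ifs with h
  · rfl
  · have h0 : 0 < θ := lt_of_le_of_ne hθ (Ne.symm h)
    rw [div_le_iff₀ h0]
    have := Real.sin_le (x := θ * (1 + t)) (mul_nonneg hθ (by linarith))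
    linarith

theorem modelFamily : LaplaceFamily (fun θ : Angle => modelPhase θ) (fun θ : Angle => modelDom θ)
    (1 / (2 * Real.pi ^ 3)) where
  smooth θ := contDiff_hadamardQuot (contDiff_modelCurv _)
  bound n := by
    refine ⟨2 ^ n, by positivity, fun θ k hk hkn v _ => ?_⟩
    refine abs_iteratedDeriv_hadamardQuot_le (contDiff_modelCurv _) (fun t => ?_) v
    obtain ⟨k, rfl⟩ := Nat.exists_eq_succ_of_ne_zero (by omega : k ≠ 0)
    rw [Nat.succ_eq_add_one, iteratedDeriv_modelCurv, abs_mul, abs_pow, abs_of_nonneg θ.2.1]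
    have h1 : (θ : ℝ) ≤ 2 := θ.2.2.trans (by linarith [Real.pi_le_four])
    calc _ ≤ (2 : ℝ) ^ k * 1 := by
          gcongr
          · exact θ.2.1
          · exact Real.abs_cos_le_one _
      _ ≤ 2 ^ n := by rw [mul_one]; exact pow_le_pow_right₀ (by norm_num) (by omega)
  bound_zero := by
    refine ⟨2, fun θ v hv => ?_⟩
    have hc := (contDiff_modelCurv θ).continuous
    -- An upper bound for the phase is the lower bound for the quotient of `-modelCurv`; for `v ≤ 1`
    -- the curvature is at most `2`.
    have h := le_hadamardQuot (g := fun t => -modelCurv θ t) hc.neg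
      (l := fun _ => -2) continuous_const (v := v) (fun s hs => by
        have := modelCurv_le (t := s * v) θ.2.1 (by nlinarith [hs.1, hv.1])
        nlinarith [hs.1, hs.2, hv.1, hv.2])
    have e : hadamardQuot (fun t => -modelCurv θ t) v = -modelPhase θ v := by
      simp [hadamardQuot, modelPhase]
    rw [e, intervalIntegral.integral_mul_const, intervalIntegral.integral_sub (by simp) (by simp)] at h
    simp at h
    linarith
  conn θ := by
    refine ⟨fun a ha b hb x hx => ⟨ha.1.trans hx.1, le_trans ?_ hb.2⟩⟩
    have := hx.2
    have := θ.2.1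
    gcongr
  sub θ v hv := ⟨hv.1, by nlinarith [hv.1, hv.2, θ.2.1, θ.2.2]⟩
  pos := by have := Real.pi_pos; positivity
  le θ v hv := modelPhase_ge θ.2 hv

/-! ## Inverting an asymptotic expansion -/

/-- The coefficients of the inverse of the power series with coefficients `a`. -/
noncomputable def invCoeff (a : ℕ → ℝ) (j : ℕ) : ℝ := PowerSeries.coeff j (PowerSeries.mk a)⁻¹

theorem invCoeff_zero (a : ℕ → ℝ) : invCoeff a 0 = (a 0)⁻¹ := by
  simp [invCoeff, PowerSeries.coeff_inv, ← PowerSeries.coeff_zero_eq_constantCoeff_apply]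

/-- Strong induction along the recursion for the inverse power series; the only division is by the
constant term, which is at least `α`. -/
theorem abs_invCoeff_le {ι : Type} {a : ι → ℕ → ℝ} (ha : ∀ j, ∃ C, ∀ i, |a i j| ≤ C) {α : ℝ}
    (hα : 0 < α) (h0 : ∀ i, α ≤ a i 0) (j : ℕ) : ∃ C, 0 ≤ C ∧ ∀ i, |invCoeff (a i) j| ≤ C := by
  have hinv : ∀ i, |(a i 0)⁻¹| ≤ α⁻¹ := fun i => by
    rw [abs_inv, abs_of_pos (hα.trans_le (h0 i))]
    exact inv_anti₀ hα (h0 i)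
  induction j using Nat.strong_induction_on with
  | _ j ih =>
    rcases Nat.eq_zero_or_pos j with rfl | hj
    · exact ⟨α⁻¹, by positivity, fun i => by rw [invCoeff_zero]; exact hinv i⟩
    choose! D hD0 hD using ih
    choose C hC using ha
    refine ⟨α⁻¹ * ∑ x ∈ Finset.HasAntidiagonal.antidiagonal j, |C x.1| * |D x.2|, by positivity, fun i => ?_⟩
    rw [invCoeff, PowerSeries.coeff_inv, if_neg hj.ne', abs_mul, abs_neg,
      ← PowerSeries.coeff_zero_eq_constantCoeff_apply, PowerSeries.coeff_mk]
    refine mul_le_mul (hinv i) ((Finset.abs_sum_le_sum_abs _ _).trans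
      (Finset.sum_le_sum fun x _ => ?_)) (abs_nonneg _) (by positivity)
    split_ifs with h
    · rw [abs_mul, PowerSeries.coeff_mk]
      exact mul_le_mul ((hC _ i).trans (le_abs_self _)) ((hD _ h i).trans (le_abs_self _))
        (abs_nonneg _) (abs_nonneg _)
    · rw [abs_zero]; positivity

theorem abs_sum_mul_pow_le {D : ℕ → ℝ} {d : ℕ → ℝ} (hD : ∀ j, |d j| ≤ D j) {H h : ℝ} (h0 : 0 ≤ h)
    (hH : h ≤ H) (s : Finset ℕ) : |∑ j ∈ s, d j * h ^ j| ≤ ∑ j ∈ s, D j * H ^ j := by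
  refine (Finset.abs_sum_le_sum_abs _ _).trans (Finset.sum_le_sum fun j _ => ?_)
  rw [abs_mul, abs_pow, abs_of_nonneg h0]
  have := (abs_nonneg _).trans (hD j)
  gcongr
  exact hD j

/-- The product of the two truncations is a polynomial of degree below `2 N` that agrees with `1` up
to order `N - 1`. What remains is `h ^ N` times a polynomial with uniformly bounded coefficients. -/
theorem trunc_mul_inv {ι : Type} {a : ι → ℕ → ℝ} (ha : ∀ j, ∃ C, ∀ i, |a i j| ≤ C) {α : ℝ}
    (hα : 0 < α) (h0 : ∀ i, α ≤ a i 0) (N : ℕ) {H : ℝ} (hH : 0 < H) :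
    ∃ C, 0 ≤ C ∧ ∀ i, ∀ h, 0 < h → h ≤ H →
      |1 - (∑ j ∈ Finset.range N, a i j * h ^ j) * ∑ j ∈ Finset.range N, invCoeff (a i) j * h ^ j| ≤
        C * h ^ N := by
  choose A hA using ha
  choose D hD0 hD using abs_invCoeff_le (fun j => ⟨A j, hA j⟩) hα h0
  rcases Nat.eq_zero_or_pos N with rfl | hN
  · exact ⟨1, zero_le_one, fun i h _ _ => by simp⟩
  set P : ι → Polynomial ℝ := fun i => PowerSeries.trunc N (PowerSeries.mk (a i))
  set Q : ι → Polynomial ℝ := fun i => PowerSeries.trunc N (PowerSeries.mk (a i))⁻¹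
  have hdegT : ∀ φ : PowerSeries ℝ, (PowerSeries.trunc N φ).natDegree < N := fun φ => by
    obtain ⟨n, rfl⟩ := Nat.exists_eq_succ_of_ne_zero hN.ne'
    exact PowerSeries.natDegree_trunc_lt φ n
  have hP : ∀ i h, (P i).eval h = ∑ j ∈ Finset.range N, a i j * h ^ j := fun i h => by
    rw [Polynomial.eval_eq_sum_range' (hdegT _)]
    refine Finset.sum_congr rfl fun j hj => ?_
    simp [PowerSeries.coeff_trunc, Finset.mem_range.1 hj]
  have hQ : ∀ i h, (Q i).eval h = ∑ j ∈ Finset.range N, invCoeff (a i) j * h ^ j := fun i h => by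
    rw [Polynomial.eval_eq_sum_range' (hdegT _)]
    refine Finset.sum_congr rfl fun j hj => ?_
    simp [PowerSeries.coeff_trunc, Finset.mem_range.1 hj, invCoeff]
  set B : ℕ → ℝ := fun n => ∑ x ∈ Finset.HasAntidiagonal.antidiagonal n, |A x.1| * |D x.2|
  have hcoeff : ∀ i n, |(P i * Q i).coeff n| ≤ B n := fun i n => by
    rw [Polynomial.coeff_mul]
    refine (Finset.abs_sum_le_sum_abs _ _).trans (Finset.sum_le_sum fun x _ => ?_)
    rw [abs_mul]
    refine mul_le_mul ?_ ?_ (abs_nonneg _) (abs_nonneg _)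
    · simp only [P, PowerSeries.coeff_trunc, PowerSeries.coeff_mk]
      split_ifs
      · exact (hA _ i).trans (le_abs_self _)
      · simp
    · simp only [Q, PowerSeries.coeff_trunc]
      split_ifs
      · exact (hD _ i).trans (le_abs_self _)
      · simp
  have hlow : ∀ i n, n < N → (P i * Q i).coeff n = if n = 0 then 1 else 0 := fun i n hn => by
    have h1 : PowerSeries.constantCoeff (PowerSeries.mk (a i)) ≠ 0 := by
      rw [← PowerSeries.coeff_zero_eq_constantCoeff_apply, PowerSeries.coeff_mk]
      exact (hα.trans_le (h0 i)).ne'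
    have h2 := congrArg (PowerSeries.coeff n) (PowerSeries.mul_inv_cancel _ h1)
    rw [PowerSeries.coeff_one, PowerSeries.coeff_mul] at h2
    rw [← h2, Polynomial.coeff_mul]
    refine Finset.sum_congr rfl fun x hx => ?_
    have := Finset.HasAntidiagonal.mem_antidiagonal.1 hx
    simp [P, Q, PowerSeries.coeff_trunc, show x.1 < N by omega, show x.2 < N by omega]
  refine ⟨∑ j ∈ Finset.range N, B (N + j) * H ^ j, by positivity, fun i h hh hhH => ?_⟩
  have hdeg : (P i * Q i).natDegree < N + N := by
    have h1 : (P i).natDegree < N := hdegT _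
    have h2 : (Q i).natDegree < N := hdegT _
    have := Polynomial.natDegree_mul_le (p := P i) (q := Q i)
    omega
  rw [← hP, ← hQ, ← Polynomial.eval_mul, Polynomial.eval_eq_sum_range' hdeg, Finset.sum_range_add]
  have e1 : ∑ n ∈ Finset.range N, (P i * Q i).coeff n * h ^ n = 1 := by
    rw [Finset.sum_congr rfl fun n hn => by rw [hlow i n (Finset.mem_range.1 hn)]]
    simp [hN]
  have e2 : ∑ n ∈ Finset.range N, (P i * Q i).coeff (N + n) * h ^ (N + n) =
      h ^ N * ∑ n ∈ Finset.range N, (P i * Q i).coeff (N + n) * h ^ n := by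
    rw [Finset.mul_sum]; exact Finset.sum_congr rfl fun n _ => by rw [pow_add]; ring
  rw [e1, e2, sub_add_cancel_left, abs_neg, abs_mul, abs_of_pos (by positivity : 0 < h ^ N), mul_comm]
  gcongr
  exact abs_sum_mul_pow_le (fun n => hcoeff i (N + n)) hh.le hhH _

/-- With `p` and `q` the two truncations, `κ⁻¹ - q = κ⁻¹ ((1 - p q) - (κ - p) q)`. Only `κ` has to
be bounded below; the truncation `p` may vanish, which can happen when `h` is not small. -/
theorem inv_expansion {ι : Type} {a : ι → ℕ → ℝ} (ha : ∀ j, ∃ C, ∀ i, |a i j| ≤ C) {α : ℝ}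
    (hα : 0 < α) (h0 : ∀ i, α ≤ a i 0) (N : ℕ) {H : ℝ} (hH : 0 < H) (C : ℝ) {δ : ℝ} (hδ : 0 < δ) :
    ∃ C', 0 ≤ C' ∧ ∀ i, ∀ h, 0 < h → h ≤ H → ∀ κ, δ ≤ κ →
      |κ - ∑ j ∈ Finset.range N, a i j * h ^ j| ≤ C * h ^ N →
      |κ⁻¹ - ∑ j ∈ Finset.range N, invCoeff (a i) j * h ^ j| ≤ C' * h ^ N := by
  obtain ⟨C1, hC1, h1⟩ := trunc_mul_inv ha hα h0 N hH
  choose D hD0 hD using abs_invCoeff_le ha hα h0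
  set S := ∑ j ∈ Finset.range N, D j * H ^ j
  have hS : 0 ≤ S := Finset.sum_nonneg fun j _ => mul_nonneg (hD0 j) (by positivity)
  refine ⟨δ⁻¹ * (C1 + |C| * S), by positivity, fun i h hh hhH κ hκ hap => ?_⟩
  set p := ∑ j ∈ Finset.range N, a i j * h ^ j
  set q := ∑ j ∈ Finset.range N, invCoeff (a i) j * h ^ j
  have hκ0 : 0 < κ := hδ.trans_le hκ
  have hq : |q| ≤ S := abs_sum_mul_pow_le (fun n => hD n i) hh.le hhH _
  have e : κ⁻¹ - q = κ⁻¹ * ((1 - p * q) - (κ - p) * q) := by field_simp; ring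
  rw [e, abs_mul, abs_inv, abs_of_pos hκ0, mul_assoc]
  refine mul_le_mul (inv_anti₀ hδ hκ) ?_ (abs_nonneg _) (by positivity)
  calc _ ≤ |1 - p * q| + |(κ - p) * q| := abs_sub _ _
    _ ≤ C1 * h ^ N + (|C| * h ^ N) * S := by
        refine add_le_add (h1 i h hh hhH) ?_
        rw [abs_mul]
        refine mul_le_mul (hap.trans ?_) hq (abs_nonneg _) (by positivity)
        gcongr; exact le_abs_self C
    _ = _ := by ring

theorem exp_neg_div_le_pow {c : ℝ} (hc : 0 < c) (n : ℕ) : ∃ C, 0 ≤ C ∧ ∀ t > 0,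
    Real.exp (-(c / t)) ≤ C * t ^ n := by
  refine ⟨n.factorial / c ^ n, by positivity, fun t ht => ?_⟩
  have h := Real.pow_div_factorial_le_exp (c / t) (by positivity) n
  rw [Real.exp_neg, inv_le_comm₀ (Real.exp_pos _) (by positivity)]
  refine le_trans (le_of_eq ?_) h
  rw [div_pow]
  field_simp

/-! ## The expansion of the reduced norm -/

/-- The Laplace coefficients of the model phase. -/
noncomputable def modelCoeff (θ : ℝ) : ℕ → ℝ := laplaceCoeff (modelPhase θ)

/-- The Laplace integral of the model phase. -/
noncomputable def modelInt (θ ε : ℝ) : ℝ := laplaceInt (modelPhase θ) (modelDom θ) ε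

theorem modelCoeff_zero (θ : ℝ) : modelCoeff θ 0 = Real.sqrt (Real.pi / modelCurv θ 0) := by
  rw [modelCoeff, LaplaceFamily.laplaceCoeff_zero, modelPhase_zero_right]
  congr 2; ring

/-- The curvature at the minimum lies in `]0, 1]`, uniformly in the angle. So the series to be
inverted has constant term bounded away from `0`, even at `θ = 0`. -/
theorem one_le_modelCoeff_zero (θ : Angle) : 1 ≤ modelCoeff θ 0 := by
  rw [modelCoeff_zero, Real.one_le_sqrt]
  have h1 := modelCurv_le (t := 0) θ.2.1 (by norm_num)
  have h2 := two_div_pi_mul_le_modelCurv (t := 0) θ.2 (by norm_num)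
  have : 0 < 2 / Real.pi * (1 + 0) := by have := Real.pi_pos; positivity
  rw [one_le_div (by linarith)]
  linarith [Real.pi_gt_three]

/-- `κ` is, up to an exponentially small error, equal to the model Laplace integral. -/
def IsReducedNorm (K θ ε κ : ℝ) : Prop :=
  modelInt θ ε ≤ κ ∧
    κ ^ 2 ≤ modelInt θ ε ^ 2 + K * (1 + ε ^ 2) / ε ^ 2 * Real.exp (-(1 / Real.pi ^ 3 / ε ^ 2))

/-- From `κ² - I² ≤ η` and `κ ≥ I ≥ δ` one gets `κ - I ≤ η / δ`. Here `η` is exponentially small in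
`1/ε²`, below every power of `ε²`, so `κ` inherits the expansion of the Laplace integral `I`. -/
theorem reducedNorm_inv_expansion (K : ℝ) {H : ℝ} (hH : 0 < H) (N : ℕ) : ∃ C, 0 ≤ C ∧
    ∀ θ : Angle, ∀ ε > 0, ε ^ 2 ≤ H → ∀ κ, IsReducedNorm K θ ε κ → 0 < κ ∧
      |κ⁻¹ - ∑ j ∈ Finset.range N, invCoeff (modelCoeff θ) j * (ε ^ 2) ^ j| ≤ C * (ε ^ 2) ^ N := by
  obtain ⟨δ, hδ, hlow⟩ := modelFamily.laplaceInt_lower (Real.sqrt H)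
  obtain ⟨C1, hC1, hexp⟩ := modelFamily.expansion N
  have hpi := Real.pi_pos
  -- The extra power of `ε²` pays for the prefactor `1/ε²` of the exponential.
  obtain ⟨C2, hC2, htail⟩ := exp_neg_div_le_pow (c := 1 / Real.pi ^ 3) (by positivity) (N + 1)
  obtain ⟨C3, hC3, hinv⟩ := inv_expansion (a := fun θ : Angle => modelCoeff θ)
    (fun j => modelFamily.abs_laplaceCoeff_le j) zero_lt_one one_le_modelCoeff_zero N hH
    (C1 + |K| * (1 + H) * C2 / δ) hδ
  refine ⟨C3, hC3, fun θ ε hε hεH κ hκ => ?_⟩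
  have hδf : δ ≤ modelInt θ ε := hlow θ ε hε (Real.le_sqrt_of_sq_le hεH)
  have hδκ : δ ≤ κ := hδf.trans hκ.1
  refine ⟨hδ.trans_le hδκ, hinv θ (ε ^ 2) (by positivity) hεH κ hδκ ?_⟩
  have h1 := hexp θ ε hε
  have h2 : κ - modelInt θ ε ≤ |K| * (1 + H) * C2 / δ * (ε ^ 2) ^ N := by
    have h3 : K * (1 + ε ^ 2) / ε ^ 2 * Real.exp (-(1 / Real.pi ^ 3 / ε ^ 2)) ≤
        |K| * (1 + H) * C2 * (ε ^ 2) ^ N := by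
      have h4 := htail (ε ^ 2) (by positivity)
      calc K * (1 + ε ^ 2) / ε ^ 2 * Real.exp (-(1 / Real.pi ^ 3 / ε ^ 2))
          ≤ |K| * (1 + H) / ε ^ 2 * (C2 * (ε ^ 2) ^ (N + 1)) := by
            gcongr
            exact le_abs_self K
        _ = _ := by rw [pow_succ _ N]; field_simp
    have h5 := hκ.2
    rw [div_mul_eq_mul_div, le_div_iff₀ hδ]
    nlinarith [mul_nonneg (sub_nonneg.2 hκ.1) (by linarith : 0 ≤ κ + modelInt θ ε - δ)]
  have h3 : |κ - modelInt θ ε| ≤ |K| * (1 + H) * C2 / δ * (ε ^ 2) ^ N := by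
    rwa [abs_of_nonneg (sub_nonneg.2 hκ.1)]
  calc _ ≤ |κ - modelInt θ ε| + |modelInt θ ε - ∑ j ∈ Finset.range N, modelCoeff θ j * (ε ^ 2) ^ j| :=
        abs_sub_le _ _ _
    _ ≤ _ := by rw [add_mul, add_comm]; exact add_le_add h1 h3

/-! ## Singular values of an operator with compact inverse -/

section Singular
variable {H : Type} [NormedAddCommGroup H] [InnerProductSpace ℂ H] [CompleteSpace H]

/-- `T T*` is self-adjoint, so some point of its spectrum has modulus `‖T T*‖ = ‖T‖²`. It is
nonzero, hence an eigenvalue by compactness, and `⟨w, T T* w⟩ = ‖T* w‖²` forces it to be positive.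
-/
theorem exists_unit_maximizer {T : H →L[ℂ] H} (hT : IsCompactOperator T) (h0 : T ≠ 0) :
    ∃ u : H, ‖u‖ = 1 ∧ T (T.adjoint u) = ((‖T‖ ^ 2 : ℝ) : ℂ) • u := by
  have hnt : Nontrivial H := by
    by_contra h
    rw [not_nontrivial_iff_subsingleton] at h
    exact h0 (Subsingleton.elim _ _)
  set A : H →L[ℂ] H := T ∘L T.adjoint with hA
  have hsa : IsSelfAdjoint A := by
    rw [ContinuousLinearMap.isSelfAdjoint_iff', hA, ContinuousLinearMap.adjoint_comp,
      ContinuousLinearMap.adjoint_adjoint]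
  have hnorm : ‖A‖ = ‖T‖ ^ 2 := by
    have := CStarRing.norm_self_mul_star (x := T)
    rw [sq]; exact this
  have hTpos : 0 < ‖T‖ := norm_pos_iff.2 h0
  have hcomp : IsCompactOperator A := hT.comp_clm T.adjoint
  obtain ⟨μ, hμ, hμn⟩ := spectrum.exists_nnnorm_eq_spectralRadius A
  rw [IsSelfAdjoint.spectralRadius_eq_nnnorm hsa] at hμn
  have hμn' : ‖μ‖ = ‖T‖ ^ 2 := by
    rw [← hnorm]
    exact congrArg NNReal.toReal (ENNReal.coe_injective hμn)
  have hμ0 : μ ≠ 0 := by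
    rw [← norm_pos_iff, hμn']; positivity
  have hev := (hcomp.hasEigenvalue_iff_mem_spectrum hμ0).2 hμ
  obtain ⟨w, hw⟩ := hev.exists_hasEigenvector
  have hw0 : w ≠ 0 := hw.2
  have hAw : A w = μ • w := hw.apply_eq_smul
  have hwn : 0 < ‖w‖ := norm_pos_iff.2 hw0
  have hin : inner ℂ w (A w) = ((‖T.adjoint w‖ ^ 2 : ℝ) : ℂ) := by
    rw [hA, ContinuousLinearMap.comp_apply, ← ContinuousLinearMap.adjoint_inner_left,
      inner_self_eq_norm_sq_to_K]; simp
  rw [hAw, inner_smul_right, inner_self_eq_norm_sq_to_K] at hin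
  have hμr : μ = ((‖T‖ ^ 2 : ℝ) : ℂ) := by
    have e : μ = ((‖T.adjoint w‖ ^ 2 / ‖w‖ ^ 2 : ℝ) : ℂ) := by
      have : (((‖w‖ : ℝ) : ℂ)) ^ 2 ≠ 0 := by
        exact_mod_cast pow_ne_zero 2 hwn.ne'
      rw [Complex.ofReal_div, eq_div_iff (by exact_mod_cast pow_ne_zero 2 hwn.ne'), ← hin]
      simp
    rw [e] at hμn' ⊢
    rw [Complex.norm_real, Real.norm_of_nonneg (by positivity)] at hμn'
    rw [hμn']
  refine ⟨((‖w‖⁻¹ : ℝ) : ℂ) • w, ?_, ?_⟩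
  · rw [norm_smul, Complex.norm_real, Real.norm_of_nonneg (by positivity), inv_mul_cancel₀ hwn.ne']
  · have : T (T.adjoint w) = μ • w := hAw
    rw [map_smul, map_smul, this, hμr, smul_comm]

/-- Every vector is in the range of the operator with graph `G`, so testing on that range determines
`v`; no density of the domain has to be discussed. -/
theorem adjGraph_iff {G : H → H → Prop} {K : H →L[ℂ] H} (hG : ∀ u v, G u v ↔ u = K v) (v z : H) :
    AdjGraph G v z ↔ v = K.adjoint z := by
  constructor
  · intro h
    refine ext_inner_left ℂ fun w => ?_
    rw [ContinuousLinearMap.adjoint_inner_right]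
    exact h (K w) w ((hG _ _).2 rfl)
  · rintro rfl u w hw
    rw [(hG _ _).1 hw, ContinuousLinearMap.adjoint_inner_right]

/-- The vector `e₊` is a top eigenvector of `K K*`, and `e₋ = m K* e₊`. Minimality: a singular value
`t` with vector `w` satisfies `w = t² K K* w`, so `1 ≤ t² ‖K‖²`. The sign of `m` is free, being
absorbed by `e₋`; this allows `m` to be negative on the circle. -/
theorem isLeast_singularValues {G : H → H → Prop} {K : H →L[ℂ] H} (hK : IsCompactOperator K)
    (h0 : K ≠ 0) (hG : ∀ u v, G u v ↔ u = K v) {m : ℝ} (hm : |m| = ‖K‖⁻¹) :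
    IsLeast (singularValues G) |m| ∧ ∃ ePlus eMinus : H, IsSingularTriple G m ePlus eMinus := by
  have hKpos : 0 < ‖K‖ := norm_pos_iff.2 h0
  obtain ⟨u, hu1, hu⟩ := exists_unit_maximizer hK h0
  have hm2 : m ^ 2 * ‖K‖ ^ 2 = 1 := by
    rw [← sq_abs, hm, ← mul_pow, inv_mul_cancel₀ hKpos.ne', one_pow]
  have hKu : K (((m ^ 2 : ℝ) : ℂ) • K.adjoint u) = u := by
    rw [map_smul, hu, smul_smul, ← Complex.ofReal_mul, hm2]; simp
  have hnorm : ‖K.adjoint u‖ = ‖K‖ := by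
    have h1 : ((‖K.adjoint u‖ ^ 2 : ℝ) : ℂ) = ((‖K‖ ^ 2 : ℝ) : ℂ) := by
      have h2 : inner ℂ (K.adjoint u) (K.adjoint u) = inner ℂ u (K (K.adjoint u)) := by
        rw [ContinuousLinearMap.adjoint_inner_left]
      rw [hu, inner_smul_right, inner_self_eq_norm_sq_to_K, inner_self_eq_norm_sq_to_K, hu1] at h2
      simpa using h2
    have h3 : ‖K.adjoint u‖ ^ 2 = ‖K‖ ^ 2 := by exact_mod_cast h1
    exact (pow_left_inj₀ (norm_nonneg _) (norm_nonneg _) two_ne_zero).1 h3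
  refine ⟨⟨⟨abs_nonneg _, u, ((m ^ 2 : ℝ) : ℂ) • K.adjoint u, ?_, (hG _ _).2 hKu.symm, ?_⟩, ?_⟩,
    u, (m : ℂ) • K.adjoint u, hu1, ?_, ?_, ?_⟩
  · rw [← norm_pos_iff, hu1]; exact one_pos
  · rw [adjGraph_iff hG, sq_abs, map_smul]
  · rintro t ⟨ht, w, v, hw0, hwv, hadj⟩
    rw [hG] at hwv
    rw [adjGraph_iff hG, map_smul] at hadj
    have hwn : 0 < ‖w‖ := norm_pos_iff.2 hw0
    have h1 : ‖w‖ ≤ t ^ 2 * ‖K‖ ^ 2 * ‖w‖ := by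
      calc ‖w‖ = ‖K v‖ := by rw [← hwv]
        _ ≤ ‖K‖ * ‖v‖ := K.le_opNorm v
        _ = ‖K‖ * (t ^ 2 * ‖K.adjoint w‖) := by
            rw [hadj, norm_smul, Complex.norm_real, Real.norm_of_nonneg (sq_nonneg t)]
        _ ≤ ‖K‖ * (t ^ 2 * (‖K‖ * ‖w‖)) := by
            gcongr
            have := K.adjoint.le_opNorm w
            rwa [LinearIsometryEquiv.norm_map] at this
        _ = _ := by ring
    have h2 : 1 ≤ (t * ‖K‖) ^ 2 := by
      rw [mul_pow]; exact le_of_mul_le_mul_right (by linarith) hwn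
    have h3 : 1 ≤ t * ‖K‖ := by
      by_contra h; push Not at h
      have : 0 ≤ t * ‖K‖ := by positivity
      nlinarith
    rw [hm, inv_le_iff_one_le_mul₀ hKpos]
    exact h3
  · rw [norm_smul, Complex.norm_real, hnorm, Real.norm_eq_abs, hm, inv_mul_cancel₀ hKpos.ne']
  · rw [hG, smul_smul, ← Complex.ofReal_mul, ← sq]; exact hKu.symm
  · rw [adjGraph_iff hG, map_smul]

/-- Restricting the basis expansion to a finite set gives finite rank operators. By Cauchy-Schwarz
and Bessel their distance to `T` is controlled by the tail of the sum. -/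
theorem isCompactOperator_of_summable {ι : Type} (b : HilbertBasis ι ℂ H) {T : H →L[ℂ] H}
    (hT : Summable fun i => ‖T (b i)‖ ^ 2) : IsCompactOperator T := by
  classical
  have hclosed := isClosed_setOfPred_isCompactOperator (𝕜₁ := ℂ) (𝕜₂ := ℂ) (σ₁₂ := RingHom.id ℂ)
    (M₁ := H) (M₂ := H)
  suffices T ∈ closure {f : H →L[ℂ] H | IsCompactOperator f} by
    rwa [hclosed.closure_eq] at this
  rw [Metric.mem_closure_iff]
  intro ε hε
  obtain ⟨F, hF⟩ := summable_iff_vanishing_norm.1 hT ((ε / 2) ^ 2) (by positivity)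
  set R : H →L[ℂ] H := ∑ i ∈ F, (innerSL ℂ (b i)).smulRight (T (b i)) with hR
  refine ⟨R, ?_, ?_⟩
  · have : ∀ i, IsCompactOperator ((innerSL ℂ (b i)).smulRight (T (b i))) := fun i => by
      exact (isCompactOperator_of_locallyCompactSpace_dom (innerSL ℂ (b i))).clm_comp
        ((1 : ℂ →L[ℂ] ℂ).smulRight (T (b i)))
    exact Submodule.sum_mem (compactOperator (RingHom.id ℂ) H H) fun i _ => this i
  · rw [dist_eq_norm]
    refine lt_of_le_of_lt (ContinuousLinearMap.opNorm_le_bound _ (half_pos hε).le fun x => ?_)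
      (half_lt_self hε)
    have hs : HasSum (fun i => b.repr x i • T (b i)) (T x) := by
      simpa using (b.hasSum_repr x).mapL T
    have hRx : R x = ∑ i ∈ F, b.repr x i • T (b i) := by
      simp [hR, b.repr_apply_apply]
    have hlim : Filter.Tendsto (fun s : Finset ι => ‖∑ i ∈ s, b.repr x i • T (b i) - R x‖)
        Filter.atTop (nhds ‖T x - R x‖) := ((hs.sub_const _ ).norm)
    refine le_of_tendsto hlim ?_
    filter_upwards [Filter.eventually_ge_atTop F] with s hs
    rw [hRx, ← Finset.sum_sdiff hs, add_sub_cancel_right]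
    have h1 := hF (s \ F) Finset.sdiff_disjoint
    rw [Real.norm_of_nonneg (by positivity)] at h1
    have h2 : ∑ i ∈ s \ F, ‖b.repr x i‖ ^ 2 ≤ ‖x‖ ^ 2 := by
      have := b.orthonormal.sum_inner_products_le (x := x) (s := s \ F)
      simpa [b.repr_apply_apply] using this
    have h3 : (∑ i ∈ s \ F, ‖b.repr x i‖ * ‖T (b i)‖) ^ 2 ≤ (ε / 2 * ‖x‖) ^ 2 := by
      calc _ ≤ (∑ i ∈ s \ F, ‖b.repr x i‖ ^ 2) * ∑ i ∈ s \ F, ‖T (b i)‖ ^ 2 :=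
            Finset.sum_mul_sq_le_sq_mul_sq _ _ _
        _ ≤ ‖x‖ ^ 2 * (ε / 2) ^ 2 := by gcongr
        _ = _ := by ring
    calc _ ≤ ∑ i ∈ s \ F, ‖b.repr x i • T (b i)‖ := norm_sum_le _ _
      _ = ∑ i ∈ s \ F, ‖b.repr x i‖ * ‖T (b i)‖ := by simp_rw [norm_smul]
      _ ≤ _ := by
        refine le_of_sq_le_sq ?_ (by positivity)
        exact h3

end Singular

/-! ## Hilbert-Schmidt integral operators -/

section HilbertSchmidt
open scoped ENNReal
variable {Y : Type} [MeasureSpace Y]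

theorem eLpNorm_two_sq {E : Type} [NormedAddCommGroup E] {α : Type} [MeasurableSpace α]
    (μ : Measure α) (f : α → E) : eLpNorm f 2 μ ^ 2 = ∫⁻ y, ‖f y‖ₑ ^ 2 ∂μ := by
  rw [eLpNorm_eq_lintegral_rpow_enorm_toReal two_ne_zero ENNReal.ofNat_ne_top, ← ENNReal.rpow_two,
    ← ENNReal.rpow_mul]
  simp

theorem memLp_two_of_lintegral_lt_top {E : Type} [NormedAddCommGroup E] {α : Type}
    [MeasurableSpace α] {μ : Measure α} {f : α → E} (hf : AEStronglyMeasurable f μ)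
    (h : ∫⁻ y, ‖f y‖ₑ ^ 2 ∂μ < ⊤) : MemLp f 2 μ := by
  refine ⟨hf, ?_⟩
  rw [← eLpNorm_two_sq] at h
  by_contra hc
  rw [not_lt, top_le_iff] at hc
  simp [hc] at h

theorem lintegral_enorm_sq_lt_top {E : Type} [NormedAddCommGroup E] {α : Type}
    [MeasurableSpace α] {μ : Measure α} {f : α → E} (hf : MemLp f 2 μ) :
    ∫⁻ y, ‖f y‖ₑ ^ 2 ∂μ < ⊤ := by
  rw [← eLpNorm_two_sq]; exact ENNReal.pow_lt_top hf.2

theorem enorm_sq_L2 (u : L2 Y) : ‖u‖ₑ ^ 2 = ∫⁻ y, ‖u y‖ₑ ^ 2 := by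
  rw [Lp.enorm_def, eLpNorm_two_sq]

theorem sq_lintegral_mul_le {α : Type} [MeasurableSpace α] {μ : Measure α} {f g : α → ℝ≥0∞}
    (hf : AEMeasurable f μ) (hg : AEMeasurable g μ) :
    (∫⁻ y, f y * g y ∂μ) ^ 2 ≤ (∫⁻ y, f y ^ 2 ∂μ) * ∫⁻ y, g y ^ 2 ∂μ := by
  have h := ENNReal.lintegral_mul_le_Lp_mul_Lq μ Real.HolderConjugate.two_two hf hg
  calc (∫⁻ y, f y * g y ∂μ) ^ 2 ≤ _ := pow_le_pow_left₀ (by positivity) h 2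
    _ = _ := by
      rw [mul_pow, ← ENNReal.rpow_two, ← ENNReal.rpow_two, ← ENNReal.rpow_mul, ← ENNReal.rpow_mul]
      simp

/-- The integral operator with kernel `k`, on functions. -/
noncomputable def kernelFun (k : Y → Y → ℝ) (v : Y → ℂ) (y : Y) : ℂ := ∫ s, (k y s : ℂ) * v s

/-- A square integrable kernel. -/
structure HSKernel (k : Y → Y → ℝ) : Prop where
  meas : Measurable (Function.uncurry k)
  fin : ∫⁻ y, ∫⁻ s, ‖k y s‖ₑ ^ 2 < ⊤

namespace HSKernel
variable {k : Y → Y → ℝ}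

theorem measurable_left (hk : HSKernel k) (y : Y) : Measurable (k y) :=
  hk.meas.comp measurable_prodMk_left

theorem enorm_kernelFun_sq_le (hk : HSKernel k) {v : Y → ℂ} (hv : AEStronglyMeasurable v volume)
    (y : Y) : ‖kernelFun k v y‖ₑ ^ 2 ≤ (∫⁻ s, ‖k y s‖ₑ ^ 2) * ∫⁻ s, ‖v s‖ₑ ^ 2 := by
  calc ‖kernelFun k v y‖ₑ ^ 2 ≤ (∫⁻ s, ‖k y s‖ₑ * ‖v s‖ₑ) ^ 2 := by
        gcongr
        refine (enorm_integral_le_lintegral_enorm _).trans_eq ?_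
        congr 1; ext s; rw [enorm_mul]; simp [enorm_eq_nnnorm]
    _ ≤ _ := sq_lintegral_mul_le (hk.measurable_left y).enorm.aemeasurable hv.enorm

variable [SFinite (volume : Measure Y)]

theorem ae_memLp (hk : HSKernel k) : ∀ᵐ y, MemLp (fun s => (k y s : ℂ)) 2 volume := by
  have hm : Measurable fun y => ∫⁻ s, ‖k y s‖ₑ ^ 2 := by
    have : Measurable fun p : Y × Y => ‖k p.1 p.2‖ₑ ^ 2 := hk.meas.enorm.pow_const 2
    exact this.lintegral_prod_right'
  filter_upwards [ae_lt_top hm hk.fin.ne] with y hy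
  refine memLp_two_of_lintegral_lt_top ?_ ?_
  · exact (Complex.measurable_ofReal.comp (hk.measurable_left y)).aestronglyMeasurable
  · simpa [enorm_eq_nnnorm] using hy

theorem ae_integrable (hk : HSKernel k) {v : Y → ℂ} (hv : MemLp v 2 volume) :
    ∀ᵐ y, Integrable (fun s => (k y s : ℂ) * v s) := by
  filter_upwards [hk.ae_memLp] with y hy
  exact hy.integrable_mul hv

theorem aestronglyMeasurable_kernelFun (hk : HSKernel k) {v : Y → ℂ}
    (hv : AEStronglyMeasurable v volume) : AEStronglyMeasurable (kernelFun k v) volume := by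
  have h1 : AEStronglyMeasurable (fun p : Y × Y => (k p.1 p.2 : ℂ) * v p.2) (volume.prod volume) :=
    (Complex.measurable_ofReal.comp hk.meas).aestronglyMeasurable.mul hv.comp_snd
  exact h1.integral_prod_right'

theorem lintegral_kernelFun_le (hk : HSKernel k) {v : Y → ℂ} (hv : AEStronglyMeasurable v volume) :
    ∫⁻ y, ‖kernelFun k v y‖ₑ ^ 2 ≤ (∫⁻ y, ∫⁻ s, ‖k y s‖ₑ ^ 2) * ∫⁻ s, ‖v s‖ₑ ^ 2 := by
  have hm : Measurable fun y => ∫⁻ s, ‖k y s‖ₑ ^ 2 := by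
    have : Measurable fun p : Y × Y => ‖k p.1 p.2‖ₑ ^ 2 := hk.meas.enorm.pow_const 2
    exact this.lintegral_prod_right'
  rw [← lintegral_mul_const _ hm]
  exact lintegral_mono fun y => hk.enorm_kernelFun_sq_le hv y

theorem memLp_kernelFun (hk : HSKernel k) {v : Y → ℂ} (hv : MemLp v 2 volume) :
    MemLp (kernelFun k v) 2 volume :=
  memLp_two_of_lintegral_lt_top (hk.aestronglyMeasurable_kernelFun hv.1)
    ((hk.lintegral_kernelFun_le hv.1).trans_lt
      (ENNReal.mul_lt_top hk.fin (lintegral_enorm_sq_lt_top hv)))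

/-- The bounded operator on `L²` with a given square integrable kernel. -/
noncomputable def op (hk : HSKernel k) : L2 Y →L[ℂ] L2 Y :=
  LinearMap.mkContinuous
    { toFun := fun v => (hk.memLp_kernelFun (Lp.memLp v)).toLp _
      map_add' := fun u v => by
        rw [← MemLp.toLp_add]
        refine (MemLp.toLp_eq_toLp_iff _ _).2 ?_
        filter_upwards [hk.ae_integrable (Lp.memLp u), hk.ae_integrable (Lp.memLp v)] with y hu hv
        rw [Pi.add_apply, kernelFun, kernelFun, kernelFun, ← integral_add hu hv]
        refine integral_congr_ae ?_
        filter_upwards [Lp.coeFn_add u v] with s hs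
        rw [hs, Pi.add_apply, mul_add]
      map_smul' := fun c v => by
        rw [RingHom.id_apply, ← MemLp.toLp_const_smul]
        refine (MemLp.toLp_eq_toLp_iff _ _).2 (.of_forall fun y => ?_)
        rw [Pi.smul_apply, kernelFun, kernelFun, smul_eq_mul, ← integral_const_mul]
        refine integral_congr_ae ?_
        filter_upwards [Lp.coeFn_smul c v] with s hs
        rw [hs, Pi.smul_apply, smul_eq_mul]; ring }
    (Real.sqrt (∫⁻ y, ∫⁻ s, ‖k y s‖ₑ ^ 2).toReal) fun v => by
      have h1 : ‖(hk.memLp_kernelFun (Lp.memLp v)).toLp _‖ₑ ^ 2 ≤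
          (∫⁻ y, ∫⁻ s, ‖k y s‖ₑ ^ 2) * ‖v‖ₑ ^ 2 := by
        rw [enorm_sq_L2, enorm_sq_L2]
        refine le_trans (le_of_eq (lintegral_congr_ae ?_))
          (hk.lintegral_kernelFun_le (Lp.memLp v).1)
        filter_upwards [MemLp.coeFn_toLp (hk.memLp_kernelFun (Lp.memLp v))] with y hy
        rw [hy]
      have h2 := ENNReal.toReal_mono (ENNReal.mul_ne_top hk.fin.ne (by simp)) h1
      rw [ENNReal.toReal_mul, ENNReal.toReal_pow, ENNReal.toReal_pow, toReal_enorm, toReal_enorm] at h2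
      refine le_of_sq_le_sq ?_ (by positivity)
      rw [mul_pow, Real.sq_sqrt ENNReal.toReal_nonneg]
      exact h2

theorem coeFn_op (hk : HSKernel k) (v : L2 Y) : hk.op v =ᵐ[volume] kernelFun k v :=
  MemLp.coeFn_toLp (hk.memLp_kernelFun (Lp.memLp v))

theorem norm_op_sq_le (hk : HSKernel k) {B : ℝ} (hB : 0 ≤ B)
    (h : ∫⁻ y, ∫⁻ s, ‖k y s‖ₑ ^ 2 ≤ ENNReal.ofReal B) : ‖hk.op‖ ^ 2 ≤ B := by
  have h1 : ‖hk.op‖ ≤ Real.sqrt (∫⁻ y, ∫⁻ s, ‖k y s‖ₑ ^ 2).toReal :=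
    LinearMap.mkContinuous_norm_le _ (Real.sqrt_nonneg _) _
  calc _ ≤ Real.sqrt (∫⁻ y, ∫⁻ s, ‖k y s‖ₑ ^ 2).toReal ^ 2 := by gcongr
    _ = (∫⁻ y, ∫⁻ s, ‖k y s‖ₑ ^ 2).toReal := Real.sq_sqrt ENNReal.toReal_nonneg
    _ ≤ B := ENNReal.toReal_le_of_le_ofReal hB h

/-- For almost every `y`, Bessel's inequality applied to the row `k y` bounds the sum of the squares
`|(op bᵢ)(y)|²`. Integrating in `y` gives the summability that compactness needs. -/
theorem isCompactOperator (hk : HSKernel k) : IsCompactOperator hk.op := by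
  obtain ⟨w, b, -⟩ := exists_hilbertBasis ℂ (L2 Y)
  refine isCompactOperator_of_summable b
    (summable_of_sum_le (c := (∫⁻ y, ∫⁻ s, ‖k y s‖ₑ ^ 2).toReal) (fun i => by positivity) fun F => ?_)
  have key : ∑ i ∈ F, ‖hk.op (b i)‖ₑ ^ 2 ≤ ∫⁻ y, ∫⁻ s, ‖k y s‖ₑ ^ 2 := by
    simp_rw [enorm_sq_L2]
    rw [← lintegral_finsetSum' _ fun i _ => (Lp.aestronglyMeasurable _).enorm.pow_const 2]
    refine lintegral_mono_ae ?_
    have hall : ∀ᵐ y, ∀ i ∈ F, hk.op (b i) y = kernelFun k (b i) y :=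
      (Filter.eventually_all_finset F).2 fun i _ => hk.coeFn_op (b i)
    filter_upwards [hk.ae_memLp, hall] with y hy hop
    have hin : ∀ i, kernelFun k (b i) y = inner ℂ (hy.toLp _) (b i) := fun i => by
      rw [L2.inner_def, kernelFun]
      refine integral_congr_ae ?_
      filter_upwards [hy.coeFn_toLp] with s hs
      rw [hs]; simp [mul_comm]
    have hbes := b.orthonormal.sum_inner_products_le (x := hy.toLp _) (s := F)
    have h2 : ∫⁻ s, ‖k y s‖ₑ ^ 2 = ‖hy.toLp _‖ₑ ^ 2 := by
      rw [enorm_sq_L2]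
      refine lintegral_congr_ae ?_
      filter_upwards [hy.coeFn_toLp] with s hs
      rw [hs]; simp [enorm_eq_nnnorm]
    rw [h2, Finset.sum_congr rfl fun i hi => by rw [hop i hi, hin i]]
    have h3 : ∀ z : ℂ, ‖z‖ₑ ^ 2 = ENNReal.ofReal (‖z‖ ^ 2) := fun z => by
      rw [ENNReal.ofReal_pow (norm_nonneg _), ofReal_norm]
    simp_rw [h3]
    rw [← ENNReal.ofReal_sum_of_nonneg fun i _ => by positivity, ← ofReal_norm (hy.toLp _),
      ← ENNReal.ofReal_pow (norm_nonneg _)]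
    refine ENNReal.ofReal_le_ofReal (le_trans (le_of_eq ?_) hbes)
    exact Finset.sum_congr rfl fun i _ => by rw [norm_inner_symm]
  have h1 := ENNReal.toReal_mono hk.fin.ne key
  rw [ENNReal.toReal_sum fun i _ => by simp] at h1
  simpa [ENNReal.toReal_pow] using h1

/-- Testing on `f` is enough: the image of `f` dominates `c ‖f‖² g` pointwise, and one divides by
`‖f‖`. -/
theorem le_norm_op (hk : HSKernel k) {f g : Y → ℝ} (hf : MemLp f 2 volume) (hg : MemLp g 2 volume)
    (hf0 : ∀ y, 0 ≤ f y) (hg0 : ∀ y, 0 ≤ g y) {c : ℝ} (hc : 0 ≤ c)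
    (h : ∀ y s, c * g y * f s ≤ k y s) (hfpos : 0 < ∫ y, f y ^ 2) :
    c * Real.sqrt (∫ y, f y ^ 2) * Real.sqrt (∫ y, g y ^ 2) ≤ ‖hk.op‖ := by
  have hfc : MemLp (fun y => (f y : ℂ)) 2 volume := hf.ofReal
  have hgc : MemLp (fun y => (g y : ℂ)) 2 volume := hg.ofReal
  have hnorm : ∀ {f : Y → ℝ} (hf : MemLp (fun y => (f y : ℂ)) 2 volume),
      ‖hf.toLp _‖ = Real.sqrt (∫ y, f y ^ 2) := by
    intro f hf
    have h1 : inner ℂ (hf.toLp _) (hf.toLp _) = ((∫ y, f y ^ 2 : ℝ) : ℂ) := by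
      rw [L2.inner_def, ← integral_complex_ofReal]
      refine integral_congr_ae ?_
      filter_upwards [hf.coeFn_toLp] with y hy
      rw [hy, RCLike.inner_apply, Complex.conj_ofReal, ← Complex.ofReal_mul, sq]
    rw [inner_self_eq_norm_sq_to_K] at h1
    rw [eq_comm, Real.sqrt_eq_iff_eq_sq (integral_nonneg fun y => sq_nonneg _) (norm_nonneg _)]
    have h2 : ((∫ y, f y ^ 2 : ℝ) : ℂ) = ((‖hf.toLp _‖ ^ 2 : ℝ) : ℂ) := by rw [← h1]; simp
    exact Complex.ofReal_injective h2
  set A := ∫ y, f y ^ 2 with hA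
  have hle : c * A * ‖hgc.toLp _‖ ≤ ‖hk.op (hfc.toLp _)‖ := by
    have e : c * A * ‖hgc.toLp _‖ = ‖((c * A : ℝ) : ℂ) • hgc.toLp _‖ := by
      rw [norm_smul, Complex.norm_real, Real.norm_of_nonneg (mul_nonneg hc hfpos.le)]
    rw [e]
    refine Lp.norm_le_norm_of_ae_le ?_
    filter_upwards [hk.coeFn_op (hfc.toLp _), hk.ae_integrable hfc,
      Lp.coeFn_smul ((c * A : ℝ) : ℂ) (hgc.toLp _), hgc.coeFn_toLp] with y h1 h2 h3 h4
    have h5 : kernelFun k (hfc.toLp _) y = ((∫ s, k y s * f s : ℝ) : ℂ) := by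
      rw [kernelFun, ← integral_complex_ofReal]
      refine integral_congr_ae ?_
      filter_upwards [hfc.coeFn_toLp] with s hs
      rw [hs]; simp
    have h6 : c * A * g y ≤ ∫ s, k y s * f s := by
      have e2 : c * A * g y = ∫ s, c * g y * f s ^ 2 := by rw [integral_const_mul]; ring
      rw [e2]
      refine integral_mono (hf.integrable_sq.const_mul _) ?_ fun s => ?_
      · have := h2.re
        simpa using this
      · have := mul_le_mul_of_nonneg_right (h y s) (hf0 s)
        simp only
        nlinarith
    rw [h1, h3, h5, Pi.smul_apply, h4, smul_eq_mul, norm_mul, Complex.norm_real, Complex.norm_real,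
      Complex.norm_real, Real.norm_of_nonneg (mul_nonneg hc hfpos.le), Real.norm_of_nonneg (hg0 y)]
    exact h6.trans (le_abs_self _)
  have h2 := hle.trans (hk.op.le_opNorm _)
  rw [hnorm hfc, hnorm hgc] at h2
  have hs : 0 < Real.sqrt A := Real.sqrt_pos.2 hfpos
  refine le_of_mul_le_mul_right ?_ hs
  calc _ = c * (Real.sqrt A * Real.sqrt A) * Real.sqrt (∫ y, g y ^ 2) := by ring
    _ = c * A * Real.sqrt (∫ y, g y ^ 2) := by rw [Real.mul_self_sqrt hfpos.le]
    _ ≤ _ := h2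

/-- Fubini; the integrand on `Y × Y` is the product of the square integrable functions `k` and `v ⊗
f`. -/
theorem integral_op_mul (hk : HSKernel k) (v : L2 Y) {f : Y → ℂ} (hf : MemLp f 2 volume) :
    ∫ y, hk.op v y * f y = ∫ s, v s * ∫ y, (k y s : ℂ) * f y := by
  have hint : Integrable (fun p : Y × Y => (k p.1 p.2 : ℂ) * (v p.2 * f p.1))
      (volume.prod volume) := by
    have hv := Lp.memLp v
    have hkc : Measurable fun p : Y × Y => (k p.1 p.2 : ℂ) := Complex.measurable_ofReal.comp hk.meas
    refine MemLp.integrable_mul (p := 2) (q := 2) ?_ ?_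
    · refine memLp_two_of_lintegral_lt_top hkc.aestronglyMeasurable ?_
      rw [lintegral_prod _ (hkc.enorm.pow_const 2).aemeasurable]
      simpa [enorm_eq_nnnorm] using hk.fin
    · refine memLp_two_of_lintegral_lt_top ((AEStronglyMeasurable.comp_snd (μ := volume) hv.1).mul
          (AEStronglyMeasurable.comp_fst (ν := volume) hf.1)) ?_
      simp_rw [enorm_mul, mul_pow, mul_comm (‖v _‖ₑ ^ 2)]
      rw [lintegral_prod_mul (hf.1.enorm.pow_const 2) (hv.1.enorm.pow_const 2)]
      exact ENNReal.mul_lt_top (lintegral_enorm_sq_lt_top hf) (lintegral_enorm_sq_lt_top hv)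
  calc ∫ y, hk.op v y * f y = ∫ y, ∫ s, (k y s : ℂ) * (v s * f y) := by
        refine integral_congr_ae ?_
        filter_upwards [hk.coeFn_op v] with y hy
        rw [hy, kernelFun, ← integral_mul_const]
        congr 1; ext s; ring
    _ = ∫ s, ∫ y, (k y s : ℂ) * (v s * f y) := integral_integral_swap hint
    _ = _ := by
        congr 1; ext s; rw [← integral_const_mul]; congr 1; ext y; ring

end HSKernel
end HilbertSchmidt

/-! ## Integrals of the exponentials -/

/-- The substitution `z = ρ (1 + ε x)`, of Jacobian `ρ ε`, sends the minimum `z = ρ` to `x = 0`; the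
factor `exp (S/h)` is the value of the integrand there. -/
theorem setIntegral_exp_eq_modelInt {Ψ : ℝ → ℝ} {θ ε ρ S h : ℝ} (s : Set ℝ) (hs : MeasurableSet s)
    (hε : 0 < ε) (hρ : 0 < ρ) (hdom : ∀ v, ρ * (1 + v) ∈ s ↔ v ∈ modelDom θ)
    (hΨ : ∀ v, -(2 * Ψ (ρ * (1 + v)) / h) = S / h - 2 * (v ^ 2 * modelPhase θ v) / ε ^ 2) :
    ∫ z in s, Real.exp (-(2 * Ψ z / h)) = Real.exp (S / h) * (ρ * ε) * modelInt θ ε := by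
  have hset : MeasurableSet {x | ε * x ∈ modelDom θ} := by
    have : {x | ε * x ∈ modelDom θ} = (fun x => ρ * (1 + ε * x)) ⁻¹' s := by
      ext x; exact (hdom _).symm
    rw [this]; exact hs.preimage (by fun_prop)
  set g : ℝ → ℝ := s.indicator fun z => Real.exp (-(2 * Ψ z / h)) with hg
  have h1 : ∫ x, g (ρ + ρ * ε * x) = (ρ * ε)⁻¹ * ∫ z, g z := by
    rw [Measure.integral_comp_mul_left (fun y => g (ρ + y)) (ρ * ε), integral_add_left_eq_self,
      abs_of_pos (by positivity), smul_eq_mul]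
  have h2 : ∀ x, g (ρ + ρ * ε * x) = Real.exp (S / h) *
      ({x | ε * x ∈ modelDom θ}.indicator (fun x => gaussPhase (modelPhase θ) (x ^ 2) (ε * x)) x) := by
    intro x
    have e : ρ + ρ * ε * x = ρ * (1 + ε * x) := by ring
    rw [e, hg]
    by_cases hx : ε * x ∈ modelDom θ
    · rw [indicator_of_mem ((hdom _).2 hx), indicator_of_mem (by exact hx), hΨ, gaussPhase,
        ← Real.exp_add]
      congr 1
      field_simp
      ring
    · rw [indicator_of_notMem (fun h => hx ((hdom _).1 h)), indicator_of_notMem (by exact hx),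
        mul_zero]
  simp_rw [h2] at h1
  rw [integral_const_mul, integral_indicator hset, hg, integral_indicator hs] at h1
  rw [modelInt, laplaceInt]
  rw [eq_inv_mul_iff_mul_eq₀ (by positivity)] at h1
  rw [← h1]; ring

/-! ### Majorants for the double integrals over the triangle `t < z` -/

theorem lintegral_exp_neg_le {b z : ℝ} (hb : 0 < b) (s : Set ℝ) (hs : s ⊆ Iic z) :
    ∫⁻ t in s, ENNReal.ofReal (Real.exp (-(b * (z - t)))) ≤ ENNReal.ofReal (1 / b) := by
  have hf : ∀ t, Real.exp (-(b * (z - t))) = Real.exp (-(b * z)) * Real.exp (b * t) := fun t => by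
    rw [← Real.exp_add]; congr 1; ring
  refine (lintegral_mono_set hs).trans ?_
  rw [← ofReal_integral_eq_lintegral_ofReal]
  · simp_rw [hf]
    rw [integral_const_mul, integral_exp_mul_Iic hb, mul_div_assoc', ← Real.exp_add]
    simp
  · simp_rw [hf]
    exact (integrableOn_exp_mul_Iic hb z).const_mul _
  · exact .of_forall fun t => (Real.exp_pos _).le

theorem lintegral_inv_sq_le {A B : ℝ} (hA : 0 < A) (hB : 0 ≤ B) :
    ∫⁻ z in Ici A, ENNReal.ofReal (B / z ^ 2) ≤ ENNReal.ofReal (B / A) := by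
  have hf : ∀ z ∈ Ioi A, B / z ^ 2 = B * z ^ (-2 : ℝ) := fun z hz => by
    have : (0:ℝ) < z := hA.trans hz
    rw [Real.rpow_neg this.le, Real.rpow_two, div_eq_mul_inv]
  rw [setLIntegral_congr Ioi_ae_eq_Ici.symm, ← ofReal_integral_eq_lintegral_ofReal]
  · rw [setIntegral_congr_fun measurableSet_Ioi hf, integral_const_mul,
      integral_Ioi_rpow_of_lt (by norm_num) hA]
    apply ENNReal.ofReal_le_ofReal
    norm_num
    rw [Real.rpow_neg_one, div_eq_mul_inv]
  · exact IntegrableOn.congr_fun ((integrableOn_Ioi_rpow_of_lt (by norm_num) hA).const_mul B)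
      (fun z hz => (hf z hz).symm) measurableSet_Ioi
  · exact .of_forall fun z => by positivity

/-- A majorant of `exp (2 (Ψ t - Ψ z) / h)`, for `t < z`. -/
noncomputable def growthMajorant (x b M z t : ℝ) : ℝ :=
  if z < 8 * x then Real.exp M else Real.exp (-(b * z ^ 2 * (z - t)))

theorem growthMajorant_nonneg (x b M z t : ℝ) : 0 ≤ growthMajorant x b M z t := by
  unfold growthMajorant; split_ifs <;> positivity

theorem measurable_growthMajorant (x b M : ℝ) :
    Measurable fun p : ℝ × ℝ => growthMajorant x b M p.1 p.2 := by
  unfold growthMajorant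
  exact Measurable.ite (measurableSet_lt (by fun_prop) (by fun_prop)) (by fun_prop) (by fun_prop)

/-- For `z < 8 x` the region lies in a square of side `8 x`. Beyond, the inner integral is at most
`1 / (b z²)`, which is integrable at infinity. -/
theorem lintegral_growthMajorant_le {x b M : ℝ} (hx : 0 < x) (hb : 0 < b) :
    ∫⁻ z in Ioi 0, ∫⁻ t in Ioo 0 z, ENNReal.ofReal (growthMajorant x b M z t) ≤
      ENNReal.ofReal (64 * x ^ 2 * Real.exp M + 1 / (8 * b * x)) := by
  have hsplit : Ioi (0 : ℝ) = Ioo 0 (8 * x) ∪ Ici (8 * x) := (Ioo_union_Ici_eq_Ioi (by positivity)).symm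
  rw [hsplit, ENNReal.ofReal_add (by positivity) (by positivity)]
  refine (lintegral_union_le _ _ _).trans (add_le_add ?_ ?_)
  · calc _ ≤ ∫⁻ z in Ioo 0 (8 * x), ENNReal.ofReal (Real.exp M * (8 * x)) := by
          refine setLIntegral_mono' measurableSet_Ioo fun z hz => ?_
          simp only [growthMajorant, if_pos hz.2]
          rw [setLIntegral_const, Real.volume_Ioo, sub_zero, ← ENNReal.ofReal_mul (Real.exp_pos _).le]
          apply ENNReal.ofReal_le_ofReal
          have := hz.2
          gcongr
      _ ≤ _ := by
          rw [setLIntegral_const, Real.volume_Ioo, sub_zero, ← ENNReal.ofReal_mul (by positivity)]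
          apply ENNReal.ofReal_le_ofReal
          exact le_of_eq (by ring)
  · calc _ ≤ ∫⁻ z in Ici (8 * x), ENNReal.ofReal ((1 / b) / z ^ 2) := by
          refine setLIntegral_mono' measurableSet_Ici fun z hz => ?_
          have hz' : 8 * x ≤ z := hz
          have hz0 : 0 < z := by linarith
          simp only [growthMajorant, if_neg (not_lt.2 hz')]
          refine (lintegral_exp_neg_le (b := b * z ^ 2) (by positivity) _
            fun t ht => ht.2.le).trans_eq ?_
          rw [div_div]
      _ ≤ ENNReal.ofReal ((1 / b) / (8 * x)) := lintegral_inv_sq_le (by positivity) (by positivity)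
      _ ≤ _ := ENNReal.ofReal_le_ofReal (le_of_eq (by field_simp))

/-- The map `(z, t) ↦ (c - t, c - z)` preserves the half plane `t < z`. It is used with `c = 0` on
the line and `c = 2π` on the circle, to exchange the two sides of the well. -/
theorem lintegral_lintegral_reflect (c : ℝ) {I : ℝ × ℝ → ENNReal} (hI : Measurable I) :
    ∫⁻ z, ∫⁻ t, I (c - t, c - z) = ∫⁻ z, ∫⁻ t, I (z, t) := by
  have h1 : ∀ z, ∫⁻ t, I (c - t, c - z) = ∫⁻ t, I (t, c - z) := fun z =>
    lintegral_sub_left_eq_self (fun t => I (t, c - z)) c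
  simp_rw [h1]
  rw [lintegral_sub_left_eq_self (fun z => ∫⁻ t, I (t, z)) c]
  exact lintegral_lintegral_swap (f := fun z t => I (t, z)) (hI.comp measurable_swap).aemeasurable

/-! ### The line -/

/-- The primitive `y ^ 3 / 3 - x² y` of the drift on the line. -/
noncomputable def lineWeight (x y : ℝ) : ℝ := y ^ 3 / 3 - x ^ 2 * y

/-- For `0 < t < z` the weight drops by at most `2 x³ / 3`, from `0` to its minimum at `x`, which is
half of the drop `4 x³ / 3` between the two critical points. This gap makes the excess of the
Hilbert-Schmidt norm exponentially small. -/
theorem lineWeight_growth {x h z t : ℝ} (hx : 0 < x) (hh : 0 < h) (ht : 0 < t) (htz : t < z) :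
    Real.exp (2 * (lineWeight x t - lineWeight x z) / h) ≤
      growthMajorant x (1 / (2 * h)) (4 * x ^ 3 / 3 / h) z t := by
  unfold growthMajorant lineWeight
  split_ifs with hz
  · apply Real.exp_le_exp.2
    gcongr
    -- This is three times `lineWeight x z + 2 x³ / 3`. If `t² ≤ 3 x²` the weight at `t` is
    -- nonpositive and the bound follows; otherwise the weight increases from `t` to `z`.
    have h1 : 0 ≤ (z - x) ^ 2 * (z + 2 * x) := by
      have : 0 < z := ht.trans htz
      positivity
    rcases le_or_gt (t ^ 2) (3 * x ^ 2) with h3 | h3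
    · nlinarith
    · have : 0 < z := ht.trans htz
      have : 0 ≤ (z - t) * ((z ^ 2 + z * t + t ^ 2) / 3 - x ^ 2) :=
        mul_nonneg (by linarith) (by nlinarith [mul_pos this ht])
      nlinarith [pow_pos hx 3]
  · push Not at hz
    apply Real.exp_le_exp.2
    rw [div_le_iff₀ hh]
    have e : -(1 / (2 * h) * z ^ 2 * (z - t)) * h = -(z ^ 2 * (z - t) / 2) := by field_simp
    rw [e]
    have h0 : 0 < z := ht.trans htz
    have h1 : z ^ 2 / 4 ≤ (z ^ 2 + z * t + t ^ 2) / 3 - x ^ 2 := by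
      nlinarith [mul_pos h0 ht, mul_self_nonneg t]
    have := mul_le_mul_of_nonneg_left h1 (by linarith : 0 ≤ z - t)
    nlinarith

theorem lintegral_lineWeight_le {x h : ℝ} (hx : 0 < x) (hh : 0 < h) :
    ∫⁻ z in Ioi 0, ∫⁻ t in Ioo 0 z,
        ENNReal.ofReal (Real.exp (2 * (lineWeight x t - lineWeight x z) / h)) ≤
      ENNReal.ofReal (64 * x ^ 2 * (1 + h / (2 * x ^ 3)) * Real.exp (4 * x ^ 3 / 3 / h)) := by
  refine le_trans (setLIntegral_mono' measurableSet_Ioi fun z _ =>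
    setLIntegral_mono' measurableSet_Ioo fun t ht =>
      ENNReal.ofReal_le_ofReal (lineWeight_growth hx hh ht.1 ht.2)) ?_
  refine (lintegral_growthMajorant_le hx (by positivity)).trans (ENNReal.ofReal_le_ofReal ?_)
  have h1 : 1 ≤ Real.exp (4 * x ^ 3 / 3 / h) := Real.one_le_exp (by positivity)
  have e : 1 / (8 * (1 / (2 * h)) * x) = x ^ 2 / 2 * (h / (2 * x ^ 3)) := by field_simp; ring
  rw [e]
  have h2 : 0 ≤ x ^ 2 * (h / (2 * x ^ 3)) := by positivity
  nlinarith

theorem integral_lineWeight {x h : ℝ} (hx : 0 < x) (hh : 0 < h) :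
    ∫ z in Ici 0, Real.exp (-(2 * lineWeight x z / h)) =
      Real.exp (4 * x ^ 3 / 3 / h) * (x * Real.sqrt (h / (2 * x ^ 3))) *
        modelInt 0 (Real.sqrt (h / (2 * x ^ 3))) := by
  refine setIntegral_exp_eq_modelInt _ measurableSet_Ici (by positivity) hx (fun v => ?_) fun v => ?_
  · simp only [modelDom, mem_Ici, mem_ofPred_eq, zero_mul]
    constructor
    · intro h; exact ⟨by linarith [(mul_nonneg_iff_of_pos_left hx).1 h], by positivity⟩
    · rintro ⟨h, -⟩; exact mul_nonneg hx.le (by linarith)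
  · rw [sq_mul_modelPhase_zero, Real.sq_sqrt (by positivity), lineWeight]
    field_simp
    ring

/-! ### The circle -/

/-- The primitive `η z - sin z`, with `η = cos θ`, of the drift on the circle, after a translation. -/
noncomputable def circWeight (θ z : ℝ) : ℝ := Real.cos θ * z - Real.sin z

/-- The critical point `θ` is the global minimum on the full period: this is `modelPhase_ge` at `v =
z/θ - 1`. -/
theorem circWeight_ge {θ z : ℝ} (hθ : θ ∈ Ioc 0 (Real.pi / 2)) (hz : z ∈ Icc 0 (2 * Real.pi)) :
    θ * Real.cos θ - Real.sin θ ≤ circWeight θ z := by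
  have h1 := cube_mul_modelPhase hθ.1.ne' (z / θ - 1)
  have e : θ * (1 + (z / θ - 1)) = z := by have := hθ.1.ne'; field_simp; ring
  have h2 := modelPhase_ge (v := z / θ - 1) (Ioc_subset_Icc_self hθ)
    ⟨by have := div_nonneg hz.1 hθ.1.le; linarith, by rw [e]; exact hz.2⟩
  have h3 : 0 ≤ modelPhase θ (z / θ - 1) := le_trans (by have := Real.pi_pos; positivity) h2
  have h4 : 0 ≤ θ ^ 3 * ((z / θ - 1) ^ 2 * modelPhase θ (z / θ - 1)) := by
    have := hθ.1; positivity
  rw [h1, e] at h4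
  have e2 : θ * (z / θ - 1) = z - θ := by have := hθ.1.ne'; field_simp
  rw [e2] at h4
  unfold circWeight
  linarith

theorem circWeight_sub (θ z t : ℝ) : circWeight θ z - circWeight θ t =
    2 * ((z - t) / 2 * Real.cos θ - Real.sin ((z - t) / 2) * Real.cos ((z + t) / 2)) := by
  have h := Real.sin_sub_sin z t
  unfold circWeight
  linarith

/-- Half of an increment of `circWeight` is `sin p (cos θ - cos q) + cos θ (p - sin p)`. Since `θ ≤
q/2`, the cosine difference is at least `cos (q/2) - cos q ≥ 1 - cos (q/2)`, of order `q²`. For `p ≤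
π/2` the first term has the required size. For larger `p` the second does, as `θ ≤ π/4` keeps `cos
θ` above `1/2`. -/
theorem circWeight_growth_aux {θ p q : ℝ} (hθ0 : 0 < θ) (hp0 : 0 < p) (hpq : p < q) (hq : q ≤ Real.pi)
    (h4 : 4 * θ ≤ q) : p * q ^ 2 / (8 * Real.pi ^ 3) ≤ p * Real.cos θ - Real.sin p * Real.cos q := by
  have hpi := Real.pi_pos
  have hpi3 := Real.pi_gt_three
  have hsp : 0 ≤ Real.sin p := Real.sin_nonneg_of_nonneg_of_le_pi hp0.le (by linarith)
  have hq2 : Real.cos (q / 2) ≤ Real.cos θ :=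
    Real.cos_le_cos_of_nonneg_of_le_pi hθ0.le (by linarith) (by linarith)
  have hc0 : 0 ≤ Real.cos (q / 2) := Real.cos_nonneg_of_neg_pi_div_two_le_of_le (by linarith) (by linarith)
  have hc1 : Real.cos (q / 2) ≤ 1 - 2 / Real.pi ^ 2 * (q / 2) ^ 2 :=
    Real.cos_le_one_sub_mul_cos_sq (by rw [abs_of_nonneg (by linarith)]; linarith)
  have hcq : Real.cos q = 2 * Real.cos (q / 2) ^ 2 - 1 := by
    rw [← Real.cos_two_mul]; congr 1; ring
  have hdiff : q ^ 2 / (2 * Real.pi ^ 2) ≤ Real.cos θ - Real.cos q := by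
    have e : 2 / Real.pi ^ 2 * (q / 2) ^ 2 = q ^ 2 / (2 * Real.pi ^ 2) := by field_simp
    rw [e] at hc1
    have : 0 ≤ q ^ 2 / (2 * Real.pi ^ 2) := by positivity
    nlinarith
  have hsle : Real.sin p ≤ p := Real.sin_le hp0.le
  have hcθ : 0 ≤ Real.cos θ := hc0.trans hq2
  have hexp : p * Real.cos θ - Real.sin p * Real.cos q =
      Real.sin p * (Real.cos θ - Real.cos q) + Real.cos θ * (p - Real.sin p) := by ring
  rw [hexp]
  rcases le_or_gt p (Real.pi / 2) with hp2 | hp2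
  · have h1 : 2 / Real.pi * p ≤ Real.sin p := Real.mul_le_sin hp0.le hp2
    have h2 : (2 / Real.pi * p) * (q ^ 2 / (2 * Real.pi ^ 2)) ≤
        Real.sin p * (Real.cos θ - Real.cos q) :=
      mul_le_mul h1 hdiff (by positivity) hsp
    have e : (2 / Real.pi * p) * (q ^ 2 / (2 * Real.pi ^ 2)) = 8 * (p * q ^ 2 / (8 * Real.pi ^ 3)) := by
      field_simp
    have h3 : 0 ≤ p * q ^ 2 / (8 * Real.pi ^ 3) := by positivity
    nlinarith [mul_nonneg hcθ (sub_nonneg.2 hsle)]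
  · have h1 : p * q ^ 2 / (8 * Real.pi ^ 3) ≤ 1 / 8 := by
      rw [div_le_div_iff₀ (by positivity) (by norm_num)]
      have : p * q ^ 2 ≤ Real.pi * Real.pi ^ 2 := by
        have : 0 ≤ q := by linarith
        gcongr; linarith
      nlinarith
    have h2 : 1 / 2 ≤ Real.cos θ := by
      rw [← Real.cos_pi_div_three]
      exact Real.cos_le_cos_of_nonneg_of_le_pi hθ0.le (by linarith) (by linarith)
    have h3 : Real.sin p ≤ 1 := Real.sin_le_one p
    have h5 : 0 ≤ Real.cos θ - Real.cos q := le_trans (by positivity) hdiff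
    nlinarith [mul_nonneg hsp h5]

/-- Increments of the weight are invariant under `(z, t) ↦ (2π - t, 2π - z)`, so the part of the
triangle with midpoint beyond `π` is reflected to the other part, and one majorant is spent on each.
The constant `8` in `growthMajorant` guarantees `4 θ ≤ q` when neither point is near its end. -/
theorem circWeight_growth {θ h z t : ℝ} (hθ : θ ∈ Ioc 0 (Real.pi / 2)) (hh : 0 < h) (ht : 0 < t)
    (htz : t < z) (hz : z < 2 * Real.pi) :
    Real.exp (2 * (circWeight θ t - circWeight θ z) / h) ≤
      growthMajorant θ (1 / (16 * Real.pi ^ 3 * h)) (2 * (Real.sin θ - θ * Real.cos θ) / h) z t +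
      growthMajorant θ (1 / (16 * Real.pi ^ 3 * h)) (2 * (Real.sin θ - θ * Real.cos θ) / h)
        (2 * Real.pi - t) (2 * Real.pi - z) := by
  have hpi := Real.pi_pos
  set p := (z - t) / 2 with hp
  set q := (z + t) / 2 with hq
  have hp0 : 0 < p := by rw [hp]; linarith
  have hpq : p < q := by rw [hp, hq]; linarith
  have hpq' : p < 2 * Real.pi - q := by rw [hp, hq]; linarith
  have hsub := circWeight_sub θ z t
  rw [← hp, ← hq] at hsub
  have hA : Real.exp (2 * (circWeight θ t - circWeight θ z) / h) ≤
      Real.exp (2 * (Real.sin θ - θ * Real.cos θ) / h) := by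
    apply Real.exp_le_exp.2
    refine div_le_div_of_nonneg_right (mul_le_mul_of_nonneg_left ?_ zero_le_two) hh.le
    -- Replacing `cos q` by `cos p` bounds the increment from `t` to `z` below by the weight at `2 p
    -- = z - t`, hence by the global minimum.
    have h1 : Real.cos q ≤ Real.cos p := by
      rcases le_or_gt q Real.pi with h | h
      · exact Real.cos_le_cos_of_nonneg_of_le_pi hp0.le h hpq.le
      · rw [← Real.cos_two_pi_sub q]
        exact Real.cos_le_cos_of_nonneg_of_le_pi hp0.le (by linarith) hpq'.le
    have hsp : 0 ≤ Real.sin p := Real.sin_nonneg_of_nonneg_of_le_pi hp0.le (by rw [hp]; linarith)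
    have h2 := circWeight_ge hθ (z := 2 * p) ⟨by linarith, by rw [hp]; linarith⟩
    rw [circWeight, Real.sin_two_mul] at h2
    nlinarith [mul_le_mul_of_nonneg_left h1 hsp]
  by_cases h1 : z < 8 * θ
  · refine hA.trans ?_
    have := growthMajorant_nonneg θ (1 / (16 * Real.pi ^ 3 * h))
      (2 * (Real.sin θ - θ * Real.cos θ) / h) (2 * Real.pi - t) (2 * Real.pi - z)
    have e : growthMajorant θ (1 / (16 * Real.pi ^ 3 * h))
      (2 * (Real.sin θ - θ * Real.cos θ) / h) z t = _ := if_pos h1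
    rw [e]; linarith
  by_cases h2 : 2 * Real.pi - t < 8 * θ
  · refine hA.trans ?_
    have := growthMajorant_nonneg θ (1 / (16 * Real.pi ^ 3 * h))
      (2 * (Real.sin θ - θ * Real.cos θ) / h) z t
    have e : growthMajorant θ (1 / (16 * Real.pi ^ 3 * h))
      (2 * (Real.sin θ - θ * Real.cos θ) / h) (2 * Real.pi - t) (2 * Real.pi - z) = _ := if_pos h2
    rw [e]; linarith
  rw [growthMajorant, growthMajorant, if_neg h1, if_neg h2]
  push Not at h1 h2
  have key : ∀ y q' : ℝ, 0 ≤ y → y ≤ 2 * q' → Real.cos q' = Real.cos q → p < q' → q' ≤ Real.pi →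
      4 * θ ≤ q' → Real.exp (2 * (circWeight θ t - circWeight θ z) / h) ≤
        Real.exp (-(1 / (16 * Real.pi ^ 3 * h) * y ^ 2 * (2 * p))) := by
    intro y q' hy0 hy hcos hpq hq' h4
    apply Real.exp_le_exp.2
    have h5 := circWeight_growth_aux hθ.1 hp0 hpq hq' h4
    rw [hcos] at h5
    rw [div_le_iff₀ hh]
    have e : -(1 / (16 * Real.pi ^ 3 * h) * y ^ 2 * (2 * p)) * h = -(p * y ^ 2 / (8 * Real.pi ^ 3)) := by
      field_simp; ring
    rw [e]
    have h6 : p * y ^ 2 / (8 * Real.pi ^ 3) ≤ 4 * (p * q' ^ 2 / (8 * Real.pi ^ 3)) := by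
      rw [mul_div_assoc']
      refine div_le_div_of_nonneg_right ?_ (by positivity)
      have : y ^ 2 ≤ (2 * q') ^ 2 := by gcongr
      nlinarith
    linarith
  rcases le_or_gt q Real.pi with hqp | hqp
  · have := key z q (by linarith) (by rw [hq]; linarith) rfl hpq hqp (by rw [hq]; linarith)
    have e : 2 * p = z - t := by rw [hp]; ring
    rw [e] at this
    exact this.trans (le_add_of_nonneg_right (Real.exp_pos _).le)
  · have := key (2 * Real.pi - t) (2 * Real.pi - q) (by linarith) (by rw [hq]; linarith)
      (Real.cos_two_pi_sub q) hpq' (by linarith) (by rw [hq]; linarith)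
    have e : 2 * p = 2 * Real.pi - t - (2 * Real.pi - z) := by rw [hp]; ring
    rw [e] at this
    exact this.trans (le_add_of_nonneg_left (Real.exp_pos _).le)

theorem lintegral_circWeight_le {θ h : ℝ} (hθ : θ ∈ Ioc 0 (Real.pi / 2)) (hh : 0 < h) :
    ∫⁻ z in Ioo 0 (2 * Real.pi), ∫⁻ t in Ioo 0 z,
        ENNReal.ofReal (Real.exp (2 * (circWeight θ t - circWeight θ z) / h)) ≤
      ENNReal.ofReal (128 * θ ^ 2 * (1 + h / θ ^ 3) *
        Real.exp (2 * (Real.sin θ - θ * Real.cos θ) / h)) := by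
  have hpi := Real.pi_pos
  have hθ0 := hθ.1
  set b := 1 / (16 * Real.pi ^ 3 * h) with hb
  set M := 2 * (Real.sin θ - θ * Real.cos θ) / h with hM
  set R : Set (ℝ × ℝ) := {p | 0 < p.2 ∧ p.2 < p.1 ∧ p.1 < 2 * Real.pi} with hR
  have hRm : MeasurableSet R := by
    rw [hR]; measurability
  set I : ℝ × ℝ → ENNReal := R.indicator fun p => ENNReal.ofReal (growthMajorant θ b M p.1 p.2)
  have hI : Measurable I := (measurable_growthMajorant θ b M).ennreal_ofReal.indicator hRm
  have hIint : ∫⁻ z, ∫⁻ t, I (z, t) ≤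
      ENNReal.ofReal (64 * θ ^ 2 * Real.exp M + 1 / (8 * b * θ)) := by
    refine le_trans ?_ (lintegral_growthMajorant_le (M := M) hθ0 (by positivity : 0 < b))
    rw [← lintegral_indicator measurableSet_Ioi]
    refine lintegral_mono fun z => ?_
    by_cases hz : z ∈ Ioi (0 : ℝ)
    · rw [indicator_of_mem hz, ← lintegral_indicator measurableSet_Ioo]
      refine lintegral_mono fun t => ?_
      simp only [I]
      by_cases ht : (z, t) ∈ R
      · rw [indicator_of_mem ht, indicator_of_mem (show t ∈ Ioo 0 z from ⟨ht.1, ht.2.1⟩)]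
      · rw [indicator_of_notMem ht]; exact zero_le
    · rw [indicator_of_notMem hz]
      refine le_of_eq ?_
      rw [lintegral_eq_zero_of_ae_eq_zero]
      refine .of_forall fun t => ?_
      simp only [I]
      exact indicator_of_notMem (fun hm => hz (hm.1.trans hm.2.1)) _
  have hmain : ∫⁻ z in Ioo 0 (2 * Real.pi), ∫⁻ t in Ioo 0 z,
        ENNReal.ofReal (Real.exp (2 * (circWeight θ t - circWeight θ z) / h)) ≤
      ∫⁻ z, ∫⁻ t, (I (z, t) + I (2 * Real.pi - t, 2 * Real.pi - z)) := by
    rw [← lintegral_indicator measurableSet_Ioo]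
    refine lintegral_mono fun z => ?_
    by_cases hz : z ∈ Ioo 0 (2 * Real.pi)
    · rw [indicator_of_mem hz, ← lintegral_indicator measurableSet_Ioo]
      refine lintegral_mono fun t => ?_
      by_cases ht : t ∈ Ioo 0 z
      · rw [indicator_of_mem ht]
        have h1 : (z, t) ∈ R := ⟨ht.1, ht.2, hz.2⟩
        have h2 : (2 * Real.pi - t, 2 * Real.pi - z) ∈ R :=
          ⟨by simpa using hz.2, by simpa using ht.2, by simpa using ht.1⟩
        simp only [I]
        rw [indicator_of_mem h1, indicator_of_mem h2,
          ← ENNReal.ofReal_add (growthMajorant_nonneg ..) (growthMajorant_nonneg ..)]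
        exact ENNReal.ofReal_le_ofReal (circWeight_growth hθ hh ht.1 ht.2 hz.2)
      · rw [indicator_of_notMem ht]; exact zero_le
    · rw [indicator_of_notMem hz]; exact zero_le
  refine hmain.trans ?_
  have hI2 : Measurable fun p : ℝ × ℝ => I (p.1, p.2) := hI
  have e1 : ∀ z, ∫⁻ t, (I (z, t) + I (2 * Real.pi - t, 2 * Real.pi - z)) =
      (∫⁻ t, I (z, t)) + ∫⁻ t, I (2 * Real.pi - t, 2 * Real.pi - z) := fun z =>
    lintegral_add_left (hI.comp measurable_prodMk_left) _
  simp_rw [e1]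
  rw [lintegral_add_left hI.lintegral_prod_right', lintegral_lintegral_reflect _ hI]
  refine (add_le_add hIint hIint).trans ?_
  rw [← ENNReal.ofReal_add (by positivity) (by positivity)]
  apply ENNReal.ofReal_le_ofReal
  have hM0 : 0 ≤ M := by
    rw [hM]
    have := circWeight_ge hθ (z := 0) ⟨le_rfl, by positivity⟩
    simp [circWeight] at this
    have : 0 ≤ Real.sin θ - θ * Real.cos θ := by linarith
    positivity
  have h1 : 1 ≤ Real.exp M := Real.one_le_exp hM0
  have e : 1 / (8 * b * θ) = 2 * Real.pi ^ 3 * (θ ^ 2 * (h / θ ^ 3)) := by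
    rw [hb]; field_simp; ring
  rw [e]
  have h2 : 0 ≤ θ ^ 2 * (h / θ ^ 3) := by positivity
  -- This bounds the coefficient of the tail by that of the near part, so one constant `128 = 2 ·
  -- 64` serves for both halves.
  have h3 : 2 * Real.pi ^ 3 ≤ 64 := by
    have : Real.pi ^ 3 ≤ 3.15 ^ 3 := by gcongr; exact Real.pi_lt_d2.le
    norm_num at this ⊢; linarith
  have h4 : θ ^ 2 * (h / θ ^ 3) * 1 ≤ θ ^ 2 * (h / θ ^ 3) * Real.exp M := by gcongr
  nlinarith

theorem integral_circWeight {θ h : ℝ} (hθ : 0 < θ) (hh : 0 < h) :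
    ∫ z in Icc 0 (2 * Real.pi), Real.exp (-(2 * circWeight θ z / h)) =
      Real.exp (2 * (Real.sin θ - θ * Real.cos θ) / h) * (θ * Real.sqrt (h / θ ^ 3)) *
        modelInt θ (Real.sqrt (h / θ ^ 3)) := by
  refine setIntegral_exp_eq_modelInt _ measurableSet_Icc (by positivity) hθ (fun v => ?_) fun v => ?_
  · simp only [modelDom, mem_Icc, mem_ofPred_eq]
    refine and_congr_left fun _ => ?_
    constructor
    · intro h; linarith [(mul_nonneg_iff_of_pos_left hθ).1 h]
    · intro h; exact mul_nonneg hθ.le (by linarith)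
  · have h1 := cube_mul_modelPhase hθ.ne' v
    rw [Real.sq_sqrt (by positivity), circWeight]
    have e : 2 * (v ^ 2 * modelPhase θ v) / (h / θ ^ 3) = 2 * (θ ^ 3 * (v ^ 2 * modelPhase θ v)) / h := by
      field_simp
    rw [e, h1]
    field_simp
    ring

/-! ## The weak equation -/

/-- `χ` is a test function on `Y` with derivative `χ'`. -/
structure IsTest {Y : Type} [TopologicalSpace Y] (c : ℝ → Y) (χ χ' : Y → ℂ) : Prop where
  supp : HasCompactSupport χ
  smooth : ContDiff ℝ ∞ (χ ∘ c)
  deriv : ∀ x : ℝ, HasDerivAt (χ ∘ c) (χ' (c x)) x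

section Weak
variable {Y : Type} [TopologicalSpace Y] {c : ℝ → Y}

theorem IsTest.continuous (hc : Topology.IsQuotientMap c) {χ χ' : Y → ℂ} (H : IsTest c χ χ') :
    Continuous χ := hc.continuous_iff.2 H.smooth.continuous

theorem IsTest.continuous_deriv (hc : Topology.IsQuotientMap c) {χ χ' : Y → ℂ}
    (H : IsTest c χ χ') : Continuous χ' := by
  rw [hc.continuous_iff]
  have : χ' ∘ c = _root_.deriv (χ ∘ c) := funext fun x => (H.deriv x).deriv.symm
  rw [this]
  exact H.smooth.continuous_deriv (by simp)

theorem IsTest.supp_deriv [T2Space Y] (hc : Topology.IsQuotientMap c) {χ χ' : Y → ℂ}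
    (H : IsTest c χ χ') : HasCompactSupport χ' := by
  refine HasCompactSupport.intro H.supp fun y hy => ?_
  obtain ⟨x, rfl⟩ := hc.surjective y
  have h1 : χ ∘ c =ᶠ[nhds x] fun _ => 0 := by
    have : {y | y ∉ tsupport χ} ∈ nhds (c x) := (isClosed_tsupport χ).isOpen_compl.mem_nhds hy
    filter_upwards [hc.continuous.continuousAt this] with z hz
    exact image_eq_zero_of_notMem_tsupport (f := χ) hz
  have h2 := h1.deriv_eq
  rw [(H.deriv x).deriv] at h2
  simpa using h2

variable [MeasureSpace Y] [OpensMeasurableSpace Y] [IsFiniteMeasureOnCompacts (volume : Measure Y)]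
  [T2Space Y]

/-- The derivative is eliminated: it must be `h⁻¹ (v - w u)`, which is square integrable because `w`
is dominated by the weight `ρ` of the domain. Regularity of `u` thus becomes part of a weak equation
tested on smooth functions. -/
theorem opGraph_iff_weak (hc : Topology.IsQuotientMap c) {w ρ : Y → ℝ} (hw : Continuous w) {C : ℝ}
    (hwρ : ∀ y, |w y| ≤ C * |ρ y|) {h : ℝ} (hh : h ≠ 0) (u v : L2 Y) :
    OpGraph c w ρ h u v ↔ MemLp (fun y => (ρ y : ℂ) * u y) 2 volume ∧
      ∀ χ χ' : Y → ℂ, IsTest c χ χ' →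
        ∫ y, u y * (-(h : ℂ) * χ' y + (w y : ℂ) * χ y) = ∫ y, v y * χ y := by
  unfold OpGraph
  refine and_congr_right fun hρ => ?_
  have hwu : MemLp (fun y => (w y : ℂ) * u y) 2 volume := by
    refine hρ.of_le_mul (c := C) ?_ (.of_forall fun y => ?_)
    · exact (Complex.continuous_ofReal.comp hw).aestronglyMeasurable.mul (Lp.memLp u).1
    · rw [norm_mul, norm_mul, Complex.norm_real, Complex.norm_real, ← mul_assoc]
      exact mul_le_mul_of_nonneg_right (hwρ y) (norm_nonneg _)
  have hL : ∀ {χ χ' : Y → ℂ}, IsTest c χ χ' → MemLp χ 2 (volume : Measure Y) ∧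
      MemLp χ' 2 (volume : Measure Y) := fun H =>
    ⟨(H.continuous hc).memLp_of_hasCompactSupport H.supp,
      (H.continuous_deriv hc).memLp_of_hasCompactSupport (H.supp_deriv hc)⟩
  have hexp : ∀ {χ χ' : Y → ℂ}, IsTest c χ χ' →
      ∫ y, u y * (-(h : ℂ) * χ' y + (w y : ℂ) * χ y) =
        -(h : ℂ) * (∫ y, u y * χ' y) + ∫ y, (w y : ℂ) * u y * χ y := fun {χ χ'} H => by
    have i1 : Integrable fun y => u y * χ' y := (Lp.memLp u).integrable_mul (hL H).2
    have i2 : Integrable fun y => (w y : ℂ) * u y * χ y := hwu.integrable_mul (hL H).1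
    rw [← integral_const_mul, ← integral_add (i1.const_mul _) i2]
    congr 1; ext y; ring
  have hhc : (h : ℂ) ≠ 0 := by exact_mod_cast hh
  constructor
  · rintro ⟨g, hg, hv⟩ χ χ' H
    have i1 : Integrable fun y => g y * χ y := (Lp.memLp g).integrable_mul (hL H).1
    have i2 : Integrable fun y => (w y : ℂ) * u y * χ y := hwu.integrable_mul (hL H).1
    rw [hexp H, hg χ χ' H.supp H.smooth H.deriv, neg_mul_neg, ← integral_const_mul,
      ← integral_add (i1.const_mul _) i2]
    refine integral_congr_ae ?_
    filter_upwards [hv] with y hy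
    rw [hy]; ring
  · intro hweak
    have hgL : MemLp (fun y => (h : ℂ)⁻¹ * (v y - (w y : ℂ) * u y)) 2 volume :=
      ((Lp.memLp v).sub hwu).const_mul _
    refine ⟨hgL.toLp _, fun χ χ' h1 h2 h3 => ?_, ?_⟩
    · have H : IsTest c χ χ' := ⟨h1, h2, h3⟩
      have h4 := hweak χ χ' H
      rw [hexp H] at h4
      have i1 : Integrable fun y => v y * χ y := (Lp.memLp v).integrable_mul (hL H).1
      have i2 : Integrable fun y => (w y : ℂ) * u y * χ y := hwu.integrable_mul (hL H).1
      have e : ∫ y, hgL.toLp _ y * χ y =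
          (h : ℂ)⁻¹ * ((∫ y, v y * χ y) - ∫ y, (w y : ℂ) * u y * χ y) := by
        rw [← integral_sub i1 i2, ← integral_const_mul]
        refine integral_congr_ae ?_
        filter_upwards [hgL.coeFn_toLp] with y hy
        rw [hy]; ring
      rw [e, ← h4]
      field_simp
      ring
    · filter_upwards [hgL.coeFn_toLp] with y hy
      rw [hy]; field_simp; ring

end Weak

/-! ## The Schur test -/

/-- Split `κ` into two square roots, apply Cauchy-Schwarz with the row bound, then exchange the
integrals and use the column bound. -/
theorem schur_lintegral_le {Y : Type} [MeasureSpace Y] [SFinite (volume : Measure Y)]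
    {κ : Y → Y → ENNReal} (hκ : Measurable (Function.uncurry κ)) {C₁ C₂ : ENNReal}
    (h1 : ∀ y, ∫⁻ s, κ y s ≤ C₁) (h2 : ∀ s, ∫⁻ y, κ y s ≤ C₂) {v : Y → ENNReal}
    (hv : AEMeasurable v volume) :
    ∫⁻ y, (∫⁻ s, κ y s * v s) ^ 2 ≤ C₁ * C₂ * ∫⁻ s, v s ^ 2 := by
  have hκy : ∀ y, Measurable (κ y) := fun y => hκ.comp measurable_prodMk_left
  have hsq : ∀ a : ENNReal, a ^ (1 / 2 : ℝ) * a ^ (1 / 2 : ℝ) = a := fun a => by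
    rw [← ENNReal.rpow_add_of_nonneg _ _ (by norm_num) (by norm_num)]; norm_num
  have hpt : ∀ y, (∫⁻ s, κ y s * v s) ^ 2 ≤ C₁ * ∫⁻ s, κ y s * v s ^ 2 := fun y => by
    have e : ∀ s, κ y s * v s = κ y s ^ (1 / 2 : ℝ) * (κ y s ^ (1 / 2 : ℝ) * v s) := fun s => by
      rw [← mul_assoc, hsq]
    rw [lintegral_congr e]
    refine (sq_lintegral_mul_le ((hκy y).pow_const _).aemeasurable
      (((hκy y).pow_const _).aemeasurable.mul hv)).trans ?_
    have e2 : ∀ s, (κ y s ^ (1 / 2 : ℝ)) ^ 2 = κ y s := fun s => by rw [sq, hsq]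
    have e3 : ∫⁻ s, (κ y s ^ (1 / 2 : ℝ)) ^ 2 = ∫⁻ s, κ y s := lintegral_congr e2
    have e4 : ∫⁻ s, (κ y s ^ (1 / 2 : ℝ) * v s) ^ 2 = ∫⁻ s, κ y s * v s ^ 2 :=
      lintegral_congr fun s => by rw [mul_pow, e2]
    rw [e3]
    refine (mul_le_mul' (h1 y) (le_of_eq ?_))
    exact e4
  have hm : AEMeasurable (fun p : Y × Y => κ p.1 p.2 * v p.2 ^ 2) (volume.prod volume) := by
    refine hκ.aemeasurable.mul ?_
    exact (hv.comp_quasiMeasurePreserving Measure.quasiMeasurePreserving_snd).pow_const 2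
  calc _ ≤ ∫⁻ y, C₁ * ∫⁻ s, κ y s * v s ^ 2 := lintegral_mono hpt
    _ ≤ C₁ * ∫⁻ y, ∫⁻ s, κ y s * v s ^ 2 := by
        rw [lintegral_const_mul'' _ hm.lintegral_prod_right']
    _ = C₁ * ∫⁻ s, ∫⁻ y, κ y s * v s ^ 2 := by rw [lintegral_lintegral_swap hm]
    _ ≤ C₁ * ∫⁻ s, C₂ * v s ^ 2 := by
        gcongr with s
        rw [lintegral_mul_const _ (show Measurable fun y => κ y s from hκ.comp measurable_prodMk_right)]
        gcongr
        exact h2 s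
    _ = _ := by rw [lintegral_const_mul'' _ (hv.pow_const 2), mul_assoc]

/-! ## The inverse operator on the line -/

/-- `h` times the integral kernel of the inverse of `lineP h (-x²)`. -/
noncomputable def lineKernel (x h y s : ℝ) : ℝ :=
  if s < y then Real.exp ((lineWeight x s - lineWeight x y) / h) else 0

theorem continuous_lineWeight (x : ℝ) : Continuous (lineWeight x) := by
  unfold lineWeight; fun_prop

theorem measurable_lineKernel (x h : ℝ) : Measurable (Function.uncurry (lineKernel x h)) := by
  have := continuous_lineWeight x
  unfold lineKernel Function.uncurry
  exact Measurable.ite (measurableSet_lt (by fun_prop) (by fun_prop)) (by fun_prop) (by fun_prop)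

theorem lineKernel_nonneg (x h y s : ℝ) : 0 ≤ lineKernel x h y s := by
  unfold lineKernel; split_ifs <;> positivity

theorem lineWeight_neg (x y : ℝ) : lineWeight x (-y) = -lineWeight x y := by
  unfold lineWeight; ring

/-- `∫₀^∞ exp (-2 Φ / h)`. -/
noncomputable def lineMass (x h : ℝ) : ℝ := ∫ z in Ici 0, Real.exp (-(2 * lineWeight x z / h))

theorem modelInt_pos (θ : Angle) {ε : ℝ} (hε : 0 < ε) : 0 < modelInt θ ε := by
  obtain ⟨δ, hδ, h⟩ := modelFamily.laplaceInt_lower ε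
  exact hδ.trans_le (h θ ε hε le_rfl)

theorem zero_mem_angle : (0 : ℝ) ∈ Icc 0 (Real.pi / 2) := ⟨le_rfl, by positivity⟩

theorem lineMass_pos {x h : ℝ} (hx : 0 < x) (hh : 0 < h) : 0 < lineMass x h := by
  rw [lineMass, integral_lineWeight hx hh]
  have := modelInt_pos ⟨0, zero_mem_angle⟩ (ε := Real.sqrt (h / (2 * x ^ 3))) (by positivity)
  simp only at this
  positivity

/-- A function that is not integrable has integral `0` by convention, whereas this integral was
computed to be positive. -/
theorem integrableOn_lineMass {x h : ℝ} (hx : 0 < x) (hh : 0 < h) :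
    IntegrableOn (fun z => Real.exp (-(2 * lineWeight x z / h))) (Ici 0) := by
  by_contra hc
  exact (lineMass_pos hx hh).ne' (integral_undef hc)

theorem lintegral_lineMass {x h : ℝ} (hx : 0 < x) (hh : 0 < h) :
    ∫⁻ z in Ici 0, ENNReal.ofReal (Real.exp (-(2 * lineWeight x z / h))) =
      ENNReal.ofReal (lineMass x h) := by
  rw [lineMass, ofReal_integral_eq_lintegral_ofReal (integrableOn_lineMass hx hh)
    (.of_forall fun z => (Real.exp_pos _).le)]

theorem enorm_ofReal_sq {a : ℝ} (ha : 0 ≤ a) : ‖a‖ₑ ^ 2 = ENNReal.ofReal (a ^ 2) := by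
  rw [Real.enorm_eq_ofReal ha, ENNReal.ofReal_pow ha]

/-- The half plane `s < y` consists of the quadrant `s ≤ 0 ≤ y`, where the squared kernel factors
and yields `lineMass²` by oddness of the weight, and of the parts `0 < s < y` and `s < y < 0`, which
the reflection through the origin exchanges. -/
theorem lintegral_lineKernel_le {x h : ℝ} (hx : 0 < x) (hh : 0 < h) :
    ∫⁻ y, ∫⁻ s, ‖lineKernel x h y s‖ₑ ^ 2 ≤ ENNReal.ofReal (lineMass x h ^ 2 +
      2 * (64 * x ^ 2 * (1 + h / (2 * x ^ 3)) * Real.exp (4 * x ^ 3 / 3 / h))) := by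
  set D := 64 * x ^ 2 * (1 + h / (2 * x ^ 3)) * Real.exp (4 * x ^ 3 / 3 / h) with hD
  have hD0 : 0 ≤ D := by positivity
  have hΦ := continuous_lineWeight x
  set R : Set (ℝ × ℝ) := {p | 0 < p.2 ∧ p.2 < p.1} with hR
  have hRm : MeasurableSet R := by rw [hR]; measurability
  set B : ℝ × ℝ → ENNReal := R.indicator fun p =>
    ENNReal.ofReal (Real.exp (2 * (lineWeight x p.2 - lineWeight x p.1) / h)) with hB
  have hBm : Measurable B := Measurable.indicator (by fun_prop) hRm
  have hBint : ∫⁻ z, ∫⁻ t, B (z, t) ≤ ENNReal.ofReal D := by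
    refine le_trans ?_ (lintegral_lineWeight_le hx hh)
    rw [← lintegral_indicator measurableSet_Ioi]
    refine lintegral_mono fun z => ?_
    by_cases hz : z ∈ Ioi (0 : ℝ)
    · rw [indicator_of_mem hz, ← lintegral_indicator measurableSet_Ioo]
      refine lintegral_mono fun t => ?_
      by_cases ht : (z, t) ∈ R
      · rw [hB, indicator_of_mem ht, indicator_of_mem (show t ∈ Ioo 0 z from ⟨ht.1, ht.2⟩)]
      · rw [hB, indicator_of_notMem ht]; exact zero_le
    · rw [indicator_of_notMem hz]
      refine le_of_eq ?_
      rw [lintegral_eq_zero_of_ae_eq_zero]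
      exact .of_forall fun t => indicator_of_notMem (fun hm => hz (hm.1.trans hm.2)) _
  set P : ℝ → ENNReal := (Ici 0).indicator fun z =>
    ENNReal.ofReal (Real.exp (-(2 * lineWeight x z / h))) with hP
  have hPm : Measurable P := Measurable.indicator (by fun_prop) measurableSet_Ici
  have hPint : ∫⁻ z, P z = ENNReal.ofReal (lineMass x h) := by
    rw [hP, lintegral_indicator measurableSet_Ici, lintegral_lineMass hx hh]
  have hpt : ∀ y s, ‖lineKernel x h y s‖ₑ ^ 2 ≤ P y * P (-s) + (B (y, s) + B (0 - s, 0 - y)) := by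
    intro y s
    rw [enorm_ofReal_sq (lineKernel_nonneg ..), lineKernel]
    split_ifs with hsy
    · have e0 : Real.exp ((lineWeight x s - lineWeight x y) / h) ^ 2 =
          Real.exp (2 * (lineWeight x s - lineWeight x y) / h) := by
        rw [← Real.exp_nat_mul]; congr 1; push_cast; ring
      rw [e0]
      rcases lt_or_ge 0 s with hs | hs
      · have : (y, s) ∈ R := ⟨hs, hsy⟩
        rw [hB, indicator_of_mem this]
        exact le_add_left (le_add_right le_rfl)
      · rcases lt_or_ge y 0 with hy | hy
        · have : (0 - s, 0 - y) ∈ R := ⟨by simpa using hy, by simpa using hsy⟩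
          rw [hB, indicator_of_mem this]
          simp only [zero_sub, lineWeight_neg]
          refine le_add_left (le_add_left (ENNReal.ofReal_le_ofReal (Real.exp_le_exp.2 ?_)))
          exact le_of_eq (by ring)
        · rw [hP, indicator_of_mem (show y ∈ Ici (0:ℝ) from hy),
            indicator_of_mem (show -s ∈ Ici (0:ℝ) by simpa using hs), ← ENNReal.ofReal_mul (by positivity),
            ← Real.exp_add, lineWeight_neg]
          refine le_add_right (ENNReal.ofReal_le_ofReal (Real.exp_le_exp.2 ?_))
          exact le_of_eq (by ring)
    · simp
  have hPn : Measurable fun s => P (-s) := hPm.comp measurable_neg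
  have hBr : Measurable fun p : ℝ × ℝ => B (0 - p.2, 0 - p.1) := hBm.comp (by fun_prop)
  calc _ ≤ ∫⁻ y, ∫⁻ s, (P y * P (-s) + (B (y, s) + B (0 - s, 0 - y))) :=
        lintegral_mono fun y => lintegral_mono fun s => hpt y s
    _ = ∫⁻ y, (P y * (∫⁻ s, P (-s)) + ((∫⁻ s, B (y, s)) + ∫⁻ s, B (0 - s, 0 - y))) := by
        refine lintegral_congr fun y => ?_
        rw [lintegral_add_left (hPn.const_mul _), lintegral_const_mul _ hPn,
          lintegral_add_left (f := fun s => B (y, s)) (hBm.comp measurable_prodMk_left)]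
    _ = (∫⁻ y, P y) * (∫⁻ s, P (-s)) + ((∫⁻ y, ∫⁻ s, B (y, s)) + ∫⁻ y, ∫⁻ s, B (0 - s, 0 - y)) := by
        rw [lintegral_add_left (hPm.mul_const _), lintegral_mul_const _ hPm,
          lintegral_add_left hBm.lintegral_prod_right']
    _ ≤ ENNReal.ofReal (lineMass x h) * ENNReal.ofReal (lineMass x h) +
        (ENNReal.ofReal D + ENNReal.ofReal D) := by
        rw [lintegral_neg_eq_self P, hPint, lintegral_lintegral_reflect 0 hBm]
        gcongr
    _ = _ := by
        have := (lineMass_pos hx hh).le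
        rw [← ENNReal.ofReal_mul this, ← ENNReal.ofReal_add hD0 hD0,
          ← ENNReal.ofReal_add (by positivity) (by positivity)]
        congr 1; ring

theorem hsKernel_lineKernel {x h : ℝ} (hx : 0 < x) (hh : 0 < h) : HSKernel (lineKernel x h) :=
  ⟨measurable_lineKernel x h, (lintegral_lineKernel_le hx hh).trans_lt ENNReal.ofReal_lt_top⟩

theorem lineMass_le_norm {x h : ℝ} (hx : 0 < x) (hh : 0 < h) :
    lineMass x h ≤ ‖(hsKernel_lineKernel hx hh).op‖ := by
  have hΦ := continuous_lineWeight x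
  -- The factor in `y` lives on the open half line and the one in `s` on the closed one, so that `s
  -- < y` holds strictly where both are nonzero.
  set g : ℝ → ℝ := (Ioi 0).indicator fun y => Real.exp (-(lineWeight x y / h)) with hg
  set f : ℝ → ℝ := fun s => (Ici 0).indicator (fun y => Real.exp (-(lineWeight x y / h))) (-s) with hf
  have hsq : ∀ y, Real.exp (-(lineWeight x y / h)) ^ 2 = Real.exp (-(2 * lineWeight x y / h)) :=
    fun y => by rw [← Real.exp_nat_mul]; congr 1; push_cast; ring
  have hgsq : ∀ y, g y ^ 2 = (Ioi 0).indicator (fun y => Real.exp (-(2 * lineWeight x y / h))) y := by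
    intro y
    by_cases hy : y ∈ Ioi (0:ℝ)
    · rw [hg, indicator_of_mem hy, indicator_of_mem hy, hsq]
    · rw [hg, indicator_of_notMem hy, indicator_of_notMem hy]; simp
  have hfsq : ∀ y, f y ^ 2 =
      (Ici 0).indicator (fun y => Real.exp (-(2 * lineWeight x y / h))) (-y) := by
    intro y
    by_cases hy : -y ∈ Ici (0:ℝ)
    · simp only [hf]; rw [indicator_of_mem hy, indicator_of_mem hy, hsq]
    · simp only [hf]; rw [indicator_of_notMem hy, indicator_of_notMem hy]; simp
  have hgm : Measurable g := Measurable.indicator (by fun_prop) measurableSet_Ioi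
  have hfm : Measurable f :=
    (Measurable.indicator (by fun_prop) measurableSet_Ici).comp measurable_neg
  have hgi : ∫ y, g y ^ 2 = lineMass x h := by
    simp_rw [hgsq]
    rw [integral_indicator measurableSet_Ioi, lineMass, integral_Ici_eq_integral_Ioi]
  have hfi : ∫ y, f y ^ 2 = lineMass x h := by
    simp_rw [hfsq]
    rw [integral_neg_eq_self (fun y =>
      (Ici 0).indicator (fun y => Real.exp (-(2 * lineWeight x y / h))) y),
      integral_indicator measurableSet_Ici, lineMass]
  have hpos := lineMass_pos hx hh
  have hgL : MemLp g 2 volume := (memLp_two_iff_integrable_sq hgm.aestronglyMeasurable).2 (by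
    by_contra hc; rw [integral_undef hc] at hgi; exact hpos.ne hgi)
  have hfL : MemLp f 2 volume := (memLp_two_iff_integrable_sq hfm.aestronglyMeasurable).2 (by
    by_contra hc; rw [integral_undef hc] at hfi; exact hpos.ne hfi)
  have h := (hsKernel_lineKernel hx hh).le_norm_op hfL hgL
    (fun y => indicator_nonneg (fun _ _ => (Real.exp_pos _).le) _)
    (fun y => indicator_nonneg (fun _ _ => (Real.exp_pos _).le) _) zero_le_one (fun y s => ?_)
    (by rw [hfi]; exact hpos)
  · rwa [hfi, hgi, one_mul, Real.mul_self_sqrt hpos.le] at h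
  · rw [one_mul]
    by_cases hy : y ∈ Ioi (0:ℝ)
    · by_cases hs : -s ∈ Ici (0:ℝ)
      · have hsy : s < y := lt_of_le_of_lt (by simpa using hs) hy
        simp only [hg, hf, lineKernel, if_pos hsy]
        rw [indicator_of_mem hy, indicator_of_mem hs, ← Real.exp_add, lineWeight_neg]
        exact (Real.exp_le_exp.2 (le_of_eq (by ring)))
      · simp only [hf]; rw [indicator_of_notMem hs, mul_zero]; exact lineKernel_nonneg ..
    · rw [hg, indicator_of_notMem hy, zero_mul]; exact lineKernel_nonneg ..

/-- The reduced norm of the inverse on the line. -/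
theorem isReducedNorm_line {x h : ℝ} (hx : 0 < x) (hh : 0 < h) :
    IsReducedNorm 128 0 (Real.sqrt (h / (2 * x ^ 3))) (‖(hsKernel_lineKernel hx hh).op‖ /
      (Real.exp (4 * x ^ 3 / 3 / h) * (x * Real.sqrt (h / (2 * x ^ 3))))) := by
  have h1 := lineMass_le_norm hx hh
  have h2 := (hsKernel_lineKernel hx hh).norm_op_sq_le (by positivity) (lintegral_lineKernel_le hx hh)
  set N := ‖(hsKernel_lineKernel hx hh).op‖
  have e := integral_lineWeight hx hh
  rw [← lineMass] at e
  set ε := Real.sqrt (h / (2 * x ^ 3)) with hε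
  have hε0 : 0 < ε := by positivity
  have hε2 : ε ^ 2 = h / (2 * x ^ 3) := Real.sq_sqrt (by positivity)
  set E := Real.exp (4 * x ^ 3 / 3 / h) with hE
  have hE0 : 0 < E := Real.exp_pos _
  constructor
  · rw [le_div_iff₀ (by positivity)]
    rw [e] at h1; linarith
  -- The true rate on the line is `(2/3)/ε²`; it is weakened to the rate `1/π³` valid for every
  -- angle on the circle.
  · have hEinv : E⁻¹ ≤ Real.exp (-(1 / Real.pi ^ 3 / ε ^ 2)) := by
      rw [hE, ← Real.exp_neg]
      apply Real.exp_le_exp.2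
      rw [hε2, neg_le_neg_iff]
      have : 1 / Real.pi ^ 3 ≤ 2 / 3 := by
        rw [div_le_div_iff₀ (by positivity) (by norm_num)]
        have : 3 ^ 3 ≤ Real.pi ^ 3 := pow_le_pow_left₀ (by norm_num) Real.pi_gt_three.le 3
        linarith
      calc 1 / Real.pi ^ 3 / (h / (2 * x ^ 3)) ≤ 2 / 3 / (h / (2 * x ^ 3)) := by gcongr
        _ = _ := by field_simp; ring
    rw [← hε2] at h2
    rw [div_pow, div_le_iff₀ (by positivity)]
    calc N ^ 2 ≤ _ := h2
      _ = (modelInt 0 ε ^ 2 + 128 * (1 + ε ^ 2) / ε ^ 2 * E⁻¹) * (E * (x * ε)) ^ 2 := by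
          rw [e]; field_simp
          ring
      _ ≤ _ := by gcongr

/-! ## The homogeneous weak equation -/

section Antideriv

/-- `exp (a Φ)` as a complex function. -/
noncomputable def cexpW (Φ : ℝ → ℝ) (a y : ℝ) : ℂ := ((Real.exp (a * Φ y) : ℝ) : ℂ)

theorem cexpW_mul_neg (Φ : ℝ → ℝ) (a y : ℝ) : cexpW Φ a y * cexpW Φ (-a) y = 1 := by
  unfold cexpW
  rw [← Complex.ofReal_mul, ← Real.exp_add]; simp

theorem contDiff_cexpW {Φ : ℝ → ℝ} (hΦ : ContDiff ℝ ∞ Φ) (a : ℝ) : ContDiff ℝ ∞ (cexpW Φ a) :=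
  Complex.ofRealCLM.contDiff.comp (Real.contDiff_exp.comp (contDiff_const.mul hΦ))

theorem hasDerivAt_cexpW {Φ : ℝ → ℝ} {w y : ℝ} (hΦ : HasDerivAt Φ w y) (a : ℝ) :
    HasDerivAt (cexpW Φ a) ((a * w : ℝ) * cexpW Φ a y) y := by
  have := ((hΦ.const_mul a).exp).ofReal_comp
  refine this.congr_deriv ?_
  unfold cexpW; push_cast; ring

theorem contDiff_integral_Ioc {g : ℝ → ℂ} (hg : ContDiff ℝ ∞ g) (a : ℝ) :
    ContDiff ℝ ∞ (fun s => ∫ t in a..s, g t) := by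
  rw [contDiff_infty_iff_deriv]
  have hd : ∀ s, HasDerivAt (fun s => ∫ t in a..s, g t) (g s) s := fun s =>
    intervalIntegral.integral_hasDerivAt_right (hg.continuous.intervalIntegrable _ _)
      hg.continuous.stronglyMeasurable.stronglyMeasurableAtFilter hg.continuous.continuousAt
  refine ⟨fun s => (hd s).differentiableAt, ?_⟩
  rwa [show deriv (fun s => ∫ t in a..s, g t) = g from funext fun s => (hd s).deriv]

/-- The transposed equation has the solution `-h⁻¹ exp (Φ/h) ∫ exp (-Φ/h) g`, integrated from the
left of the support. It vanishes to the right of the support precisely because the total integral is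
`0`. -/
theorem exists_isTest_of_integral_eq_zero {Φ w : ℝ → ℝ} (hΦ : ContDiff ℝ ∞ Φ)
    (hw : ∀ y, HasDerivAt Φ (w y) y) {h : ℝ} (hh : h ≠ 0) {g : ℝ → ℂ} (hg : ContDiff ℝ ∞ g)
    (hgc : HasCompactSupport g) (hg0 : ∫ y, cexpW Φ (-h⁻¹) y * g y = 0) :
    ∃ χ χ' : ℝ → ℂ, IsTest id χ χ' ∧ ∀ y, -(h : ℂ) * χ' y + (w y : ℂ) * χ y = g y := by
  have hhc : (h : ℂ) ≠ 0 := by exact_mod_cast hh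
  obtain ⟨R, hR⟩ : ∃ R : ℝ, tsupport g ⊆ Ioc (-R) R := by
    obtain ⟨R, hR⟩ := hgc.isCompact.isBounded.subset_closedBall 0
    refine ⟨R + 1, hR.trans fun y hy => ?_⟩
    rw [Metric.mem_closedBall, dist_zero_right, Real.norm_eq_abs, abs_le] at hy
    exact ⟨by linarith, by linarith⟩
  set e : ℝ → ℂ := fun y => cexpW Φ (-h⁻¹) y * g y with he
  have hes : ContDiff ℝ ∞ e := (contDiff_cexpW hΦ _).mul hg
  have hsupp : Function.support e ⊆ Ioc (-R) R := fun y hy =>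
    hR (subset_tsupport _ fun h0 => hy (by simp [he, h0]))
  have hz : ∀ y, y ∉ Ioc (-R) R → e y = 0 := fun y hy => by
    by_contra hc; exact hy (hsupp hc)
  set F : ℝ → ℂ := fun s => ∫ t in (-R)..s, e t with hF
  have hFs : ContDiff ℝ ∞ F := contDiff_integral_Ioc hes _
  have hFd : ∀ s, HasDerivAt F (e s) s := fun s =>
    intervalIntegral.integral_hasDerivAt_right (hes.continuous.intervalIntegrable _ _)
      hes.continuous.stronglyMeasurable.stronglyMeasurableAtFilter hes.continuous.continuousAt
  have hF0 : ∀ s, s ∉ Icc (-R) R → F s = 0 := by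
    intro s hs
    rcases lt_or_ge s (-R) with h1 | h1
    · rw [hF]
      refine intervalIntegral.integral_zero_ae (.of_forall fun y hy => ?_)
      rw [uIoc_of_ge h1.le] at hy
      exact hz y fun hy' => absurd hy'.1 (not_lt.2 hy.2)
    · have h2 : R < s := by by_contra hc; exact hs ⟨h1, not_lt.1 hc⟩
      simp only [hF]
      rw [intervalIntegral.integral_eq_integral_of_support_subset, hg0]
      exact hsupp.trans (Ioc_subset_Ioc_right h2.le)
  refine ⟨fun y => -(h : ℂ)⁻¹ * cexpW Φ h⁻¹ y * F y,
    fun y => -(h : ℂ)⁻¹ * (((h⁻¹ * w y : ℝ) * cexpW Φ h⁻¹ y) * F y + cexpW Φ h⁻¹ y * e y),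
    ⟨HasCompactSupport.intro isCompact_Icc fun y hy => by rw [hF0 y hy, mul_zero],
      ((contDiff_const.mul (contDiff_cexpW hΦ _)).mul hFs), fun y => ?_⟩, fun y => ?_⟩
  · have := (((hasDerivAt_cexpW (hw y) h⁻¹).mul (hFd y)).const_mul (-(h : ℂ)⁻¹))
    refine (this.congr_of_eventuallyEq (.of_forall fun z => ?_))
    simp [mul_assoc]
  · have := cexpW_mul_neg Φ h⁻¹ y
    have e1 : cexpW Φ h⁻¹ y * e y = g y := by rw [he]; simp only; rw [← mul_assoc, this, one_mul]
    simp only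
    rw [e1]; push_cast; field_simp; ring

/-- The argument of du Bois-Reymond: subtracting from a test function `G` a multiple of a fixed `ψ₀`
with `∫ exp (-Φ/h) ψ₀ = 1` puts it in the range of the transposed operator, which `z` annihilates.
The constant is then `∫ z ψ₀`. -/
theorem ae_eq_of_weak_zero {Φ w : ℝ → ℝ} (hΦ : ContDiff ℝ ∞ Φ)
    (hw : ∀ y, HasDerivAt Φ (w y) y) {h : ℝ} (hh : h ≠ 0) {z : ℝ → ℂ}
    (hz : LocallyIntegrable z volume)
    (hz0 : ∀ χ χ' : ℝ → ℂ, IsTest id χ χ' →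
      ∫ y, z y * (-(h : ℂ) * χ' y + (w y : ℂ) * χ y) = 0) :
    ∃ c : ℂ, z =ᵐ[volume] fun y => c * cexpW Φ (-h⁻¹) y := by
  set E := cexpW Φ (-h⁻¹) with hE
  have hEs : ContDiff ℝ ∞ E := contDiff_cexpW hΦ _
  set β : ContDiffBump (0 : ℝ) := ⟨1, 2, one_pos, one_lt_two⟩
  set ψ₀ : ℝ → ℂ := fun y => cexpW Φ h⁻¹ y * (β.normed volume y : ℂ) with hψ₀
  have hψs : ContDiff ℝ ∞ ψ₀ :=
    (contDiff_cexpW hΦ _).mul (Complex.ofRealCLM.contDiff.comp (β.contDiff_normed (n := ⊤)))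
  have hψc : HasCompactSupport ψ₀ := by
    refine HasCompactSupport.mul_left ?_
    exact (β.hasCompactSupport_normed (μ := volume)).comp_left (g := ((↑) : ℝ → ℂ)) rfl
  have hψ1 : ∫ y, E y * ψ₀ y = 1 := by
    have : ∀ y, E y * ψ₀ y = (β.normed volume y : ℂ) := fun y => by
      rw [hψ₀, hE]; simp only
      rw [← mul_assoc, mul_comm (cexpW Φ (-h⁻¹) y), cexpW_mul_neg, one_mul]
    simp_rw [this]
    rw [integral_complex_ofReal, β.integral_normed]; rfl
  have hint : ∀ {f g : ℝ → ℂ}, LocallyIntegrable f volume → Continuous g → HasCompactSupport g →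
      Integrable fun y => f y * g y := fun {f g} hf hg hc => by
    have := hf.integrable_smul_left_of_hasCompactSupport hg hc
    refine this.congr (.of_forall fun y => ?_)
    simp [mul_comm]
  have hEl : LocallyIntegrable E volume := hEs.continuous.locallyIntegrable
  refine ⟨∫ y, z y * ψ₀ y, ?_⟩
  refine ae_eq_of_integral_contDiff_smul_eq hz
    ((contDiff_const.mul hEs).continuous.locallyIntegrable) fun g hg hgc => ?_
  set G : ℝ → ℂ := fun y => (g y : ℂ) with hG
  have hGs : ContDiff ℝ ∞ G := Complex.ofRealCLM.contDiff.comp hg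
  have hGc : HasCompactSupport G := hgc.comp_left (g := ((↑) : ℝ → ℂ)) rfl
  set a := ∫ y, E y * G y with ha
  have i1 := hint hEl hGs.continuous hGc
  have i2 := hint hEl hψs.continuous hψc
  have i3 := hint hz hGs.continuous hGc
  have i4 := hint hz hψs.continuous hψc
  have h0 : ∫ y, E y * (G y - a * ψ₀ y) = 0 := by
    have : ∀ y, E y * (G y - a * ψ₀ y) = E y * G y - a * (E y * ψ₀ y) := fun y => by ring
    simp_rw [this]
    rw [integral_sub i1 (i2.const_mul _), integral_const_mul, hψ1, ← ha]; ring
  have hc : HasCompactSupport fun y => G y - a * ψ₀ y :=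
    hGc.sub (HasCompactSupport.mul_left hψc)
  obtain ⟨χ, χ', hχ, heq⟩ := exists_isTest_of_integral_eq_zero hΦ hw hh
    (hGs.sub (contDiff_const.mul hψs)) hc h0
  have h1 := hz0 χ χ' hχ
  simp_rw [heq] at h1
  have h2 : ∫ y, z y * (G y - a * ψ₀ y) = (∫ y, z y * G y) - a * ∫ y, z y * ψ₀ y := by
    have : ∀ y, z y * (G y - a * ψ₀ y) = z y * G y - a * (z y * ψ₀ y) := fun y => by ring
    simp_rw [this]
    rw [integral_sub i3 (i4.const_mul _), integral_const_mul]
  rw [h2, sub_eq_zero] at h1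
  calc ∫ y, g y • z y = ∫ y, z y * G y := by
        congr 1; ext y; simp [hG, mul_comm]
    _ = _ := h1
    _ = (∫ y, z y * ψ₀ y) * ∫ y, E y * G y := by rw [mul_comm]
    _ = _ := by
        rw [← integral_const_mul]
        congr 1; ext y; simp [hG]; ring

end Antideriv

/-! ## The graph on the line -/

theorem drift_linePhi (ξ y : ℝ) : drift linePhi ξ y = ξ + y ^ 2 := by
  have : HasDerivAt linePhi (y ^ 2) y := by
    unfold linePhi
    refine ((hasDerivAt_pow 3 y).div_const 3).congr_deriv ?_
    norm_num
  rw [drift, this.deriv]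

theorem contDiff_lineWeight (x : ℝ) : ContDiff ℝ ∞ (lineWeight x) := by
  unfold lineWeight; fun_prop

theorem hasDerivAt_lineWeight (x y : ℝ) :
    HasDerivAt (lineWeight x) (drift linePhi (-x ^ 2) y) y := by
  rw [drift_linePhi]
  unfold lineWeight
  refine (((hasDerivAt_pow 3 y).div_const 3).sub ((hasDerivAt_id y).const_mul (x ^ 2))).congr_deriv ?_
  norm_num; ring

/-- The difference of the two sides is `5 (y - s) (y + s)² / 24`. The cubic term is kept in order to
absorb linear losses in `y - s`. -/
theorem lineWeight_sub_ge (x : ℝ) {y s : ℝ} (hs : s < y) :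
    (y - s) * (y ^ 2 + s ^ 2) / 12 + (y - s) ^ 3 / 24 - x ^ 2 * (y - s) ≤
      lineWeight x y - lineWeight x s := by
  have e : lineWeight x y - lineWeight x s - ((y - s) * (y ^ 2 + s ^ 2) / 12 + (y - s) ^ 3 / 24
      - x ^ 2 * (y - s)) = (y - s) * (5 * (y + s) ^ 2 / 24) := by
    unfold lineWeight; ring
  have : 0 ≤ (y - s) * (5 * (y + s) ^ 2 / 24) := mul_nonneg (by linarith) (by positivity)
  linarith

theorem mul_sub_cube_le {A r : ℝ} (hA : 0 ≤ A) (hr : 0 ≤ r) :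
    A * r - r ^ 3 / 24 ≤ A * (24 * A + 1) := by
  rcases le_or_gt r (24 * A + 1) with h | h
  · have := mul_le_mul_of_nonneg_left h hA
    have : 0 ≤ r ^ 3 := by positivity
    linarith
  · have h1 : 24 * A ≤ r ^ 2 := by nlinarith
    have h2 : 0 ≤ r * (r ^ 2 - 24 * A) := mul_nonneg hr (by linarith)
    have h3 : 0 ≤ A * (24 * A + 1) := by positivity
    nlinarith

/-- The weight of the domain must be compensated by decay at rate `1 + y²`, or `1 + s²`, in `y - s`;
the two bounds serve the row and column integrals of the Schur test. Passing from `1 + y²` to `1 +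
s²` costs `1 + (y - s)²`, hence a factor `exp (2 (y - s))`, which is the term `2 h` in `A`. -/
theorem weighted_lineKernel_le (x : ℝ) {h : ℝ} (hh : 0 < h) : ∃ C : ℝ, 0 ≤ C ∧ ∀ y s, s < y →
    (1 + y ^ 2) * lineKernel x h y s ≤
      C * ((1 + y ^ 2) * Real.exp (-((1 + y ^ 2) / (12 * h) * (y - s)))) ∧
    (1 + y ^ 2) * lineKernel x h y s ≤
      C * ((1 + s ^ 2) * Real.exp (-((1 + s ^ 2) / (12 * h) * (y - s)))) := by
  set A := x ^ 2 + 1 / 12 + 2 * h with hA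
  have hA0 : 0 ≤ A := by positivity
  refine ⟨2 * Real.exp (A * (24 * A + 1) / h), by positivity, fun y s hs => ?_⟩
  have hr : 0 < y - s := by linarith
  have h1 := lineWeight_sub_ge x hs
  have h2 := mul_sub_cube_le hA0 hr.le
  have h3 : (y - s) * s ^ 2 ≥ 0 := by positivity
  have h3' : (y - s) * y ^ 2 ≥ 0 := by positivity
  rw [lineKernel, if_pos hs]
  have key : ∀ t : ℝ, (y - s) * t ^ 2 ≤ (y - s) * (y ^ 2 + s ^ 2) →
      Real.exp ((lineWeight x s - lineWeight x y) / h) * Real.exp (2 * (y - s)) ≤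
      Real.exp (A * (24 * A + 1) / h) * Real.exp (-((1 + t ^ 2) / (12 * h) * (y - s))) := by
    intro t ht
    rw [← Real.exp_add, ← Real.exp_add]
    apply Real.exp_le_exp.2
    have e1 : (lineWeight x s - lineWeight x y) / h + 2 * (y - s) =
        (lineWeight x s - lineWeight x y + 2 * h * (y - s)) / h := by field_simp
    have e2 : A * (24 * A + 1) / h + -((1 + t ^ 2) / (12 * h) * (y - s)) =
        (A * (24 * A + 1) - (1 + t ^ 2) / 12 * (y - s)) / h := by
      field_simp; ring
    rw [e1, e2]
    apply div_le_div_of_nonneg_right _ hh.le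
    have : A * (y - s) = x ^ 2 * (y - s) + 1 / 12 * (y - s) + 2 * h * (y - s) := by rw [hA]; ring
    nlinarith
  have hexp : (1 + (y - s) ^ 2) ≤ Real.exp (2 * (y - s)) := by
    have := Real.add_one_le_exp (y - s)
    have e : Real.exp (2 * (y - s)) = Real.exp (y - s) ^ 2 := by
      rw [← Real.exp_nat_mul]; norm_num
    rw [e]; nlinarith
  have hK : 0 < Real.exp ((lineWeight x s - lineWeight x y) / h) := Real.exp_pos _
  constructor
  · have k1 := key y (by nlinarith)
    have h4 : 1 ≤ Real.exp (2 * (y - s)) := Real.one_le_exp (by linarith)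
    calc _ ≤ (1 + y ^ 2) * (Real.exp (A * (24 * A + 1) / h) *
          Real.exp (-((1 + y ^ 2) / (12 * h) * (y - s)))) := by
          refine mul_le_mul_of_nonneg_left (le_trans ?_ k1) (by positivity)
          exact le_mul_of_one_le_right hK.le h4
      _ ≤ 2 * ((1 + y ^ 2) * (Real.exp (A * (24 * A + 1) / h) *
          Real.exp (-((1 + y ^ 2) / (12 * h) * (y - s))))) := by
          have : 0 ≤ (1 + y ^ 2) * (Real.exp (A * (24 * A + 1) / h) *
            Real.exp (-((1 + y ^ 2) / (12 * h) * (y - s)))) := by positivity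
          linarith
      _ = _ := by ring
  · have k1 := key s (by nlinarith)
    have h4 : 1 + y ^ 2 ≤ 2 * (1 + s ^ 2) * Real.exp (2 * (y - s)) := by
      calc 1 + y ^ 2 ≤ 2 * (1 + s ^ 2) * (1 + (y - s) ^ 2) := by
            nlinarith [sq_nonneg (y - 2 * s), sq_nonneg (s * (y - s))]
        _ ≤ _ := by gcongr
    calc _ ≤ 2 * (1 + s ^ 2) * Real.exp (2 * (y - s)) *
          Real.exp ((lineWeight x s - lineWeight x y) / h) := by gcongr
      _ = 2 * (1 + s ^ 2) * (Real.exp ((lineWeight x s - lineWeight x y) / h) *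
          Real.exp (2 * (y - s))) := by ring
      _ ≤ _ := mul_le_mul_of_nonneg_left k1 (by positivity)
      _ = _ := by ring

theorem sqrt_one_add_pow_four_le (y : ℝ) : Real.sqrt (1 + y ^ 4) ≤ 1 + y ^ 2 := by
  rw [Real.sqrt_le_iff]
  constructor
  · positivity
  · nlinarith [sq_nonneg y]

theorem memLp_weight_kernelFun {x h : ℝ} (hx : 0 < x) (hh : 0 < h) (v : L2 ℝ) :
    MemLp (fun y => ((Real.sqrt (1 + y ^ 4) : ℝ) : ℂ) * kernelFun (lineKernel x h) v y) 2 volume := by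
  obtain ⟨C, hC, hle⟩ := weighted_lineKernel_le x hh
  set κ : ℝ → ℝ → ENNReal := fun y s => ENNReal.ofReal ((1 + y ^ 2) * lineKernel x h y s) with hκ
  have hκm : Measurable (Function.uncurry κ) := by
    have h1 : Measurable fun p : ℝ × ℝ => 1 + p.1 ^ 2 := by fun_prop
    exact (h1.mul (measurable_lineKernel x h)).ennreal_ofReal
  have hconst : ∀ t : ℝ, ENNReal.ofReal (C * (1 + t ^ 2)) *
      ENNReal.ofReal (1 / ((1 + t ^ 2) / (12 * h))) = ENNReal.ofReal (C * (12 * h)) := fun t => by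
    rw [← ENNReal.ofReal_mul (by positivity)]
    congr 1; field_simp
  have h1 : ∀ y, ∫⁻ s, κ y s ≤ ENNReal.ofReal (C * (12 * h)) := by
    intro y
    have hb : 0 < (1 + y ^ 2) / (12 * h) := by positivity
    calc ∫⁻ s, κ y s ≤ ∫⁻ s, (Iio y).indicator (fun s => ENNReal.ofReal (C * (1 + y ^ 2)) *
          ENNReal.ofReal (Real.exp (-((1 + y ^ 2) / (12 * h) * (y - s))))) s := by
          refine lintegral_mono fun s => ?_
          by_cases hs : s < y
          · rw [indicator_of_mem (show s ∈ Iio y from hs), ← ENNReal.ofReal_mul (by positivity)]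
            refine ENNReal.ofReal_le_ofReal ((hle y s hs).1.trans_eq (by ring))
          · simp [hκ, lineKernel, hs]
      _ = ENNReal.ofReal (C * (1 + y ^ 2)) * ∫⁻ s in Iio y,
          ENNReal.ofReal (Real.exp (-((1 + y ^ 2) / (12 * h) * (y - s)))) := by
          rw [lintegral_indicator measurableSet_Iio, lintegral_const_mul _ (by fun_prop)]
      _ ≤ _ := by
          rw [← hconst y]
          gcongr
          exact lintegral_exp_neg_le hb _ Iio_subset_Iic_self
  have h2 : ∀ s, ∫⁻ y, κ y s ≤ ENNReal.ofReal (C * (12 * h)) := by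
    intro s
    have hb : 0 < (1 + s ^ 2) / (12 * h) := by positivity
    rw [← lintegral_neg_eq_self]
    calc ∫⁻ y, κ (-y) s ≤ ∫⁻ y, (Iio (-s)).indicator (fun y => ENNReal.ofReal (C * (1 + s ^ 2)) *
          ENNReal.ofReal (Real.exp (-((1 + s ^ 2) / (12 * h) * (-s - y))))) y := by
          refine lintegral_mono fun y => ?_
          by_cases hs : s < -y
          · rw [indicator_of_mem (show y ∈ Iio (-s) by rw [mem_Iio]; linarith),
              ← ENNReal.ofReal_mul (by positivity)]
            refine ENNReal.ofReal_le_ofReal ((hle (-y) s hs).2.trans_eq ?_)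
            rw [show -y - s = -s - y by ring]; ring
          · simp [hκ, lineKernel, hs]
      _ = ENNReal.ofReal (C * (1 + s ^ 2)) * ∫⁻ y in Iio (-s),
          ENNReal.ofReal (Real.exp (-((1 + s ^ 2) / (12 * h) * (-s - y)))) := by
          rw [lintegral_indicator measurableSet_Iio, lintegral_const_mul _ (by fun_prop)]
      _ ≤ _ := by
          rw [← hconst s]
          gcongr
          exact lintegral_exp_neg_le hb _ Iio_subset_Iic_self
  have hk := hsKernel_lineKernel hx hh
  refine memLp_two_of_lintegral_lt_top ?_ ?_
  · exact (by fun_prop : Continuous fun y : ℝ => ((Real.sqrt (1 + y ^ 4) : ℝ) : ℂ)).aestronglyMeasurable.mul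
      (hk.aestronglyMeasurable_kernelFun (Lp.memLp v).1)
  · have hv : AEMeasurable (fun s => ‖v s‖ₑ) volume := (Lp.memLp v).1.enorm
    refine lt_of_le_of_lt ?_ (ENNReal.mul_lt_top (ENNReal.mul_lt_top (ENNReal.ofReal_lt_top (r := C * (12 * h)))
      (ENNReal.ofReal_lt_top (r := C * (12 * h)))) (lintegral_enorm_sq_lt_top (Lp.memLp v)))
    refine le_trans ?_ (schur_lintegral_le hκm h1 h2 hv)
    refine lintegral_mono fun y => pow_le_pow_left' ?_ 2
    rw [enorm_mul, kernelFun]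
    calc _ ≤ ENNReal.ofReal (1 + y ^ 2) * ∫⁻ s, ‖((lineKernel x h y s : ℝ) : ℂ) * v s‖ₑ := by
          gcongr
          · rw [← ofReal_norm, Complex.norm_real, Real.norm_of_nonneg (Real.sqrt_nonneg _)]
            exact ENNReal.ofReal_le_ofReal (sqrt_one_add_pow_four_le y)
          · exact enorm_integral_le_lintegral_enorm _
      _ = ∫⁻ s, ENNReal.ofReal (1 + y ^ 2) * ‖((lineKernel x h y s : ℝ) : ℂ) * v s‖ₑ := by
          rw [lintegral_const_mul' _ _ ENNReal.ofReal_ne_top]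
      _ = _ := by
          refine lintegral_congr fun s => ?_
          rw [hκ]
          simp only
          rw [enorm_mul, ENNReal.ofReal_mul (by positivity), mul_assoc]
          congr 2
          rw [← ofReal_norm, Complex.norm_real, Real.norm_of_nonneg (lineKernel_nonneg ..)]

/-- For fixed `s` the kernel is a fundamental solution: against the transposed operator, the
integral over `y > s` is that of the derivative of `-h exp (-Φ/h) χ`, times `exp (Φ(s)/h)`. -/
theorem integral_lineKernel_mul {x h : ℝ} (hh : 0 < h) {χ χ' : ℝ → ℂ} (H : IsTest id χ χ') (s : ℝ) :
    ∫ y, (lineKernel x h y s : ℂ) * (-(h : ℂ) * χ' y + (drift linePhi (-x ^ 2) y : ℂ) * χ y) =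
      h * χ s := by
  have hhc : (h : ℂ) ≠ 0 := by exact_mod_cast hh.ne'
  have hΦ := contDiff_lineWeight x
  set F : ℝ → ℂ := fun y => -(h : ℂ) * (cexpW (lineWeight x) (-h⁻¹) y * χ y) with hF
  have hFs : ContDiff ℝ ∞ F := contDiff_const.mul ((contDiff_cexpW hΦ _).mul H.smooth)
  have hFc : HasCompactSupport F := HasCompactSupport.mul_left (HasCompactSupport.mul_left H.supp)
  have hFd : ∀ y, deriv F y = cexpW (lineWeight x) (-h⁻¹) y *
      (-(h : ℂ) * χ' y + (drift linePhi (-x ^ 2) y : ℂ) * χ y) := fun y => by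
    have := ((hasDerivAt_cexpW (hasDerivAt_lineWeight x y) (-h⁻¹)).mul (H.deriv y)).const_mul (-(h : ℂ))
    rw [show F = fun y => -(h : ℂ) * ((cexpW (lineWeight x) (-h⁻¹) * χ ∘ id) y) from rfl, this.deriv]
    simp only [id, Function.comp]
    push_cast; field_simp; ring
  have hi := HasCompactSupport.integral_Ioi_deriv_eq (hFs.of_le (by simp)) hFc s
  have e : ∀ y, (lineKernel x h y s : ℂ) *
      (-(h : ℂ) * χ' y + (drift linePhi (-x ^ 2) y : ℂ) * χ y) =
      cexpW (lineWeight x) h⁻¹ s * (Ioi s).indicator (deriv F) y := fun y => by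
    by_cases hs : s < y
    · rw [indicator_of_mem (show y ∈ Ioi s from hs), hFd, lineKernel, if_pos hs, ← mul_assoc]
      congr 1
      unfold cexpW
      rw [← Complex.ofReal_mul, ← Real.exp_add]
      congr 2; ring
    · rw [indicator_of_notMem (show y ∉ Ioi s from hs), lineKernel, if_neg hs]; simp
  simp_rw [e]
  rw [integral_const_mul, integral_indicator measurableSet_Ioi, hi, hF]
  simp only
  have := cexpW_mul_neg (lineWeight x) h⁻¹ s
  linear_combination (h : ℂ) * χ s * this

/-- The cubic tends to `-∞` on the left, so the homogeneous solution is at least `1` on a half line.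
This excludes any kernel of the operator on the line. -/
theorem not_memLp_cexpW {x h : ℝ} (hh : 0 < h) :
    ¬ MemLp (cexpW (lineWeight x) (-h⁻¹)) 2 volume := by
  intro hm
  have h1 := lintegral_enorm_sq_lt_top hm
  have h2 : ∫⁻ y in Iic (-(2 * |x|)), (1 : ENNReal) ≤
      ∫⁻ y, ‖cexpW (lineWeight x) (-h⁻¹) y‖ₑ ^ 2 := by
    refine le_trans ?_ (setLIntegral_le_lintegral (Iic (-(2 * |x|))) _)
    refine setLIntegral_mono' measurableSet_Iic fun y hy => ?_
    refine one_le_pow₀ ?_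
    rw [← ofReal_norm, cexpW, Complex.norm_real, Real.norm_of_nonneg (Real.exp_pos _).le,
      ENNReal.one_le_ofReal]
    refine Real.one_le_exp ?_
    have hy' : y ≤ -(2 * |x|) := hy
    have h3 : lineWeight x y ≤ 0 := by
      have hy0 : y ≤ 0 := by have := abs_nonneg x; linarith
      have hx2 : 3 * x ^ 2 ≤ y ^ 2 := by
        rw [← sq_abs x]; nlinarith [abs_nonneg x]
      unfold lineWeight
      nlinarith [mul_nonneg (neg_nonneg.2 hy0) (sub_nonneg.2 hx2)]
    have : 0 < h⁻¹ := by positivity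
    nlinarith
  rw [setLIntegral_const, Real.volume_Iic, one_mul] at h2
  exact absurd (lt_of_le_of_lt h2 h1) (by simp)

/-- The Schur test puts the image of the kernel in the weighted domain and Fubini gives the weak
equation. Conversely, two solutions differ by a square integrable multiple of `exp (-Φ/h)`, which is
zero. -/
theorem lineP_iff {x h : ℝ} (hx : 0 < x) (hh : 0 < h) (u v : L2 ℝ) :
    lineP h (-x ^ 2) u v ↔ u = ((h : ℂ)⁻¹ • (hsKernel_lineKernel hx hh).op) v := by
  have hhc : (h : ℂ) ≠ 0 := by exact_mod_cast hh.ne'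
  have hc : Topology.IsQuotientMap (id : ℝ → ℝ) := Topology.IsQuotientMap.id
  have hwc : Continuous (drift linePhi (-x ^ 2)) := by
    have : drift linePhi (-x ^ 2) = fun y => -x ^ 2 + y ^ 2 := funext (drift_linePhi _)
    rw [this]; fun_prop
  have hwρ : ∀ y, |drift linePhi (-x ^ 2) y| ≤ (x ^ 2 + 1) * |Real.sqrt (1 + y ^ 4)| := fun y => by
    rw [drift_linePhi, abs_of_nonneg (Real.sqrt_nonneg _)]
    have h1 : 1 ≤ Real.sqrt (1 + y ^ 4) := Real.one_le_sqrt.2 (by nlinarith [sq_nonneg (y ^ 2)])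
    have h2 : y ^ 2 ≤ Real.sqrt (1 + y ^ 4) := Real.le_sqrt_of_sq_le (by nlinarith)
    have h3 : x ^ 2 * 1 ≤ x ^ 2 * Real.sqrt (1 + y ^ 4) := by gcongr
    rw [abs_le]; constructor <;> nlinarith [sq_nonneg x, sq_nonneg y]
  have hk := hsKernel_lineKernel hx hh
  set K : L2 ℝ →L[ℂ] L2 ℝ := (h : ℂ)⁻¹ • (hsKernel_lineKernel hx hh).op with hK
  have hKv : ∀ v, K v =ᵐ[volume] fun y => (h : ℂ)⁻¹ * kernelFun (lineKernel x h) v y := fun v => by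
    have e : K v = (h : ℂ)⁻¹ • (hsKernel_lineKernel hx hh).op v := rfl
    rw [e]
    filter_upwards [Lp.coeFn_smul ((h : ℂ)⁻¹) ((hsKernel_lineKernel hx hh).op v), hk.coeFn_op v] with y h1 h2
    rw [h1, Pi.smul_apply, h2, smul_eq_mul]
  have htest : ∀ {χ χ' : ℝ → ℂ}, IsTest id χ χ' →
      MemLp (fun y => -(h : ℂ) * χ' y + (drift linePhi (-x ^ 2) y : ℂ) * χ y) 2 volume := fun {χ χ'} H => by
    have h1 := H.continuous hc
    have h2 := H.continuous_deriv hc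
    have h3 := Complex.continuous_ofReal.comp hwc
    exact ((continuous_const.mul h2).add (h3.mul h1)).memLp_of_hasCompactSupport
      ((HasCompactSupport.mul_left (H.supp_deriv hc)).add (HasCompactSupport.mul_left H.supp))
  have hfwd : ∀ v : L2 ℝ, lineP h (-x ^ 2) (K v) v := fun v => by
    unfold lineP
    rw [opGraph_iff_weak hc hwc hwρ hh.ne']
    constructor
    · refine ((memLp_weight_kernelFun hx hh v).const_mul (h : ℂ)⁻¹).ae_eq ?_
      filter_upwards [hKv v] with y hy
      rw [hy]; ring
    · intro χ χ' H
      have e1 : ∫ y, K v y * (-(h : ℂ) * χ' y + (drift linePhi (-x ^ 2) y : ℂ) * χ y) =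
          (h : ℂ)⁻¹ * ∫ y, (hsKernel_lineKernel hx hh).op v y *
            (-(h : ℂ) * χ' y + (drift linePhi (-x ^ 2) y : ℂ) * χ y) := by
        rw [← integral_const_mul]
        refine integral_congr_ae ?_
        filter_upwards [hKv v, hk.coeFn_op v] with y h1 h2
        rw [h1, h2]; ring
      rw [e1, HSKernel.integral_op_mul _ v (htest H)]
      simp_rw [integral_lineKernel_mul hh H]
      rw [← integral_const_mul]
      congr 1; ext y; field_simp
  constructor
  · intro hu
    have hKv' := hfwd v
    unfold lineP at hu hKv'
    rw [opGraph_iff_weak hc hwc hwρ hh.ne'] at hu hKv'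
    have hsub : (u - K v : L2 ℝ) =ᵐ[volume] fun y => u y - K v y := Lp.coeFn_sub _ _
    have hz0 : ∀ χ χ' : ℝ → ℂ, IsTest id χ χ' → ∫ y, (u - K v : L2 ℝ) y *
        (-(h : ℂ) * χ' y + (drift linePhi (-x ^ 2) y : ℂ) * χ y) = 0 := fun χ χ' H => by
      have i1 : Integrable fun y => u y * (-(h : ℂ) * χ' y + (drift linePhi (-x ^ 2) y : ℂ) * χ y) :=
        (Lp.memLp u).integrable_mul (htest H)
      have i2 : Integrable fun y => K v y * (-(h : ℂ) * χ' y + (drift linePhi (-x ^ 2) y : ℂ) * χ y) :=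
        (Lp.memLp (K v)).integrable_mul (htest H)
      rw [← sub_eq_zero.2 ((hu.2 χ χ' H).trans (hKv'.2 χ χ' H).symm), ← integral_sub i1 i2]
      refine integral_congr_ae ?_
      filter_upwards [hsub] with y hy
      rw [hy, sub_mul]
    obtain ⟨c, hcz⟩ := ae_eq_of_weak_zero (contDiff_lineWeight x) (hasDerivAt_lineWeight x) hh.ne'
      ((Lp.memLp (u - K v)).locallyIntegrable (by norm_num)) hz0
    have hc0 : c = 0 := by
      by_contra hne
      refine not_memLp_cexpW (x := x) hh ?_
      have := ((Lp.memLp (u - K v)).ae_eq hcz).const_mul c⁻¹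
      refine this.ae_eq (.of_forall fun y => ?_)
      field_simp
    rw [← sub_eq_zero]
    refine Lp.ext ?_
    filter_upwards [hcz, Lp.coeFn_zero ℂ 2 (volume : Measure ℝ)] with y h1 h2
    rw [h1, h2, hc0]; simp
  · rintro rfl
    exact hfwd v

/-- The smallest singular value on the line. -/
theorem exists_singularValue_line {x h : ℝ} (hx : 0 < x) (hh : 0 < h) :
    ∃ κ : ℝ, IsReducedNorm 128 0 (Real.sqrt (h / (2 * x ^ 3))) κ ∧
      ∀ m : ℝ, m = Real.sqrt h * (Real.sqrt 2 * Real.sqrt x / κ) * Real.exp (-(4 * x ^ 3 / 3 / h)) →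
      IsLeast (singularValues (lineP h (-x ^ 2))) |m| ∧
        ∃ ePlus eMinus, IsSingularTriple (lineP h (-x ^ 2)) m ePlus eMinus := by
  have h1 := lineMass_le_norm hx hh
  have h2 := lineMass_pos hx hh
  have hred := isReducedNorm_line hx hh
  refine ⟨_, hred, fun m hm => ?_⟩
  set N := ‖(hsKernel_lineKernel hx hh).op‖ with hN
  have hN0 : 0 < N := h2.trans_le h1
  have hKn : ‖(h : ℂ)⁻¹ • (hsKernel_lineKernel hx hh).op‖ = h⁻¹ * N := by
    rw [norm_smul, norm_inv, Complex.norm_real, Real.norm_of_nonneg hh.le]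
  refine isLeast_singularValues (K := (h : ℂ)⁻¹ • (hsKernel_lineKernel hx hh).op) ?_ ?_
    (lineP_iff hx hh) ?_
  · exact (hsKernel_lineKernel hx hh).isCompactOperator.smul ((h : ℂ)⁻¹)
  · rw [← norm_pos_iff, hKn]; positivity
  · rw [hKn, hm, abs_of_nonneg (by positivity)]
    -- This identity turns `h` divided by the norm of the kernel operator into `√h (√(2x) / κ) exp
    -- (-S₀/h)`.
    have e3 : Real.sqrt (h / (2 * x ^ 3)) * x * (Real.sqrt 2 * Real.sqrt x) = Real.sqrt h := by
      have : x = Real.sqrt x ^ 2 := (Real.sq_sqrt hx.le).symm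
      have hsx : 0 < Real.sqrt x := by positivity
      rw [Real.sqrt_div hh.le, Real.sqrt_mul (by norm_num), show x ^ 3 = x ^ 2 * x by ring,
        Real.sqrt_mul (by positivity), Real.sqrt_sq hx.le]
      field_simp
    have e4 : Real.sqrt h * Real.sqrt h = h := Real.mul_self_sqrt hh.le
    rw [Real.exp_neg]
    have := Real.exp_pos (4 * x ^ 3 / 3 / h)
    have hε : 0 < Real.sqrt (h / (2 * x ^ 3)) := by positivity
    set s := Real.sqrt (h / (2 * x ^ 3))
    field_simp
    calc _ = Real.sqrt h * (s * x * (Real.sqrt 2 * Real.sqrt x)) := by ring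
      _ = h := by rw [e3, e4]

/-! ## The graph on the circle -/

/-- The representative in `]α, α + 2π]`. -/
noncomputable def circLift (α : ℝ) (y : Circ) : ℝ := AddCircle.equivIoc (2 * Real.pi) α y

theorem circLift_mem (α : ℝ) (y : Circ) : circLift α y ∈ Ioc α (α + 2 * Real.pi) :=
  (AddCircle.equivIoc (2 * Real.pi) α y).2

theorem circCover_circLift (α : ℝ) (y : Circ) : circCover (circLift α y) = y :=
  AddCircle.coe_equivIoc

theorem circLift_circCover {α y : ℝ} (hy : y ∈ Ioc α (α + 2 * Real.pi)) :
    circLift α (circCover y) = y := AddCircle.equivIoc_coe_of_mem hy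

theorem measurable_circLift (α : ℝ) : Measurable (circLift α) :=
  measurable_subtype_coe.comp (AddCircle.measurableEquivIoc (2 * Real.pi) α).measurable

theorem lintegral_circLift (α : ℝ) (F : ℝ → ENNReal) :
    ∫⁻ y, F (circLift α y) = ∫⁻ z in Ioc α (α + 2 * Real.pi), F z := by
  rw [← AddCircle.lintegral_preimage (2 * Real.pi) α]
  refine setLIntegral_congr_fun measurableSet_Ioc fun z hz => ?_
  exact congrArg F (circLift_circCover hz)

theorem integral_circLift {E : Type} [NormedAddCommGroup E] [NormedSpace ℝ E] (α : ℝ) (F : ℝ → E) :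
    ∫ y, F (circLift α y) = ∫ z in Ioc α (α + 2 * Real.pi), F z := by
  rw [← AddCircle.integral_preimage (2 * Real.pi) α]
  refine setIntegral_congr_fun measurableSet_Ioc fun z hz => ?_
  exact congrArg F (circLift_circCover hz)

theorem isQuotientMap_circCover : Topology.IsQuotientMap circCover :=
  QuotientAddGroup.isQuotientMap_mk _

theorem circCover_add (y : ℝ) : circCover (y + 2 * Real.pi) = circCover y :=
  AddCircle.coe_add_period _ _

/-- The characters are smooth, so all Fourier coefficients of `z` vanish. -/
theorem ae_zero_of_integral_smooth {z : Circ → ℂ} (hz : MemLp z 2 volume)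
    (h : ∀ f : Circ → ℂ, ContDiff ℝ ∞ (f ∘ circCover) → ∫ y, z y * f y = 0) :
    z =ᵐ[volume] 0 := by
  have h2π : ENNReal.ofReal (2 * Real.pi) ≠ 0 := by simpa using Real.pi_pos
  have hvol := AddCircle.volume_eq_smul_haarAddCircle (T := 2 * Real.pi)
  have hac : (AddCircle.haarAddCircle : Measure Circ) =
      (ENNReal.ofReal (2 * Real.pi))⁻¹ • (volume : Measure Circ) := by
    rw [hvol, smul_smul, ENNReal.inv_mul_cancel h2π ENNReal.ofReal_ne_top, one_smul]
  have hzh : MemLp z 2 (AddCircle.haarAddCircle : Measure Circ) := by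
    rw [hac]; exact hz.smul_measure (ENNReal.inv_ne_top.2 h2π)
  have hcoef : ∀ n, fourierCoeff (hzh.toLp z) n = 0 := fun n => by
    rw [fourierCoeff]
    have e : ∫ t, fourier (-n) t • (hzh.toLp z) t ∂AddCircle.haarAddCircle =
        ∫ t, fourier (-n) t • z t ∂AddCircle.haarAddCircle := by
      refine integral_congr_ae ?_
      filter_upwards [hzh.coeFn_toLp] with t ht
      rw [ht]
    rw [e, hac, integral_smul_measure]
    have : ∫ t, fourier (-n) t • z t = 0 := by
      rw [← h (fun t => fourier (-n) t) ?_]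
      · congr 1; ext t; rw [smul_eq_mul, mul_comm]
      · have : (fun t : Circ => fourier (-n) t) ∘ circCover = fun x : ℝ =>
            Complex.exp (2 * Real.pi * Complex.I * ((-n : ℤ) : ℂ) * (x : ℂ) / ((2 * Real.pi : ℝ) : ℂ)) := by
          funext x; exact fourier_coe_apply
        rw [this]
        exact ((contDiff_const.mul Complex.ofRealCLM.contDiff).div_const _).cexp
    rw [this, smul_zero]
  have hz0 : hzh.toLp z = 0 := by
    apply (fourierBasis (T := 2 * Real.pi)).repr.injective
    ext n
    rw [fourierBasis_repr, hcoef, map_zero]; rfl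
  have h1 : z =ᵐ[(AddCircle.haarAddCircle : Measure Circ)] 0 :=
    hzh.coeFn_toLp.symm.trans (by rw [hz0]; exact Lp.coeFn_zero _ _ _)
  rw [hvol]
  exact Measure.ae_smul_measure h1 _

/-- The primitive `ξ y + sin y` of `drift circPhi ξ`. -/
noncomputable def circPrim (ξ y : ℝ) : ℝ := ξ * y + Real.sin y

theorem drift_circPhi (ξ y : ℝ) : drift circPhi ξ y = ξ + Real.cos y := by
  have hs : circPhi = Real.sin := rfl
  simp [drift, hs]

theorem contDiff_circPrim (ξ : ℝ) : ContDiff ℝ ∞ (circPrim ξ) := by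
  unfold circPrim
  exact (contDiff_const.mul contDiff_id).add Real.contDiff_sin

theorem hasDerivAt_circPrim (ξ y : ℝ) : HasDerivAt (circPrim ξ) (drift circPhi ξ y) y := by
  rw [drift_circPhi]
  unfold circPrim
  refine (((hasDerivAt_id y).const_mul ξ).add (Real.hasDerivAt_sin y)).congr_deriv ?_
  simp

/-- The Floquet multiplier. -/
noncomputable def circMult (ξ h : ℝ) : ℝ := Real.exp (-(2 * Real.pi * ξ / h))

theorem cexpW_circPrim_add (ξ h y : ℝ) : cexpW (circPrim ξ) (-h⁻¹) (y + 2 * Real.pi) =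
    (circMult ξ h : ℂ) * cexpW (circPrim ξ) (-h⁻¹) y := by
  unfold cexpW circMult circPrim
  rw [← Complex.ofReal_mul, ← Real.exp_add, Real.sin_add_two_pi]
  congr 2; ring

/-- A multiple of the integral kernel of the inverse of `circP h ξ`, on `]α, α + 2π]`. -/
noncomputable def circKer (ξ h y s : ℝ) : ℝ :=
  Real.exp ((circPrim ξ s - circPrim ξ y) / h) * if s < y then 1 else circMult ξ h

/-- The same on the circle. -/
noncomputable def circKernel (α ξ h : ℝ) (y s : Circ) : ℝ := circKer ξ h (circLift α y) (circLift α s)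

theorem circMult_pos (ξ h : ℝ) : 0 < circMult ξ h := Real.exp_pos _

theorem measurable_circKer (ξ h : ℝ) : Measurable (Function.uncurry (circKer ξ h)) := by
  have := (contDiff_circPrim ξ).continuous
  unfold circKer Function.uncurry
  exact Measurable.mul (by fun_prop)
    (Measurable.ite (measurableSet_lt (by fun_prop) (by fun_prop)) (by fun_prop) (by fun_prop))

theorem measurable_circKernel (α ξ h : ℝ) : Measurable (Function.uncurry (circKernel α ξ h)) :=
  (measurable_circKer ξ h).comp (((measurable_circLift α).comp measurable_fst).prodMk
    ((measurable_circLift α).comp measurable_snd))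

/-- `∂_y φ + ξ` on the circle. -/
noncomputable def circDrift (ξ : ℝ) : Circ → ℝ := (circDrift_periodic ξ).lift

theorem circDrift_circCover (ξ y : ℝ) : circDrift ξ (circCover y) = drift circPhi ξ y := rfl

theorem continuous_circDrift (ξ : ℝ) : Continuous (circDrift ξ) := by
  rw [isQuotientMap_circCover.continuous_iff]
  have : circDrift ξ ∘ circCover = fun y => ξ + Real.cos y := funext (drift_circPhi ξ)
  rw [this]; fun_prop

theorem hasDerivAt_cexpW_mul_test {ξ h : ℝ} (hh : h ≠ 0) {χ χ' : Circ → ℂ} (H : IsTest circCover χ χ')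
    (y : ℝ) : HasDerivAt (fun y => -(h : ℂ) * (cexpW (circPrim ξ) (-h⁻¹) y * χ (circCover y)))
      (cexpW (circPrim ξ) (-h⁻¹) y * (-(h : ℂ) * χ' (circCover y) +
        (circDrift ξ (circCover y) : ℂ) * χ (circCover y))) y := by
  have hhc : (h : ℂ) ≠ 0 := by exact_mod_cast hh
  have := ((hasDerivAt_cexpW (hasDerivAt_circPrim ξ y) (-h⁻¹)).mul (H.deriv y)).const_mul (-(h : ℂ))
  refine this.congr_deriv ?_
  rw [circDrift_circCover]
  simp only [Function.comp]
  push_cast; field_simp; ring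

theorem continuous_testImage {ξ h : ℝ} {χ χ' : Circ → ℂ} (H : IsTest circCover χ χ') :
    Continuous fun y => -(h : ℂ) * χ' y + (circDrift ξ y : ℂ) * χ y :=
  (continuous_const.mul (H.continuous_deriv isQuotientMap_circCover)).add
    ((Complex.continuous_ofReal.comp (continuous_circDrift ξ)).mul (H.continuous isQuotientMap_circCover))

theorem memLp_of_continuous_circ {f : Circ → ℂ} (hf : Continuous f) : MemLp f 2 volume :=
  hf.memLp_of_hasCompactSupport (HasCompactSupport.of_compactSpace f)

/-- The fundamental theorem of calculus on both sides of the jump at `σ`: the two ends of the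
fundamental interval contribute `-q F(α) + F(α + 2π) = 0` by the Floquet relation, and the jump
contributes `-(1 - q) F(σ)`. -/
theorem integral_circKernel_mul {α ξ h : ℝ} (hh : h ≠ 0) {χ χ' : Circ → ℂ}
    (H : IsTest circCover χ χ') (s : Circ) :
    ∫ y, (circKernel α ξ h y s : ℂ) * (-(h : ℂ) * χ' y + (circDrift ξ y : ℂ) * χ y) =
      (h : ℂ) * (1 - circMult ξ h) * χ s := by
  set σ := circLift α s with hσ
  have hσm : σ ∈ Ioc α (α + 2 * Real.pi) := circLift_mem α s
  set q : ℂ := ((circMult ξ h : ℝ) : ℂ) with hq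
  set f : ℝ → ℂ := fun y => cexpW (circPrim ξ) (-h⁻¹) y * (-(h : ℂ) * χ' (circCover y) +
        (circDrift ξ (circCover y) : ℂ) * χ (circCover y)) with hf
  set F : ℝ → ℂ := fun y => -(h : ℂ) * (cexpW (circPrim ξ) (-h⁻¹) y * χ (circCover y)) with hF
  have hfc : Continuous f := (contDiff_cexpW (contDiff_circPrim ξ) _).continuous.mul
    ((continuous_testImage H).comp isQuotientMap_circCover.continuous)
  have hFd : ∀ y, HasDerivAt F (f y) y := hasDerivAt_cexpW_mul_test hh H
  have hftc : ∀ a b, ∫ y in a..b, f y = F b - F a := fun a b =>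
    intervalIntegral.integral_eq_sub_of_hasDerivAt (fun y _ => hFd y) (hfc.intervalIntegrable _ _)
  have hFp : F (α + 2 * Real.pi) = q * F α := by
    simp only [hF]; rw [cexpW_circPrim_add, circCover_add]; ring
  have e1 : ∀ y : Circ, (circKernel α ξ h y s : ℂ) * (-(h : ℂ) * χ' y + (circDrift ξ y : ℂ) * χ y) =
      (fun y => cexpW (circPrim ξ) h⁻¹ σ * ((if σ < y then 1 else q) * f y)) (circLift α y) := fun y => by
    have ec : f (circLift α y) = cexpW (circPrim ξ) (-h⁻¹) (circLift α y) *
      (-(h : ℂ) * χ' y + (circDrift ξ y : ℂ) * χ y) := by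
      simp only [hf]; rw [circCover_circLift]
    simp only
    rw [ec, circKernel, circKer, ← hσ]
    have : ((Real.exp ((circPrim ξ σ - circPrim ξ (circLift α y)) / h) : ℝ) : ℂ) =
        cexpW (circPrim ξ) h⁻¹ σ * cexpW (circPrim ξ) (-h⁻¹) (circLift α y) := by
      unfold cexpW
      rw [← Complex.ofReal_mul, ← Real.exp_add]
      congr 2; ring
    rw [Complex.ofReal_mul, this]
    split_ifs
    · push_cast; ring
    · ring
  rw [integral_congr_ae (.of_forall e1), integral_circLift α
    (fun y => cexpW (circPrim ξ) h⁻¹ σ * ((if σ < y then 1 else q) * f y)), integral_const_mul, ← Ioc_union_Ioc_eq_Ioc hσm.1.le hσm.2,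
    setIntegral_union]
  · have a1 : ∫ y in Ioc α σ, (if σ < y then 1 else q) * f y = q * (F σ - F α) := by
      rw [← hftc, intervalIntegral.integral_of_le hσm.1.le, ← integral_const_mul]
      refine setIntegral_congr_fun measurableSet_Ioc fun y hy => ?_
      rw [if_neg (not_lt.2 hy.2)]
    have a2 : ∫ y in Ioc σ (α + 2 * Real.pi), (if σ < y then 1 else q) * f y =
        F (α + 2 * Real.pi) - F σ := by
      rw [← hftc, intervalIntegral.integral_of_le hσm.2]
      refine setIntegral_congr_fun measurableSet_Ioc fun y hy => ?_
      rw [if_pos hy.1, one_mul]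
    rw [a1, a2, hFp]
    have a3 : F σ = -(h : ℂ) * (cexpW (circPrim ξ) (-h⁻¹) σ * χ s) := by
      simp only [hF, hσ]; rw [circCover_circLift]
    have := cexpW_mul_neg (circPrim ξ) h⁻¹ σ
    rw [a3]
    linear_combination (h : ℂ) * (1 - q) * χ s * this
  · exact Ioc_disjoint_Ioc_of_le le_rfl
  · exact measurableSet_Ioc
  · refine ((hfc.const_mul q).integrableOn_Ioc (a := α) (b := σ)).congr_fun (fun y hy => ?_) measurableSet_Ioc
    simp only
    rw [if_neg (not_lt.2 hy.2)]
  · refine (hfc.integrableOn_Ioc (a := σ) (b := α + 2 * Real.pi)).congr_fun (fun y hy => ?_) measurableSet_Ioc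
    rw [if_pos hy.1, one_mul]

/-- When `q ≠ 1` the transposed equation is solvable for every smooth right-hand side: the constant
of integration can be chosen to make the solution periodic. Hence the uniqueness argument needs no
compatibility condition, unlike on the line. -/
theorem exists_isTest_circ {ξ h : ℝ} (hh : h ≠ 0) (hq : circMult ξ h ≠ 1) {f : Circ → ℂ}
    (hf : ContDiff ℝ ∞ (f ∘ circCover)) : ∃ χ χ' : Circ → ℂ, IsTest circCover χ χ' ∧
      ∀ y, -(h : ℂ) * χ' y + (circDrift ξ y : ℂ) * χ y = f y := by
  have hhc : (h : ℂ) ≠ 0 := by exact_mod_cast hh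
  set q : ℂ := ((circMult ξ h : ℝ) : ℂ) with hqd
  have hqc : 1 - q ≠ 0 := by
    rw [sub_ne_zero]; intro h1; exact hq (by rw [hqd] at h1; exact_mod_cast h1.symm)
  have hq0 : q ≠ 0 := by rw [hqd]; exact_mod_cast (circMult_pos ξ h).ne'
  set g : ℝ → ℂ := fun y => cexpW (circPrim ξ) (-h⁻¹) y * f (circCover y) with hg
  have hgs : ContDiff ℝ ∞ g := (contDiff_cexpW (contDiff_circPrim ξ) _).mul hf
  have hgp : ∀ y, g (y + 2 * Real.pi) = q * g y := fun y => by
    simp only [hg]; rw [cexpW_circPrim_add, circCover_add]; ring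
  set G : ℝ → ℂ := fun s => ∫ t in (0 : ℝ)..s, g t with hG
  have hGs : ContDiff ℝ ∞ G := contDiff_integral_Ioc hgs 0
  have hGd : ∀ s, HasDerivAt G (g s) s := fun s =>
    intervalIntegral.integral_hasDerivAt_right (hgs.continuous.intervalIntegrable _ _)
      hgs.continuous.stronglyMeasurable.stronglyMeasurableAtFilter hgs.continuous.continuousAt
  set c₀ : ℂ := G (2 * Real.pi) with hc₀
  -- By this relation `c₀ - (1 - q) G` is multiplied by `q` over a period, which cancels the factor
  -- `q⁻¹` of the exponential in `X`.
  have hGp : ∀ s, G (s + 2 * Real.pi) = c₀ + q * G s := fun s => by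
    have h1 : G (s + 2 * Real.pi) = c₀ + ∫ t in (2 * Real.pi)..(s + 2 * Real.pi), g t :=
      (intervalIntegral.integral_add_adjacent_intervals (hgs.continuous.intervalIntegrable _ _)
        (hgs.continuous.intervalIntegrable _ _)).symm
    rw [h1]
    congr 1
    have h2 := intervalIntegral.integral_comp_add_right (a := 0) (b := s) g (2 * Real.pi)
    rw [zero_add] at h2
    rw [← h2, hG, ← intervalIntegral.integral_const_mul]
    simp_rw [hgp]
  set X : ℝ → ℂ := fun s => cexpW (circPrim ξ) h⁻¹ s * ((h : ℂ)⁻¹ * (1 - q)⁻¹) *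
    (c₀ - (1 - q) * G s) with hX
  have hXs : ContDiff ℝ ∞ X := ((contDiff_cexpW (contDiff_circPrim ξ) _).mul contDiff_const).mul
    (contDiff_const.sub (contDiff_const.mul hGs))
  have hEp : ∀ y, cexpW (circPrim ξ) h⁻¹ (y + 2 * Real.pi) = q⁻¹ * cexpW (circPrim ξ) h⁻¹ y := fun y => by
    have h1 := cexpW_mul_neg (circPrim ξ) h⁻¹ (y + 2 * Real.pi)
    have h2 := cexpW_mul_neg (circPrim ξ) h⁻¹ y
    rw [cexpW_circPrim_add] at h1
    rw [eq_inv_mul_iff_mul_eq₀ hq0]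
    linear_combination (cexpW (circPrim ξ) h⁻¹ y) * h1 -
      (q * cexpW (circPrim ξ) h⁻¹ (y + 2 * Real.pi)) * h2
  have hXp : Function.Periodic X (2 * Real.pi) := fun y => by
    simp only [hX]; rw [hEp, hGp]; field_simp; ring
  have hXd : ∀ s, HasDerivAt X (((drift circPhi ξ s : ℂ) * X s - f (circCover s)) / h) s := fun s => by
    have h1 := ((hasDerivAt_cexpW (hasDerivAt_circPrim ξ s) h⁻¹).mul_const
      ((h : ℂ)⁻¹ * (1 - q)⁻¹)).mul (((hGd s).const_mul (1 - q)).const_sub c₀)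
    refine h1.congr_deriv ?_
    have h2 := cexpW_mul_neg (circPrim ξ) h⁻¹ s
    simp only [hX, hg]
    generalize cexpW (circPrim ξ) h⁻¹ s = a at *
    generalize cexpW (circPrim ξ) (-h⁻¹) s = b at *
    push_cast
    field_simp
    linear_combination ((q - 1) * h * f (circCover s)) * h2
  refine ⟨hXp.lift, fun y => ((circDrift ξ y : ℂ) * hXp.lift y - f y) / h,
    ⟨HasCompactSupport.of_compactSpace _, hXs, fun x => hXd x⟩, fun y => ?_⟩
  field_simp; ring

theorem circP_weak_iff {ξ h : ℝ} (hh : h ≠ 0) (u v : L2 Circ) :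
    circP h ξ u v ↔ ∀ χ χ' : Circ → ℂ, IsTest circCover χ χ' →
        ∫ y, u y * (-(h : ℂ) * χ' y + (circDrift ξ y : ℂ) * χ y) = ∫ y, v y * χ y := by
  have hb : ∀ y, |circDrift ξ y| ≤ (|ξ| + 1) * |(1 : ℝ)| := fun y => by
    obtain ⟨x, rfl⟩ := isQuotientMap_circCover.surjective y
    rw [circDrift_circCover, drift_circPhi, abs_one, mul_one]
    exact (abs_add_le _ _).trans (add_le_add le_rfl (Real.abs_cos_le_one x))
  have := opGraph_iff_weak (w := circDrift ξ) (ρ := fun _ => 1) isQuotientMap_circCover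
    (continuous_circDrift ξ) hb hh u v
  refine this.trans (and_iff_right ?_)
  simpa using Lp.memLp u

/-- The cut `α` is arbitrary here; it is chosen later, according to the sign of `ξ`, so that the
critical points sit conveniently in the fundamental interval. -/
theorem circP_iff {α ξ h : ℝ} (hh : h ≠ 0) (hq : circMult ξ h ≠ 1)
    (hk : HSKernel (circKernel α ξ h)) (u v : L2 Circ) :
    circP h ξ u v ↔ u = (((h * (1 - circMult ξ h))⁻¹ : ℝ) • hk.op) v := by
  set a : ℝ := (h * (1 - circMult ξ h))⁻¹ with ha
  have ha0 : (a : ℂ) * ((h : ℂ) * (1 - circMult ξ h)) = 1 := by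
    have : h * (1 - circMult ξ h) ≠ 0 := mul_ne_zero hh (sub_ne_zero.2 hq.symm)
    rw [ha]
    exact_mod_cast inv_mul_cancel₀ this
  set K : L2 Circ →L[ℂ] L2 Circ := a • hk.op with hK
  have hKv : ∀ v, K v =ᵐ[volume] fun y => (a : ℂ) * hk.op v y := fun v => by
    have e : K v = a • hk.op v := rfl
    rw [e]
    filter_upwards [Lp.coeFn_smul a (hk.op v)] with y h1
    rw [h1, Pi.smul_apply, Complex.real_smul]
  have hfwd : ∀ v : L2 Circ, circP h ξ (K v) v := fun v => by
    rw [circP_weak_iff hh]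
    intro χ χ' H
    have e1 : ∫ y, K v y * (-(h : ℂ) * χ' y + (circDrift ξ y : ℂ) * χ y) =
        (a : ℂ) * ∫ y, hk.op v y * (-(h : ℂ) * χ' y + (circDrift ξ y : ℂ) * χ y) := by
      rw [← integral_const_mul]
      refine integral_congr_ae ?_
      filter_upwards [hKv v] with y h1
      rw [h1]; ring
    rw [e1, hk.integral_op_mul v (memLp_of_continuous_circ (continuous_testImage H))]
    simp_rw [integral_circKernel_mul hh H]
    rw [← integral_const_mul]
    congr 1; ext y
    linear_combination (v y * χ y) * ha0
  constructor
  · intro hu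
    have hKv' := hfwd v
    rw [circP_weak_iff hh] at hu hKv'
    have hsub : (u - K v : L2 Circ) =ᵐ[volume] fun y => u y - K v y := Lp.coeFn_sub _ _
    have hz0 := ae_zero_of_integral_smooth (Lp.memLp (u - K v)) fun f hf => by
      obtain ⟨χ, χ', H, heq⟩ := exists_isTest_circ hh hq hf
      have hfL := memLp_of_continuous_circ (continuous_testImage (ξ := ξ) (h := h) H)
      have h1 := (hu χ χ' H).trans (hKv' χ χ' H).symm
      simp_rw [heq] at h1 hfL
      have i1 : Integrable fun y => u y * f y := (Lp.memLp u).integrable_mul hfL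
      have i2 : Integrable fun y => K v y * f y := (Lp.memLp (K v)).integrable_mul hfL
      rw [← sub_eq_zero.2 h1, ← integral_sub i1 i2]
      refine integral_congr_ae ?_
      filter_upwards [hsub] with y hy
      rw [hy, sub_mul]
    rw [← sub_eq_zero]
    exact Lp.ext (hz0.trans (Lp.coeFn_zero _ _ _).symm)
  · rintro rfl
    exact hfwd v

/-! ## The kernel at `ξ = 0` -/

/-- For `ξ = 0` the functions `exp (∓ sin / h)` are periodic and are annihilated by the operator and
by its adjoint respectively; since singular values are nonnegative, `0` is the least. -/
theorem exists_singularTriple_circ_zero {h : ℝ} (hh : h ≠ 0) :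
    IsLeast (singularValues (circP h 0)) |(0 : ℝ)| ∧
      ∃ ePlus eMinus, IsSingularTriple (circP h 0) 0 ePlus eMinus := by
  have hper : ∀ a : ℝ, Function.Periodic (cexpW (circPrim 0) a) (2 * Real.pi) := fun a y => by
    unfold cexpW circPrim; simp
  set f : ℝ → Circ → ℂ := fun a => (hper a).lift with hf
  have hfs : ∀ a, ContDiff ℝ ∞ (f a ∘ circCover) := fun a => contDiff_cexpW (contDiff_circPrim 0) a
  have hfc : ∀ a, Continuous (f a) := fun a =>
    isQuotientMap_circCover.continuous_iff.2 (hfs a).continuous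
  have hfL : ∀ a, MemLp (f a) 2 volume := fun a => memLp_of_continuous_circ (hfc a)
  have hfne : ∀ a, (hfL a).toLp (f a) ≠ 0 := fun a h0 => by
    have h1 := (Lp.eq_zero_iff_ae_eq_zero.1 h0).symm.trans (hfL a).coeFn_toLp
    have h2 : (fun _ : Circ => (0 : ℂ)) = f a := (continuous_const.ae_eq_iff_eq volume (hfc a)).1 h1
    have h3 := congrFun h2 (circCover 0)
    have : f a (circCover 0) = cexpW (circPrim 0) a 0 := rfl
    rw [this] at h3
    simp [cexpW, circPrim] at h3
  set e : ℝ → L2 Circ := fun a => ((‖(hfL a).toLp (f a)‖⁻¹ : ℝ) : ℂ) • (hfL a).toLp (f a) with he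
  have hen : ∀ a, ‖e a‖ = 1 := fun a => by
    have := norm_pos_iff.2 (hfne a)
    rw [he]; simp only
    rw [norm_smul, Complex.norm_real, Real.norm_of_nonneg (by positivity), inv_mul_cancel₀ this.ne']
  have hec : ∀ a, e a =ᵐ[volume] fun y => ((‖(hfL a).toLp (f a)‖⁻¹ : ℝ) : ℂ) * f a y := fun a => by
    filter_upwards [Lp.coeFn_smul ((‖(hfL a).toLp (f a)‖⁻¹ : ℝ) : ℂ) ((hfL a).toLp (f a)),
      (hfL a).coeFn_toLp] with y h1 h2
    rw [h1, Pi.smul_apply, h2, smul_eq_mul]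
  have hP : circP h 0 (e (-h⁻¹)) 0 := by
    rw [circP_weak_iff hh]
    intro χ χ' H
    have e1 : ∫ y, e (-h⁻¹) y * (-(h : ℂ) * χ' y + (circDrift 0 y : ℂ) * χ y) =
        ((‖(hfL (-h⁻¹)).toLp (f (-h⁻¹))‖⁻¹ : ℝ) : ℂ) *
          ∫ y, f (-h⁻¹) y * (-(h : ℂ) * χ' y + (circDrift 0 y : ℂ) * χ y) := by
      rw [← integral_const_mul]
      refine integral_congr_ae ?_
      filter_upwards [hec (-h⁻¹)] with y hy
      rw [hy]; ring
    have e2 : ∫ y, (0 : L2 Circ) y * χ y = 0 := by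
      rw [← integral_zero Circ ℂ (μ := volume)]
      refine integral_congr_ae ?_
      filter_upwards [Lp.coeFn_zero ℂ 2 (volume : Measure Circ)] with y hy
      rw [hy]; simp
    have hc : Continuous fun y => f (-h⁻¹) y * (-(h : ℂ) * χ' y + (circDrift 0 y : ℂ) * χ y) :=
      (hfc _).mul (continuous_testImage H)
    have e3 := AddCircle.intervalIntegral_preimage (2 * Real.pi) 0
      (fun y => f (-h⁻¹) y * (-(h : ℂ) * χ' y + (circDrift 0 y : ℂ) * χ y))
    have e4 := intervalIntegral.integral_eq_sub_of_hasDerivAt (a := 0) (b := 0 + 2 * Real.pi)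
      (fun y _ => hasDerivAt_cexpW_mul_test (ξ := 0) hh H y)
      ((hc.comp isQuotientMap_circCover.continuous).intervalIntegrable _ _)
    rw [e1, e2, ← e3]
    refine mul_eq_zero_of_right _ (e4.trans ?_)
    rw [circCover_add, hper (-h⁻¹) 0, sub_self]
  have hAdj : ∀ u Pu : L2 Circ, circP h 0 u Pu → inner ℂ Pu (e h⁻¹) = 0 := by
    intro u Pu hu
    rw [circP_weak_iff hh] at hu
    -- On the compact circle the adjoint null function is itself a test function, so it can be
    -- inserted in the weak equation.
    have H : IsTest circCover (f h⁻¹)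
        (fun y => ((h : ℂ)⁻¹ * (circDrift 0 y : ℂ)) * f h⁻¹ y) :=
      ⟨HasCompactSupport.of_compactSpace _, hfs _, fun x => by
        refine (hasDerivAt_cexpW (hasDerivAt_circPrim 0 x) h⁻¹).congr_deriv ?_
        rw [circDrift_circCover]
        have : f h⁻¹ (circCover x) = cexpW (circPrim 0) h⁻¹ x := rfl
        rw [this]; push_cast; ring⟩
    have h1 := hu _ _ H
    have hhc : (h : ℂ) ≠ 0 := by exact_mod_cast hh
    have h2 : ∀ y, -(h : ℂ) * (((h : ℂ)⁻¹ * (circDrift 0 y : ℂ)) * f h⁻¹ y) +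
        (circDrift 0 y : ℂ) * f h⁻¹ y = 0 := fun y => by field_simp; ring
    simp_rw [h2, mul_zero, integral_zero] at h1
    have hreal : ∀ y, conj (f h⁻¹ y) = f h⁻¹ y := fun y => by
      obtain ⟨x, rfl⟩ := isQuotientMap_circCover.surjective y
      exact Complex.conj_ofReal _
    rw [← inner_conj_symm, L2.inner_def]
    have : ∫ y, inner ℂ (e h⁻¹ y) (Pu y) = ((‖(hfL h⁻¹).toLp (f h⁻¹)‖⁻¹ : ℝ) : ℂ) *
        ∫ y, Pu y * f h⁻¹ y := by
      rw [← integral_const_mul]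
      refine integral_congr_ae ?_
      filter_upwards [hec h⁻¹] with y hy
      rw [hy, RCLike.inner_apply, map_mul, hreal, Complex.conj_ofReal]; ring
    rw [this, ← h1]; simp
  refine ⟨⟨⟨abs_nonneg _, e (-h⁻¹), 0, ?_, hP, ?_⟩, fun t ht => by simpa using ht.1⟩,
    e (-h⁻¹), e h⁻¹, hen _, hen _, ?_, ?_⟩
  · rw [← norm_pos_iff, hen]; exact one_pos
  · intro u Pu _; simp
  · simpa using hP
  · intro u Pu hu
    rw [hAdj u Pu hu]; simp

/-! ## The norm of the inverse on the circle -/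

theorem lintegral_circLift_sub (α : ℝ) (F : ℝ → ENNReal) :
    ∫⁻ y, F (circLift α y - α) = ∫⁻ z in Ioc 0 (2 * Real.pi), F z := by
  rw [lintegral_circLift α (fun z => F (z - α)), ← lintegral_indicator measurableSet_Ioc,
    ← lintegral_indicator measurableSet_Ioc,
    ← lintegral_sub_right_eq_self ((Ioc 0 (2 * Real.pi)).indicator F) α]
  congr 1; ext z
  by_cases hz : z ∈ Ioc α (α + 2 * Real.pi)
  · rw [indicator_of_mem hz, indicator_of_mem (show z - α ∈ Ioc 0 (2 * Real.pi) from
      ⟨by linarith [hz.1], by linarith [hz.2]⟩)]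
  · rw [indicator_of_notMem hz, indicator_of_notMem]
    exact fun h => hz ⟨by linarith [h.1], by linarith [h.2]⟩

theorem integral_circLift_sub (α : ℝ) (F : ℝ → ℝ) :
    ∫ y, F (circLift α y - α) = ∫ z in (0 : ℝ)..2 * Real.pi, F z := by
  rw [integral_circLift α (fun z => F (z - α)),
    ← intervalIntegral.integral_of_le (by linarith [Real.pi_pos]),
    intervalIntegral.integral_comp_sub_right]
  congr 1 <;> ring

/-- `∫₀^{2π} exp (-2 Ψ / h)`. -/
noncomputable def circMass (θ h : ℝ) : ℝ :=
  ∫ z in (0 : ℝ)..2 * Real.pi, Real.exp (-(2 * circWeight θ z / h))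

theorem continuous_circWeight (θ : ℝ) : Continuous (circWeight θ) := by
  unfold circWeight; fun_prop

theorem circMass_eq {θ h : ℝ} (hθ : 0 < θ) (hh : 0 < h) : circMass θ h =
    Real.exp (2 * (Real.sin θ - θ * Real.cos θ) / h) * (θ * Real.sqrt (h / θ ^ 3)) *
      modelInt θ (Real.sqrt (h / θ ^ 3)) := by
  rw [← integral_circWeight hθ hh, circMass, integral_Icc_eq_integral_Ioc,
    intervalIntegral.integral_of_le (by linarith [Real.pi_pos])]

theorem circMass_pos (θ h : ℝ) : 0 < circMass θ h := by
  have := continuous_circWeight θ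
  refine intervalIntegral.intervalIntegral_pos_of_pos (Continuous.intervalIntegrable (by fun_prop) _ _)
    (fun z => Real.exp_pos _) (by linarith [Real.pi_pos])

/-- The weight satisfies `Ψ(2π - z) = 2π cos θ - Ψ(z)`, which relates the two exponentials by
reflection. -/
theorem integral_exp_circWeight (θ h : ℝ) :
    ∫ z in (0 : ℝ)..2 * Real.pi, Real.exp (2 * circWeight θ z / h) =
      (circMult (Real.cos θ) h ^ 2)⁻¹ * circMass θ h := by
  have e : ∀ z, Real.exp (2 * circWeight θ z / h) = (circMult (Real.cos θ) h ^ 2)⁻¹ *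
      Real.exp (-(2 * circWeight θ (2 * Real.pi - z) / h)) := fun z => by
    unfold circMult circWeight
    rw [← Real.exp_nat_mul, ← Real.exp_neg, ← Real.exp_add, Real.sin_two_pi_sub]
    congr 1; push_cast; ring
  simp_rw [e]
  rw [intervalIntegral.integral_const_mul,
    intervalIntegral.integral_comp_sub_left (fun z => Real.exp (-(2 * circWeight θ z / h)))]
  simp [circMass]

theorem setLIntegral_ofReal_eq {F : ℝ → ℝ} (hF : Continuous F) (h0 : ∀ z, 0 ≤ F z) :
    ∫⁻ z in Ioc 0 (2 * Real.pi), ENNReal.ofReal (F z) =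
      ENNReal.ofReal (∫ z in (0 : ℝ)..2 * Real.pi, F z) := by
  rw [intervalIntegral.integral_of_le (by linarith [Real.pi_pos]),
    ofReal_integral_eq_lintegral_ofReal hF.integrableOn_Ioc (.of_forall h0)]

/-- An upper bound for the square of the kernel. -/
noncomputable def circMajorant (θ h z t : ℝ) : ENNReal :=
  ENNReal.ofReal (Real.exp (2 * (circWeight θ t - circWeight θ z) / h)) *
    (if t ≤ z then 1 else ENNReal.ofReal (circMult (Real.cos θ) h ^ 2))

/-- The excess of the Hilbert-Schmidt norm. -/
noncomputable def circExcess (θ h : ℝ) : ℝ :=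
  128 * θ ^ 2 * (1 + h / θ ^ 3) * Real.exp (2 * (Real.sin θ - θ * Real.cos θ) / h)

/-- The region `t > z` carries the weight `q²`; extended to the whole square it factors into `q² ·
circMass · q⁻² circMass = circMass²`. The triangle `t ≤ z` is the excess. -/
theorem lintegral_circMajorant_le {θ h : ℝ} (hθ : θ ∈ Ioc 0 (Real.pi / 2)) (hh : 0 < h) :
    ∫⁻ z in Ioc 0 (2 * Real.pi), ∫⁻ t in Ioc 0 (2 * Real.pi), circMajorant θ h z t ≤
      ENNReal.ofReal (circMass θ h ^ 2 + circExcess θ h) := by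
  have hΨ := continuous_circWeight θ
  have hq := circMult_pos (Real.cos θ) h
  set q := circMult (Real.cos θ) h with hqd
  set a := circMass θ h with ha
  have ha0 : 0 < a := circMass_pos θ h
  set I : ℝ → ℝ → ENNReal := fun z t =>
    ENNReal.ofReal (Real.exp (2 * (circWeight θ t - circWeight θ z) / h)) with hI
  have hIm : Measurable (Function.uncurry I) := by
    rw [hI]; unfold Function.uncurry; fun_prop
  set J : ℝ → ℝ → ENNReal := fun z t => (Iic z).indicator (I z) t with hJ
  have hJm : Measurable (Function.uncurry J) := by
    have : Function.uncurry J = {p : ℝ × ℝ | p.2 ≤ p.1}.indicator (Function.uncurry I) := by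
      ext ⟨z, t⟩; rfl
    rw [this]
    exact hIm.indicator (measurableSet_le measurable_snd measurable_fst)
  have hle : ∀ z t, circMajorant θ h z t ≤ J z t + ENNReal.ofReal (q ^ 2) *
      (ENNReal.ofReal (Real.exp (-(2 * circWeight θ z / h))) *
        ENNReal.ofReal (Real.exp (2 * circWeight θ t / h))) := by
    intro z t
    unfold circMajorant
    split_ifs with htz
    · simp only [hJ]
      rw [indicator_of_mem (show t ∈ Iic z from htz), mul_one]
      exact le_add_right le_rfl
    · refine le_add_left (le_of_eq ?_)
      rw [mul_comm, ← ENNReal.ofReal_mul (Real.exp_pos _).le, ← Real.exp_add]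
      congr 3; ring
  have hJint : ∫⁻ z in Ioc 0 (2 * Real.pi), ∫⁻ t in Ioc 0 (2 * Real.pi), J z t ≤
      ENNReal.ofReal (circExcess θ h) := by
    refine le_trans (le_of_eq ?_) (lintegral_circWeight_le hθ hh)
    rw [← restrict_Ioo_eq_restrict_Ioc]
    refine setLIntegral_congr_fun measurableSet_Ioo fun z hz => ?_
    simp only [hJ]
    rw [lintegral_indicator measurableSet_Iic, Measure.restrict_restrict measurableSet_Iic,
      restrict_Ioo_eq_restrict_Ioc]
    have : Iic z ∩ Ioo 0 (2 * Real.pi) = Ioc 0 z := by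
      ext t
      exact ⟨fun h => ⟨h.2.1, h.1⟩, fun h => ⟨h.2, h.1, lt_of_le_of_lt h.2 hz.2⟩⟩
    rw [this]
  have hP : ∫⁻ z in Ioc 0 (2 * Real.pi), ENNReal.ofReal (Real.exp (-(2 * circWeight θ z / h))) =
      ENNReal.ofReal a := setLIntegral_ofReal_eq (by fun_prop) fun z => (Real.exp_pos _).le
  have hQ : ∫⁻ z in Ioc 0 (2 * Real.pi), ENNReal.ofReal (Real.exp (2 * circWeight θ z / h)) =
      ENNReal.ofReal ((q ^ 2)⁻¹ * a) := by
    rw [setLIntegral_ofReal_eq (by fun_prop) fun z => (Real.exp_pos _).le,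
      integral_exp_circWeight]
  have hEx : 0 ≤ circExcess θ h := by
    have := hθ.1
    unfold circExcess; positivity
  calc _ ≤ ∫⁻ z in Ioc 0 (2 * Real.pi), ∫⁻ t in Ioc 0 (2 * Real.pi), (J z t + ENNReal.ofReal (q ^ 2) *
      (ENNReal.ofReal (Real.exp (-(2 * circWeight θ z / h))) *
        ENNReal.ofReal (Real.exp (2 * circWeight θ t / h)))) :=
        lintegral_mono fun z => lintegral_mono fun t => hle z t
    _ = ∫⁻ z in Ioc 0 (2 * Real.pi), ((∫⁻ t in Ioc 0 (2 * Real.pi), J z t) + ENNReal.ofReal (q ^ 2) *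
      (ENNReal.ofReal (Real.exp (-(2 * circWeight θ z / h))) * ENNReal.ofReal ((q ^ 2)⁻¹ * a))) := by
        refine lintegral_congr fun z => ?_
        rw [lintegral_add_left (f := J z) (hJm.comp measurable_prodMk_left),
          lintegral_const_mul _ (by fun_prop), lintegral_const_mul _ (by fun_prop), hQ]
    _ = (∫⁻ z in Ioc 0 (2 * Real.pi), ∫⁻ t in Ioc 0 (2 * Real.pi), J z t) + ENNReal.ofReal (q ^ 2) *
      (ENNReal.ofReal a * ENNReal.ofReal ((q ^ 2)⁻¹ * a)) := by
        rw [lintegral_add_left (f := fun z => ∫⁻ t in Ioc 0 (2 * Real.pi), J z t)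
          hJm.lintegral_prod_right', lintegral_const_mul _ (by fun_prop),
          lintegral_mul_const _ (by fun_prop), hP]
    _ ≤ ENNReal.ofReal (circExcess θ h) + ENNReal.ofReal (q ^ 2) *
      (ENNReal.ofReal a * ENNReal.ofReal ((q ^ 2)⁻¹ * a)) := by gcongr
    _ = _ := by
        rw [← ENNReal.ofReal_mul ha0.le, ← ENNReal.ofReal_mul (by positivity),
          ← ENNReal.ofReal_add hEx (by positivity)]
        congr 1; field_simp; ring

theorem measurable_circMajorant_comp {Y : Type} [MeasurableSpace Y] {Z : Y → ℝ} (hZ : Measurable Z)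
    (θ h : ℝ) : Measurable (Function.uncurry fun y s : Y => circMajorant θ h (Z y) (Z s)) := by
  have := (continuous_circWeight θ).measurable
  have h1 : Measurable fun p : Y × Y => Z p.1 := hZ.comp measurable_fst
  have h2 : Measurable fun p : Y × Y => Z p.2 := hZ.comp measurable_snd
  unfold circMajorant Function.uncurry
  refine Measurable.mul (Measurable.ennreal_ofReal (Real.measurable_exp.comp ?_))
    (Measurable.ite (measurableSet_le h2 h1) measurable_const measurable_const)
  exact (((this.comp h2).sub (this.comp h1)).const_mul 2).div_const h

theorem lintegral_const_mul_swap {Y : Type} [MeasureSpace Y] [SFinite (volume : Measure Y)]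
    {M : Y → Y → ENNReal} (hM : Measurable (Function.uncurry M)) (c : ENNReal) :
    ∫⁻ y, ∫⁻ s, c * M s y = c * ∫⁻ s, ∫⁻ y, M s y := by
  have h1 : Measurable fun s => ∫⁻ y, M s y := hM.lintegral_prod_right'
  have h2 : AEMeasurable (Function.uncurry fun y s => c * M s y) (volume.prod volume) :=
    ((hM.comp measurable_swap).const_mul c).aemeasurable
  rw [lintegral_lintegral_swap h2, ← lintegral_const_mul _ h1]
  refine lintegral_congr fun s => ?_
  rw [lintegral_const_mul _ (show Measurable (M s) from hM.comp measurable_prodMk_left)]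

theorem lintegral_circMajorant_lift_le (α : ℝ) {θ h : ℝ} (hθ : θ ∈ Ioc 0 (Real.pi / 2)) (hh : 0 < h) :
    ∫⁻ y, ∫⁻ s, circMajorant θ h (circLift α y - α) (circLift α s - α) ≤
      ENNReal.ofReal (circMass θ h ^ 2 + circExcess θ h) := by
  refine le_trans (le_of_eq ?_) (lintegral_circMajorant_le hθ hh)
  rw [← lintegral_circLift_sub α]
  refine lintegral_congr fun y => ?_
  rw [lintegral_circLift_sub α (circMajorant θ h (circLift α y - α))]

theorem memLp_circLift (α : ℝ) {F : ℝ → ℝ} (hF : Continuous F)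
    (h0 : 0 < ∫ z in (0 : ℝ)..2 * Real.pi, F z ^ 2) :
    MemLp (fun y => F (circLift α y - α)) 2 volume := by
  have hm : Measurable fun y => F (circLift α y - α) :=
    hF.measurable.comp ((measurable_circLift α).sub_const α)
  refine (memLp_two_iff_integrable_sq hm.aestronglyMeasurable).2 ?_
  by_contra hc
  have := integral_undef hc
  rw [integral_circLift_sub α (fun z => F z ^ 2)] at this
  exact h0.ne' this

theorem circMult_lt_one {θ h : ℝ} (hθ : θ ∈ Ioo 0 (Real.pi / 2)) (hh : 0 < h) :
    circMult (Real.cos θ) h < 1 := by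
  have : 0 < Real.cos θ := Real.cos_pos_of_mem_Ioo ⟨by linarith [hθ.1, Real.pi_pos], hθ.2⟩
  unfold circMult
  rw [Real.exp_lt_one_iff]
  have := Real.pi_pos
  rw [neg_lt_zero]
  positivity

/-- The step factor of the kernel is never below `q`, up to the normalisation `β`, so the kernel
dominates a product on the whole square. The norms of the factors multiply to `q⁻¹ circMass`. The
sign `σ` allows for the exchange of the two variables when `ξ` changes sign. -/
theorem le_norm_op_circ (α : ℝ) {θ h : ℝ} {k : Circ → Circ → ℝ} (hk : HSKernel k) {β : ℝ}
    (hβ : 0 ≤ β) (σ : ℝ) (hσ : σ = 1 ∨ σ = -1)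
    (hle : ∀ y s, β * circMult (Real.cos θ) h * Real.exp (σ * (circWeight θ (circLift α s - α) -
      circWeight θ (circLift α y - α)) / h) ≤ k y s) :
    β * circMass θ h ≤ ‖hk.op‖ := by
  have hΨ := continuous_circWeight θ
  have hq := circMult_pos (Real.cos θ) h
  have hm := circMass_pos θ h
  set q := circMult (Real.cos θ) h with hqd
  have hsq : ∀ τ : ℝ, ∀ z, Real.exp (τ * circWeight θ z / h) ^ 2 =
      Real.exp (2 * (τ * circWeight θ z) / h) :=
    fun τ y => by rw [← Real.exp_nat_mul]; congr 1; push_cast; ring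
  have hI : ∀ τ : ℝ, τ = 1 ∨ τ = -1 → 0 < ∫ z in (0 : ℝ)..2 * Real.pi, Real.exp (τ * circWeight θ z / h) ^ 2 :=
    fun τ _ => by
      refine intervalIntegral.intervalIntegral_pos_of_pos
        (Continuous.intervalIntegrable (by fun_prop) _ _)
        (fun z => by positivity) (by linarith [Real.pi_pos])
  have h1 : ∫ z in (0 : ℝ)..2 * Real.pi, Real.exp (1 * circWeight θ z / h) ^ 2 =
      (q ^ 2)⁻¹ * circMass θ h := by
    simp_rw [hsq, one_mul]; exact integral_exp_circWeight θ h
  have h2 : ∫ z in (0 : ℝ)..2 * Real.pi, Real.exp (-1 * circWeight θ z / h) ^ 2 = circMass θ h := by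
    simp_rw [hsq, circMass]
    congr 1; ext z; congr 1; ring
  have hσ' : -σ = 1 ∨ -σ = -1 := by rcases hσ with rfl | rfl <;> simp
  have key := hk.le_norm_op (f := fun s => Real.exp (σ * circWeight θ (circLift α s - α) / h))
    (g := fun y => Real.exp (-σ * circWeight θ (circLift α y - α) / h)) (c := β * q)
    (memLp_circLift α (F := fun z => Real.exp (σ * circWeight θ z / h)) (by fun_prop) (hI σ hσ))
    (memLp_circLift α (F := fun z => Real.exp (-σ * circWeight θ z / h)) (by fun_prop) (hI (-σ) hσ'))
    (fun y => (Real.exp_pos _).le) (fun y => (Real.exp_pos _).le) (by positivity)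
    (fun y s => by
      refine (le_of_eq ?_).trans (hle y s)
      rw [mul_assoc, ← Real.exp_add]
      congr 2; ring)
    (by
      rw [integral_circLift_sub α (fun z => Real.exp (σ * circWeight θ z / h) ^ 2)]
      exact hI σ hσ)
  rw [integral_circLift_sub α (fun z => Real.exp (σ * circWeight θ z / h) ^ 2),
    integral_circLift_sub α (fun z => Real.exp (-σ * circWeight θ z / h) ^ 2)] at key
  have hs : Real.sqrt ((q ^ 2)⁻¹ * circMass θ h) * Real.sqrt (circMass θ h) =
      q⁻¹ * circMass θ h := by
    rw [← Real.sqrt_mul (by positivity), show (q ^ 2)⁻¹ * circMass θ h * circMass θ h =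
      (q⁻¹ * circMass θ h) ^ 2 by rw [mul_pow, inv_pow]; ring, Real.sqrt_sq (by positivity)]
  refine le_trans (le_of_eq ?_) key
  rcases hσ with rfl | rfl
  · rw [h1, h2, mul_assoc, hs]; field_simp
  · rw [neg_neg, h1, h2, mul_assoc, mul_comm (Real.sqrt _), hs]; field_simp

theorem isReducedNorm_circ {θ h N : ℝ} (hθ : θ ∈ Ioc 0 (Real.pi / 2)) (hh : 0 < h)
    (h1 : circMass θ h ≤ N) (h2 : N ^ 2 ≤ circMass θ h ^ 2 + circExcess θ h) :
    IsReducedNorm 128 θ (Real.sqrt (h / θ ^ 3)) (N /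
      (Real.exp (2 * (Real.sin θ - θ * Real.cos θ) / h) * (θ * Real.sqrt (h / θ ^ 3)))) := by
  have hθ0 := hθ.1
  have e := circMass_eq hθ0 hh
  -- The lower bound of the model phase at `v = -1`: it makes the decay rate `S₀/h` at least a fixed
  -- multiple of `1/ε²`, uniformly as `θ → 0`.
  have hS : 1 / Real.pi ^ 3 * θ ^ 3 ≤ 2 * (Real.sin θ - θ * Real.cos θ) := by
    have a1 := cube_mul_modelPhase hθ0.ne' (-1)
    have a2 := modelPhase_ge (θ := θ) (v := -1) ⟨hθ.1.le, hθ.2⟩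
      ⟨le_rfl, by rw [add_neg_cancel, mul_zero]; positivity⟩
    rw [add_neg_cancel, mul_zero, Real.sin_zero] at a1
    have a3 : θ ^ 3 * (1 / (2 * Real.pi ^ 3)) ≤ θ ^ 3 * modelPhase θ (-1) := by gcongr
    have a4 : 1 / Real.pi ^ 3 * θ ^ 3 = 2 * (θ ^ 3 * (1 / (2 * Real.pi ^ 3))) := by field_simp
    rw [a4]; linarith
  rw [circExcess] at h2
  set ε := Real.sqrt (h / θ ^ 3) with hε
  have hε0 : 0 < ε := by positivity
  have hε2 : ε ^ 2 = h / θ ^ 3 := Real.sq_sqrt (by positivity)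
  set E := Real.exp (2 * (Real.sin θ - θ * Real.cos θ) / h) with hE
  have hE0 : 0 < E := Real.exp_pos _
  constructor
  · rw [le_div_iff₀ (by positivity)]
    rw [e] at h1; linarith
  · have hEinv : E⁻¹ ≤ Real.exp (-(1 / Real.pi ^ 3 / ε ^ 2)) := by
      rw [hE, ← Real.exp_neg]
      apply Real.exp_le_exp.2
      rw [hε2, neg_le_neg_iff]
      calc 1 / Real.pi ^ 3 / (h / θ ^ 3) = 1 / Real.pi ^ 3 * θ ^ 3 / h := by field_simp
        _ ≤ _ := by gcongr
    rw [← hε2] at h2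
    rw [div_pow, div_le_iff₀ (by positivity)]
    calc N ^ 2 ≤ _ := h2
      _ = (modelInt θ ε ^ 2 + 128 * (1 + ε ^ 2) / ε ^ 2 * E⁻¹) * (E * (θ * ε)) ^ 2 := by
          rw [e]; field_simp
      _ ≤ _ := by gcongr

theorem enorm_ofReal_mul_sq {a b : ℝ} (ha : 0 ≤ a) (hb : 0 ≤ b) :
    ‖a * b‖ₑ ^ 2 = ENNReal.ofReal (a ^ 2) * ENNReal.ofReal (b ^ 2) := by
  rw [enorm_ofReal_sq (mul_nonneg ha hb), mul_pow, ENNReal.ofReal_mul (by positivity)]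

/-- The operator with kernel `circKernel`, normalised, for `ξ = cos θ` and `ξ = - cos θ`. -/
theorem exists_circNorm {θ h : ℝ} (hθ : θ ∈ Ioo 0 (Real.pi / 2)) (hh : 0 < h) {ξ : ℝ}
    (hξ : ξ = Real.cos θ ∨ ξ = -Real.cos θ) : ∃ α N : ℝ, ∃ hk : HSKernel (circKernel α ξ h),
      circMass θ h ≤ N ∧ N ^ 2 ≤ circMass θ h ^ 2 + circExcess θ h ∧
      ‖((h * (1 - circMult ξ h))⁻¹ : ℝ) • hk.op‖ = (h * (1 - circMult (Real.cos θ) h))⁻¹ * N := by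
  have hθ' : θ ∈ Ioc 0 (Real.pi / 2) := ⟨hθ.1, hθ.2.le⟩
  have hq := circMult_pos (Real.cos θ) h
  have hq1 := circMult_lt_one hθ hh
  set q := circMult (Real.cos θ) h with hqd
  have hEx : 0 ≤ circExcess θ h := by
    have := hθ.1
    unfold circExcess; positivity
  have hB : 0 ≤ circMass θ h ^ 2 + circExcess θ h := by positivity
  rcases hξ with rfl | rfl
  -- For `ξ = cos θ` the cut is at `-π`; the translation by `π` turns `cos θ · y + sin y` into
  -- `circWeight θ` up to a constant.
  · have hprim : ∀ y s, circPrim (Real.cos θ) s - circPrim (Real.cos θ) y =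
        circWeight θ (s - -Real.pi) - circWeight θ (y - -Real.pi) := fun y s => by
      unfold circPrim circWeight
      rw [sub_neg_eq_add, sub_neg_eq_add, Real.sin_add_pi, Real.sin_add_pi]; ring
    have hb : ∫⁻ y, ∫⁻ s, ‖circKernel (-Real.pi) (Real.cos θ) h y s‖ₑ ^ 2 ≤
        ENNReal.ofReal (circMass θ h ^ 2 + circExcess θ h) := by
      refine le_trans ?_ (lintegral_circMajorant_lift_le (-Real.pi) hθ' hh)
      refine lintegral_mono fun y => lintegral_mono fun s => ?_
      rw [circKernel, circKer, enorm_ofReal_mul_sq (Real.exp_pos _).le (by split_ifs <;> positivity),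
        circMajorant, hprim]
      gcongr ?_ * ?_
      · refine le_of_eq ?_
        rw [← Real.exp_nat_mul]; congr 2; push_cast; ring
      · by_cases hs : circLift (-Real.pi) s < circLift (-Real.pi) y
        · rw [if_pos hs, if_pos (by linarith)]; simp
        · rw [if_neg hs]
          split_ifs
          · rw [ENNReal.ofReal_le_one]; exact pow_le_one₀ hq.le hq1.le
          · exact le_rfl
    have hk : HSKernel (circKernel (-Real.pi) (Real.cos θ) h) :=
      ⟨measurable_circKernel _ _ _, hb.trans_lt ENNReal.ofReal_lt_top⟩
    refine ⟨-Real.pi, ‖hk.op‖, hk, ?_, hk.norm_op_sq_le hB hb, ?_⟩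
    · rw [← one_mul (circMass θ h)]
      refine le_norm_op_circ (-Real.pi) hk zero_le_one 1 (Or.inl rfl) fun y s => ?_
      rw [circKernel, circKer, hprim, one_mul, one_mul, mul_comm]
      refine mul_le_mul_of_nonneg_left ?_ (Real.exp_pos _).le
      split_ifs
      · exact hq1.le
      · exact le_rfl
    · rw [norm_smul, Real.norm_of_nonneg (inv_nonneg.2 (mul_nonneg hh.le (by linarith)))]
  -- For `ξ = -cos θ` the cut is at `0` and the primitive is `-circWeight θ`, so `y` and `s` change
  -- roles. The multiplier becomes `q⁻¹`, and the kernel is normalised by the factor `q`.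
  · have hprim : ∀ y s, circPrim (-Real.cos θ) s - circPrim (-Real.cos θ) y =
        circWeight θ (y - 0) - circWeight θ (s - 0) := fun y s => by
      unfold circPrim circWeight
      rw [sub_zero, sub_zero]; ring
    have hmul : circMult (-Real.cos θ) h = q⁻¹ := by
      rw [hqd]; unfold circMult
      rw [← Real.exp_neg]; congr 1; ring
    have hb : ∫⁻ y, ∫⁻ s, ‖circKernel 0 (-Real.cos θ) h y s‖ₑ ^ 2 ≤
        ENNReal.ofReal (q⁻¹ ^ 2 * (circMass θ h ^ 2 + circExcess θ h)) := by
      have hmm := measurable_circMajorant_comp ((measurable_circLift 0).sub_const 0) θ h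
      calc _ ≤ ∫⁻ y, ∫⁻ s, ENNReal.ofReal (q⁻¹ ^ 2) *
            circMajorant θ h (circLift 0 s - 0) (circLift 0 y - 0) := by
            refine lintegral_mono fun y => lintegral_mono fun s => ?_
            rw [circKernel, circKer, enorm_ofReal_mul_sq (Real.exp_pos _).le (by
              have := circMult_pos (-Real.cos θ) h
              split_ifs <;> positivity), circMajorant, hprim, ← mul_assoc,
              mul_comm (ENNReal.ofReal (q⁻¹ ^ 2)), mul_assoc, hmul]
            gcongr ?_ * ?_
            · refine le_of_eq ?_
              rw [← Real.exp_nat_mul]; congr 2; push_cast; ring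
            · by_cases hs : circLift 0 s < circLift 0 y
              · rw [if_pos hs, if_neg (by linarith), ← ENNReal.ofReal_mul (by positivity),
                  ← mul_pow, inv_mul_cancel₀ hq.ne']
              · rw [if_neg hs, if_pos (by linarith), mul_one]
        _ = ENNReal.ofReal (q⁻¹ ^ 2) * ∫⁻ s, ∫⁻ y,
            circMajorant θ h (circLift 0 s - 0) (circLift 0 y - 0) :=
            lintegral_const_mul_swap hmm _
        _ ≤ _ := by
            rw [ENNReal.ofReal_mul (by positivity)]
            gcongr
            exact lintegral_circMajorant_lift_le 0 hθ' hh
    have hk : HSKernel (circKernel 0 (-Real.cos θ) h) :=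
      ⟨measurable_circKernel _ _ _, hb.trans_lt ENNReal.ofReal_lt_top⟩
    refine ⟨0, q * ‖hk.op‖, hk, ?_, ?_, ?_⟩
    · rw [← div_le_iff₀' hq, div_eq_inv_mul]
      refine le_norm_op_circ 0 hk (inv_nonneg.2 hq.le) (-1) (Or.inr rfl) fun y s => ?_
      rw [circKernel, circKer, hprim, inv_mul_cancel₀ hq.ne', one_mul, hmul,
        show -1 * (circWeight θ (circLift 0 s - 0) - circWeight θ (circLift 0 y - 0)) =
          circWeight θ (circLift 0 y - 0) - circWeight θ (circLift 0 s - 0) by ring]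
      refine le_mul_of_one_le_right (Real.exp_pos _).le ?_
      split_ifs
      · exact le_rfl
      · exact (one_le_inv₀ hq).2 hq1.le
    · have := hk.norm_op_sq_le (by positivity) hb
      rw [mul_pow]
      calc q ^ 2 * ‖hk.op‖ ^ 2 ≤ q ^ 2 * (q⁻¹ ^ 2 * (circMass θ h ^ 2 + circExcess θ h)) := by gcongr
        _ = _ := by field_simp
    · rw [norm_smul, hmul, Real.norm_eq_abs, abs_inv, abs_mul, abs_of_pos hh]
      have h1 : 1 < q⁻¹ := (one_lt_inv₀ hq).2 hq1
      rw [abs_of_neg (by linarith), show -(1 - q⁻¹) = q⁻¹ * (1 - q) by field_simp; ring]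
      have : 1 - q ≠ 0 := by linarith
      field_simp

/-- The smallest singular value on the circle, for `ξ ≠ 0`. -/
theorem exists_singularValue_circ {θ h : ℝ} (hθ : θ ∈ Ioo 0 (Real.pi / 2)) (hh : 0 < h) {ξ : ℝ}
    (hξ : ξ = Real.cos θ ∨ ξ = -Real.cos θ) :
    ∃ κ : ℝ, IsReducedNorm 128 θ (Real.sqrt (h / θ ^ 3)) κ ∧
      ∀ m : ℝ, |m| = Real.sqrt h * (Real.sqrt θ / κ) * ((1 - circMult (Real.cos θ) h) *
        Real.exp (-(2 * (Real.sin θ - θ * Real.cos θ) / h))) →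
      IsLeast (singularValues (circP h ξ)) |m| ∧
        ∃ ePlus eMinus, IsSingularTriple (circP h ξ) m ePlus eMinus := by
  obtain ⟨α, N, hk, h1, h2, h3⟩ := exists_circNorm hθ hh hξ
  have hθ0 := hθ.1
  have hq1 := circMult_lt_one hθ hh
  have hq0 := circMult_pos (Real.cos θ) h
  have hN : 0 < N := (circMass_pos θ h).trans_le h1
  have hred := isReducedNorm_circ ⟨hθ.1, hθ.2.le⟩ hh h1 h2
  refine ⟨_, hred, fun m hm => ?_⟩
  have hne : circMult ξ h ≠ 1 := by
    rcases hξ with rfl | rfl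
    · exact hq1.ne
    · intro h0
      have : circMult (Real.cos θ) h * circMult (-Real.cos θ) h = 1 := by
        unfold circMult; rw [← Real.exp_add, ← Real.exp_zero]; congr 1; ring
      rw [h0, mul_one] at this
      exact hq1.ne this
  have hpos : 0 < 1 - circMult (Real.cos θ) h := by linarith
  refine isLeast_singularValues (K := ((h * (1 - circMult ξ h))⁻¹ : ℝ) • hk.op) ?_ ?_
    (circP_iff hh.ne' hne hk) ?_
  · exact hk.isCompactOperator.smul ((h * (1 - circMult ξ h))⁻¹)
  · rw [← norm_pos_iff, h3]; positivity
  · rw [h3, hm]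
    have e3 : Real.sqrt (h / θ ^ 3) * θ * Real.sqrt θ = Real.sqrt h := by
      have hsx : 0 < Real.sqrt θ := by positivity
      rw [Real.sqrt_div hh.le, show θ ^ 3 = θ ^ 2 * θ by ring,
        Real.sqrt_mul (by positivity), Real.sqrt_sq hθ0.le]
      field_simp
    have e4 : Real.sqrt h * Real.sqrt h = h := Real.mul_self_sqrt hh.le
    rw [Real.exp_neg]
    have hE := Real.exp_pos (2 * (Real.sin θ - θ * Real.cos θ) / h)
    set E := Real.exp (2 * (Real.sin θ - θ * Real.cos θ) / h)
    have hε : 0 < Real.sqrt (h / θ ^ 3) := by positivity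
    set s := Real.sqrt (h / θ ^ 3)
    set p := 1 - circMult (Real.cos θ) h
    field_simp
    calc _ = Real.sqrt h * (s * θ * Real.sqrt θ) := by ring
      _ = h := by rw [e3, e4]

/-! ## Lithner-Agmon distances -/

theorem abs_intervalIntegral_symm (f : ℝ → ℝ) (a b : ℝ) :
    |∫ y in a..b, f y| = |∫ y in b..a, f y| := by
  rw [intervalIntegral.integral_symm, abs_neg]

section Agmon
variable {w : ℝ → ℝ}

/-- The change of variables formula along a `C¹` curve requires no monotonicity: backtracking
cancels on the left and only adds length on the right. -/
theorem abs_integral_le_length (hw : Continuous w) {γ : ℝ → ℝ} (hγ : ContDiff ℝ 1 γ) :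
    |(∫ y in (γ 0)..(γ 1), |w y|)| ≤ ∫ t in (0 : ℝ)..1, |w (γ t)| * |deriv γ t| := by
  have hγ' : Continuous (deriv γ) := hγ.continuous_deriv le_rfl
  have h1 : ∫ t in (0 : ℝ)..1, ((fun y => |w y|) ∘ γ) t * deriv γ t = ∫ y in (γ 0)..(γ 1), |w y| :=
    intervalIntegral.integral_comp_mul_deriv
      (fun t _ => (hγ.differentiable one_ne_zero t).hasDerivAt) hγ'.continuousOn (by fun_prop)
  rw [← h1]
  refine (intervalIntegral.abs_integral_le_integral_abs zero_le_one).trans (le_of_eq ?_)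
  congr 1; ext t
  simp [abs_mul]

theorem length_segment (hw : Continuous w) (a b : ℝ) :
    ∫ t in (0 : ℝ)..1, |w (a + t * (b - a))| * |deriv (fun t => a + t * (b - a)) t| =
      |(∫ y in a..b, |w y|)| := by
  have hd : ∀ t : ℝ, deriv (fun t => a + t * (b - a)) t = b - a := fun t => by simp
  simp_rw [hd]
  have h1 : ∫ t in (0 : ℝ)..1, |w (a + t * (b - a))| * (b - a) = ∫ y in a..b, |w y| := by
    have := intervalIntegral.integral_comp_mul_deriv (a := 0) (b := 1)
      (f := fun t => a + t * (b - a)) (f' := fun _ => b - a) (g := fun y => |w y|)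
      (fun t _ => by simpa using ((hasDerivAt_id t).mul_const (b - a)).const_add a)
      continuousOn_const (by fun_prop)
    simpa using this
  rw [← h1, intervalIntegral.integral_mul_const, intervalIntegral.integral_mul_const, abs_mul,
    abs_of_nonneg (intervalIntegral.integral_nonneg zero_le_one fun t _ => abs_nonneg _)]

theorem agmonDist_id (hw : Continuous w) {J : Set ℝ} (hJ : J.OrdConnected) {a b : ℝ} (ha : a ∈ J)
    (hb : b ∈ J) : agmonDist id J w a b = |(∫ y in a..b, |w y|)| := by
  refine IsLeast.csInf_eq ⟨⟨fun t => a + t * (b - a), by fun_prop, fun t ht => ?_, by simp, by simp,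
    (length_segment hw a b).symm⟩, ?_⟩
  · refine hJ.uIcc_subset ha hb ?_
    rcases le_total a b with h | h
    · rw [uIcc_of_le h]; constructor <;> nlinarith [ht.1, ht.2]
    · rw [uIcc_of_ge h]; constructor <;> nlinarith [ht.1, ht.2]
  · rintro L ⟨γ, hγ, -, h0, h1, rfl⟩
    have := abs_integral_le_length hw hγ
    rwa [show γ 0 = a from h0, show γ 1 = b from h1] at this

/-- A lifted curve ends, after a translation, at some `b + 2πn`. As `b - 2π ≤ a ≤ b`, the cheapest
targets are `n = 0` and `n = -1`. -/
theorem agmonDist_circ (hw : Continuous w) (hp : Function.Periodic w (2 * Real.pi)) {a b : ℝ}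
    (h1 : b - 2 * Real.pi ≤ a) (h2 : a ≤ b) :
    agmonDist circCover univ w (circCover a) (circCover b) =
      min (∫ y in a..b, |w y|) (∫ y in (b - 2 * Real.pi)..a, |w y|) := by
  have hpi := Real.pi_pos
  have hcov : ∀ {y z : ℝ}, circCover y = circCover z → ∃ n : ℤ, y = z + n * (2 * Real.pi) :=
    fun {y z} h => by
      have h' : ((y - z : ℝ) : Circ) = 0 := by
        rw [AddCircle.coe_sub]; exact sub_eq_zero.2 h
      obtain ⟨n, hn⟩ := (AddCircle.coe_eq_zero_iff _).1 h'
      rw [zsmul_eq_mul] at hn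
      exact ⟨n, by linarith⟩
  have hci : ∀ a b : ℝ, IntervalIntegrable (fun y => |w y|) volume a b := fun a b =>
    (hw.abs).intervalIntegrable a b
  have hpa : Function.Periodic (fun y => |w y|) (2 * Real.pi) := fun y => by simp only [hp y]
  have hmono : ∀ {p q r s : ℝ}, p ≤ q → q ≤ r → r ≤ s →
      ∫ y in q..r, |w y| ≤ ∫ y in p..s, |w y| := fun {p q r s} hpq hqr hrs =>
    intervalIntegral.integral_mono_interval hpq hqr hrs (.of_forall fun y => abs_nonneg _) (hci _ _)
  have key : ∀ n : ℤ, min (∫ y in a..b, |w y|) (∫ y in (b - 2 * Real.pi)..a, |w y|) ≤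
      |(∫ y in a..(b + n * (2 * Real.pi)), |w y|)| := by
    intro n
    rcases le_or_gt 0 n with hn | hn
    · have hn' : (0 : ℝ) ≤ n := by exact_mod_cast hn
      refine (min_le_left _ _).trans ((hmono le_rfl h2 ?_).trans (le_abs_self _))
      have := mul_nonneg hn' Real.two_pi_pos.le
      linarith
    · have hn' : (n : ℝ) ≤ -1 := by exact_mod_cast Int.le_sub_one_of_lt hn
      rw [abs_intervalIntegral_symm]
      refine (min_le_right _ _).trans ((hmono ?_ h1 le_rfl).trans (le_abs_self _))
      nlinarith
  have hnn : ∀ {p q : ℝ}, p ≤ q → 0 ≤ ∫ y in p..q, |w y| := fun h =>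
    intervalIntegral.integral_nonneg h fun y _ => abs_nonneg _
  have hb' : circCover (b - 2 * Real.pi) = circCover b := by
    rw [← circCover_add, sub_add_cancel]
  refine IsLeast.csInf_eq ⟨?_, ?_⟩
  · rcases min_choice (∫ y in a..b, |w y|) (∫ y in (b - 2 * Real.pi)..a, |w y|) with h | h
    · rw [h]
      refine ⟨fun t => a + t * (b - a), by fun_prop, fun t _ => mem_univ _, by simp, by simp, ?_⟩
      rw [length_segment hw a b, abs_of_nonneg (hnn h2)]
    · rw [h]
      refine ⟨fun t => a + t * (b - 2 * Real.pi - a), by fun_prop, fun t _ => mem_univ _, by simp,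
        by simp [hb'], ?_⟩
      rw [length_segment hw a (b - 2 * Real.pi), abs_intervalIntegral_symm,
        abs_of_nonneg (hnn h1)]
  · rintro L ⟨γ, hγ, -, h0, h1', rfl⟩
    refine le_trans ?_ (abs_integral_le_length hw hγ)
    obtain ⟨k, hk⟩ := hcov h0
    obtain ⟨l, hl⟩ := hcov h1'
    have e : ∫ y in (γ 0)..(γ 1), |w y| = ∫ y in a..(b + ((l - k : ℤ) : ℝ) * (2 * Real.pi)), |w y| := by
      have h3 := intervalIntegral.integral_comp_add_right (a := a)
        (b := b + ((l - k : ℤ) : ℝ) * (2 * Real.pi)) (fun y => |w y|) (k * (2 * Real.pi))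
      have h4 : ∀ y, |w (y + k * (2 * Real.pi))| = |w y| := fun y => (hpa.int_mul k) y
      simp_rw [h4] at h3
      rw [h3, hk, hl]
      congr 1; push_cast; ring
    rw [e]
    exact key _

end Agmon

/-! ## Amplitudes -/

theorem poisson_symb {φ : ℝ → ℝ} {ξ y φ₂ : ℝ} (h : HasDerivAt (deriv φ) φ₂ y) :
    poisson (symb φ ξ) (fun y η => conj (symb φ ξ y η)) y 0 = 2 * Complex.I * φ₂ := by
  have hd : HasDerivAt (fun s => (drift φ ξ s : ℂ)) (φ₂ : ℂ) y := (h.const_add ξ).ofReal_comp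
  have hc : ∀ y η, conj (symb φ ξ y η) = -(Complex.I * (η : ℂ)) + (drift φ ξ y : ℂ) := fun y η => by
    simp [symb]
  have h1 : deriv (fun s => symb φ ξ y s) 0 = Complex.I := by
    have := (((hasDerivAt_id (0 : ℝ)).ofReal_comp).const_mul Complex.I).add_const (drift φ ξ y : ℂ)
    simpa [symb] using this.deriv
  have h2 : deriv (fun s => symb φ ξ s 0) y = φ₂ := (hd.const_add _).deriv
  have h3 : deriv (fun s => conj (symb φ ξ y s)) 0 = -Complex.I := by
    simp_rw [hc]
    have := ((((hasDerivAt_id (0 : ℝ)).ofReal_comp).const_mul Complex.I).neg).add_const (drift φ ξ y : ℂ)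
    simpa using this.deriv
  have h4 : deriv (fun s => conj (symb φ ξ s 0)) y = φ₂ := by
    simp_rw [hc]; exact (hd.const_add _).deriv
  rw [poisson, h1, h2, h3, h4]; ring

/-- The bracket at a critical point is `2 i φ''`, and both critical points have the same `|φ''|`, so
the two fourth roots combine into a square root. -/
theorem amp_eq {φ : ℝ → ℝ} {ξ yp ym a : ℝ} (ha : 0 ≤ a) (hp : HasDerivAt (deriv φ) a yp)
    (hm : HasDerivAt (deriv φ) (-a) ym) : amp φ ξ yp ym = Real.sqrt (a / Real.pi) := by
  have hn : ∀ b : ℝ, |b| = a → ‖2 * Complex.I * (b : ℂ)‖ / (2 * Real.pi) = a / Real.pi := fun b hb => by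
    rw [norm_mul, norm_mul, Complex.norm_I, Complex.norm_real, Real.norm_eq_abs, hb]
    have := Real.pi_pos
    simp; field_simp
  have h0 : 0 ≤ a / Real.pi := div_nonneg ha Real.pi_pos.le
  rw [amp, poisson_symb hp, poisson_symb hm, hn a (abs_of_nonneg ha),
    hn (-a) (by rw [abs_neg, abs_of_nonneg ha]), ← Real.rpow_add_of_nonneg h0 (by norm_num) (by norm_num),
    Real.sqrt_eq_rpow]
  norm_num

/-! ## The line -/

theorem deriv_linePhi : deriv linePhi = fun y => y ^ 2 := by
  funext y
  have := drift_linePhi 0 y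
  simpa [drift] using this

theorem hasDerivAt_deriv_linePhi (y : ℝ) : HasDerivAt (deriv linePhi) (2 * y) y := by
  rw [deriv_linePhi]
  simpa using hasDerivAt_pow 2 y

theorem IsCritPair.line {x yp ym : ℝ} (hx : 0 < x) (h : IsCritPair linePhi (-x ^ 2) yp ym) :
    yp = x ∧ ym = -x := by
  obtain ⟨h1, h2, h3, h4⟩ := h
  rw [(hasDerivAt_deriv_linePhi yp).deriv] at h2
  rw [(hasDerivAt_deriv_linePhi ym).deriv] at h4
  rw [deriv_linePhi, neg_neg] at h1 h3
  simp only at h1 h3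
  constructor
  · rcases sq_eq_sq_iff_eq_or_eq_neg.1 h1 with h | h <;> linarith
  · rcases sq_eq_sq_iff_eq_or_eq_neg.1 h3 with h | h <;> linarith

theorem amp_line {x : ℝ} (hx : 0 < x) :
    amp linePhi (-x ^ 2) x (-x) = Real.sqrt 2 * Real.sqrt x / Real.sqrt Real.pi := by
  rw [amp_eq (a := 2 * x) (by positivity) (hasDerivAt_deriv_linePhi x)
    (by simpa using hasDerivAt_deriv_linePhi (-x)), Real.sqrt_div (by positivity),
    Real.sqrt_mul (by norm_num)]

theorem integral_abs_of_sign {w W : ℝ → ℝ} (hW : ∀ y, HasDerivAt W (w y) y) (hw : Continuous w)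
    {a b σ : ℝ} (hab : a ≤ b) (h : ∀ y ∈ Icc a b, |w y| = σ * w y) :
    ∫ y in a..b, |w y| = σ * (W b - W a) := by
  rw [← intervalIntegral.integral_eq_sub_of_hasDerivAt (fun y _ => hW y) (hw.intervalIntegrable _ _),
    ← intervalIntegral.integral_const_mul]
  refine intervalIntegral.integral_congr fun y hy => ?_
  rw [uIcc_of_le hab] at hy
  exact h y hy

theorem lineS0_eq {x : ℝ} (hx : 0 < x) : lineS0 (-x ^ 2) x (-x) = 4 * x ^ 3 / 3 := by
  have hwc : Continuous (drift linePhi (-x ^ 2)) := by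
    have : drift linePhi (-x ^ 2) = fun y => -x ^ 2 + y ^ 2 := funext (drift_linePhi _)
    rw [this]; fun_prop
  have hi : ∫ y in (-x)..x, |drift linePhi (-x ^ 2) y| = 4 * x ^ 3 / 3 := by
    rw [integral_abs_of_sign (hasDerivAt_lineWeight x) hwc (σ := -1) (by linarith) fun y hy => ?_]
    · unfold lineWeight; ring
    · rw [drift_linePhi, abs_of_nonpos]
      · ring
      · nlinarith [hy.1, hy.2]
  rw [lineS0, agmonDist_id hwc ordConnected_univ (mem_univ _) (mem_univ _),
    intervalIntegral.integral_symm, abs_neg, hi, abs_of_pos (by positivity)]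

/-! ## The circle -/

theorem deriv_circPhi : deriv circPhi = Real.cos := by
  have hs : circPhi = Real.sin := rfl
  rw [hs, Real.deriv_sin]

theorem hasDerivAt_deriv_circPhi (y : ℝ) : HasDerivAt (deriv circPhi) (-Real.sin y) y := by
  rw [deriv_circPhi]; exact Real.hasDerivAt_cos y

theorem IsCritPair.circ {ϑ yp ym : ℝ} (hϑ : ϑ ∈ Icc 0 Real.pi)
    (h : IsCritPair circPhi (-Real.cos ϑ) yp ym) (hp : yp ∈ Ioo (-Real.pi) 0)
    (hm : ym ∈ Ioo 0 Real.pi) : yp = -ϑ ∧ ym = ϑ := by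
  obtain ⟨h1, -, h3, -⟩ := h
  rw [deriv_circPhi, neg_neg] at h1 h3
  constructor
  · rw [← Real.cos_neg] at h1
    have := Real.injOn_cos ⟨by linarith [hp.2], by linarith [hp.1]⟩ hϑ h1
    linarith
  · exact Real.injOn_cos ⟨hm.1.le, hm.2.le⟩ hϑ h3

theorem amp_circ {ξ ϑ : ℝ} (hϑ : ϑ ∈ Icc 0 Real.pi) :
    amp circPhi ξ (-ϑ) ϑ = Real.sqrt (Real.sin ϑ / Real.pi) :=
  amp_eq (Real.sin_nonneg_of_mem_Icc hϑ) (by simpa using hasDerivAt_deriv_circPhi (-ϑ))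
    (hasDerivAt_deriv_circPhi ϑ)

theorem continuous_drift_circPhi (ξ : ℝ) : Continuous (drift circPhi ξ) := by
  have : drift circPhi ξ = fun y => ξ + Real.cos y := funext (drift_circPhi ξ)
  rw [this]; fun_prop

theorem integral_abs_drift_right {ϑ : ℝ} (hϑ : ϑ ∈ Icc 0 Real.pi) :
    ∫ y in (-ϑ)..ϑ, |drift circPhi (-Real.cos ϑ) y| = 2 * Real.sin ϑ - 2 * ϑ * Real.cos ϑ := by
  rw [integral_abs_of_sign (hasDerivAt_circPrim _) (continuous_drift_circPhi _) (σ := 1)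
    (by linarith [hϑ.1]) fun y hy => ?_]
  · unfold circPrim; rw [Real.sin_neg]; ring
  · rw [drift_circPhi, abs_of_nonneg, one_mul]
    have : Real.cos ϑ ≤ Real.cos |y| :=
      Real.cos_le_cos_of_nonneg_of_le_pi (abs_nonneg y) hϑ.2 (abs_le.2 hy)
    rw [Real.cos_abs] at this
    linarith

theorem integral_abs_drift_left {ϑ : ℝ} (hϑ : ϑ ∈ Icc 0 Real.pi) :
    ∫ y in (ϑ - 2 * Real.pi)..(-ϑ), |drift circPhi (-Real.cos ϑ) y| =
      2 * Real.sin ϑ - 2 * ϑ * Real.cos ϑ + 2 * Real.pi * Real.cos ϑ := by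
  rw [integral_abs_of_sign (hasDerivAt_circPrim _) (continuous_drift_circPhi _) (σ := -1)
    (by linarith [hϑ.2]) fun y hy => ?_]
  · unfold circPrim; rw [Real.sin_neg, Real.sin_sub_two_pi]; ring
  · rw [drift_circPhi, abs_of_nonpos]
    · ring
    · have h1 : Real.cos |y + Real.pi| ≥ Real.cos (Real.pi - ϑ) := by
        refine Real.cos_le_cos_of_nonneg_of_le_pi (abs_nonneg _) (by linarith [hϑ.1]) (abs_le.2 ?_)
        constructor <;> linarith [hy.1, hy.2]
      rw [Real.cos_abs, Real.cos_add_pi, Real.cos_pi_sub] at h1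
      linarith

theorem circDJ_eq {ϑ : ℝ} (hϑ : ϑ ∈ Icc 0 Real.pi) :
    circDJ (-Real.cos ϑ) ϑ (-ϑ) ϑ = 2 * Real.sin ϑ - 2 * ϑ * Real.cos ϑ ∧
    circDJ (-Real.cos ϑ) ϑ (-ϑ) (ϑ - 2 * Real.pi) =
      2 * Real.sin ϑ - 2 * ϑ * Real.cos ϑ + 2 * Real.pi * Real.cos ϑ := by
  have hpi := Real.pi_pos
  have hm : -ϑ ∈ Icc (ϑ - 2 * Real.pi) ϑ := ⟨by linarith [hϑ.2], by linarith [hϑ.1]⟩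
  have hnn : ∀ {p q : ℝ}, p ≤ q → 0 ≤ ∫ y in p..q, |drift circPhi (-Real.cos ϑ) y| := fun h =>
    intervalIntegral.integral_nonneg h fun y _ => abs_nonneg _
  constructor
  · rw [circDJ, agmonDist_id (continuous_drift_circPhi _) ordConnected_Icc hm ⟨by linarith, le_rfl⟩,
      abs_of_nonneg (hnn hm.2), integral_abs_drift_right hϑ]
  · rw [circDJ, agmonDist_id (continuous_drift_circPhi _) ordConnected_Icc hm ⟨le_rfl, by linarith⟩,
      intervalIntegral.integral_symm, abs_neg, abs_of_nonneg (hnn hm.1), integral_abs_drift_left hϑ]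

/-- The arcs between the critical points have lengths differing by `2π cos ϑ`; the sign of this
difference decides which is the shorter. -/
theorem circS0_eq {ϑ : ℝ} (hϑ : ϑ ∈ Icc 0 Real.pi) :
    circS0 (-Real.cos ϑ) (-ϑ) ϑ = 2 * Real.sin ϑ - 2 * ϑ * Real.cos ϑ +
      min 0 (2 * Real.pi * Real.cos ϑ) := by
  rw [circS0, agmonDist_circ (continuous_drift_circPhi _) (circDrift_periodic _)
    (by linarith [hϑ.2]) (by linarith [hϑ.1]), integral_abs_drift_right hϑ, integral_abs_drift_left hϑ,
    ← min_add_add_left, add_zero]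

/-! ## Scaled expansions -/

theorem IsReducedNorm.pos {K ε κ : ℝ} {θ : Angle} (hε : 0 < ε) (h : IsReducedNorm K θ ε κ) : 0 < κ :=
  (modelInt_pos θ hε).trans_le h.1

/-- The coefficients of `s / κ` in powers of `h`, for a reduced norm `κ` at `ε ^ 2 = h / ρ`. -/
noncomputable def scaledCoeff (θ s ρ : ℝ) (j : ℕ) : ℝ := s * invCoeff (modelCoeff θ) j * (ρ⁻¹) ^ j

/-- The amplitude `s` and the scale `ρ` enter only by homogeneity, so the constant depends on
neither. This independence gives the exact powers of `|ξ|` and `δ` in (2) and (3). -/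
theorem scaled_expansion (K : ℝ) {H : ℝ} (hH : 0 < H) (N : ℕ) : ∃ C, 0 ≤ C ∧
    ∀ θ : Angle, ∀ ρ > 0, ∀ h > 0, h / ρ ≤ H → ∀ κ, IsReducedNorm K θ (Real.sqrt (h / ρ)) κ →
      ∀ s ≥ 0, |s / κ - ∑ j ∈ Finset.range N, scaledCoeff θ s ρ j * h ^ j| ≤ C * (s * (h / ρ) ^ N) := by
  obtain ⟨C, hC, hexp⟩ := reducedNorm_inv_expansion K hH N
  refine ⟨C, hC, fun θ ρ hρ h hh hle κ hκ s hs => ?_⟩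
  have hsq : Real.sqrt (h / ρ) ^ 2 = h / ρ := Real.sq_sqrt (by positivity)
  have h1 := (hexp θ _ (by positivity) (by rwa [hsq]) κ hκ).2
  rw [hsq] at h1
  have e : s / κ - ∑ j ∈ Finset.range N, scaledCoeff θ s ρ j * h ^ j =
      s * (κ⁻¹ - ∑ j ∈ Finset.range N, invCoeff (modelCoeff θ) j * (h / ρ) ^ j) := by
    rw [mul_sub, Finset.mul_sum, div_eq_mul_inv]
    congr 1
    refine Finset.sum_congr rfl fun j _ => ?_
    rw [scaledCoeff, div_eq_mul_inv h, mul_pow]; ring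
  rw [e, abs_mul, abs_of_nonneg hs]
  calc _ ≤ s * (C * (h / ρ) ^ N) := by gcongr
    _ = _ := by ring

theorem hasExpansion_of_isReducedNorm {K : ℝ} {Q : Set ℝ} {θ : ℝ → Angle} {s ρ : ℝ → ℝ}
    {κ : ℝ → ℝ → ℝ} (hs : ∀ ξ ∈ Q, 0 ≤ s ξ) (hρ : ∀ ξ ∈ Q, 0 < ρ ξ) {B₁ B₂ : ℝ}
    (hs' : ∀ ξ ∈ Q, s ξ ≤ B₁) (hρ' : ∀ ξ ∈ Q, (ρ ξ)⁻¹ ≤ B₂)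
    (hκ : ∀ h > 0, ∀ ξ ∈ Q, IsReducedNorm K (θ ξ) (Real.sqrt (h / ρ ξ)) (κ h ξ)) :
    HasExpansion (fun h ξ => s ξ / κ h ξ) (fun j ξ => scaledCoeff (θ ξ) (s ξ) (ρ ξ) j) Q 1 := by
  intro N
  obtain ⟨C, hC, hexp⟩ := scaled_expansion K (H := |B₂| + 1) (by positivity) N
  refine ⟨C * (|B₁| * |B₂| ^ N), fun h hh ξ hξ => ?_⟩
  have h1 : h / ρ ξ ≤ |B₂| * h := by
    rw [div_eq_inv_mul]
    exact mul_le_mul_of_nonneg_right ((hρ' ξ hξ).trans (le_abs_self _)) hh.1.le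
  have h2 : h / ρ ξ ≤ |B₂| + 1 := by nlinarith [abs_nonneg B₂, hh.2]
  refine (hexp (θ ξ) _ (hρ ξ hξ) h hh.1 h2 _ (hκ h hh.1 ξ hξ) _ (hs ξ hξ)).trans ?_
  have h3 : 0 ≤ h / ρ ξ := div_nonneg hh.1.le (hρ ξ hξ).le
  calc C * (s ξ * (h / ρ ξ) ^ N) ≤ C * (|B₁| * (|B₂| * h) ^ N) := by
        have := hs ξ hξ
        have := (hs' ξ hξ).trans (le_abs_self _)
        gcongr
    _ = _ := by rw [mul_pow]; ring

/-! ### Fractional powers of `|ξ| = x²` and the threshold `h^{2/3}` -/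

theorem sq_rpow_three_halves {x : ℝ} (hx : 0 ≤ x) : (x ^ 2) ^ (3 / 2 : ℝ) = x ^ 3 := by
  rw [← Real.rpow_natCast, ← Real.rpow_mul hx, ← Real.rpow_natCast]; norm_num

theorem sq_rpow_quarter {x : ℝ} (hx : 0 ≤ x) : (x ^ 2) ^ (1 / 4 : ℝ) = Real.sqrt x := by
  rw [← Real.rpow_natCast, ← Real.rpow_mul hx, Real.sqrt_eq_rpow]; norm_num

theorem sq_rpow_neg_five_quarters {x : ℝ} (hx : 0 < x) :
    (x ^ 2) ^ (-(5 / 4) : ℝ) = Real.sqrt x * (x ^ 3)⁻¹ := by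
  rw [Real.sqrt_eq_rpow, ← Real.rpow_natCast x 3, ← Real.rpow_neg hx.le, ← Real.rpow_add hx,
    ← Real.rpow_natCast, ← Real.rpow_mul hx.le]
  norm_num

theorem le_cube_of_rpow_le {c h x : ℝ} (hc : 0 < c) (hh : 0 < h) (hx : 0 < x)
    (hle : c * h ^ (2 / 3 : ℝ) ≤ x ^ 2) : c ^ (3 / 2 : ℝ) * h ≤ x ^ 3 := by
  have h1 := Real.rpow_le_rpow (by positivity) hle (by norm_num : (0 : ℝ) ≤ 3 / 2)
  rw [sq_rpow_three_halves hx.le, Real.mul_rpow hc.le (by positivity), ← Real.rpow_mul hh.le] at h1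
  norm_num at h1
  exact h1

/-! ## The model on the line -/

theorem scaledCoeff_line_zero {x : ℝ} (hx : 0 < x) :
    scaledCoeff 0 (Real.sqrt 2 * Real.sqrt x) (2 * x ^ 3) 0 = amp linePhi (-x ^ 2) x (-x) := by
  rw [amp_line hx, scaledCoeff, invCoeff_zero, modelCoeff_zero, modelCurv_zero_right]
  simp [div_eq_mul_inv]

/-- With `ξ = -x²`, everything is the scaled expansion at `θ = 0`: with `N` arbitrary for (1), and
with `N = 1` for (2), where the two forms correspond to `s = √(2x)` and `s = √π`. -/
theorem line_singular_values :
    (∀ yp ym : ℝ → ℝ, (∀ ξ < 0, IsCritPair linePhi ξ (yp ξ) (ym ξ)) →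
      ∃ (m b : ℝ → ℝ → ℝ) (c : ℕ → ℝ → ℝ),
        (∀ h > 0, ∀ ξ < 0,
          IsLeast (singularValues (lineP h ξ)) |m h ξ| ∧
          ∃ ePlus eMinus : L2 ℝ, IsSingularTriple (lineP h ξ) (m h ξ) ePlus eMinus) ∧
        (∀ ξ < 0, c 0 ξ = amp linePhi ξ (yp ξ) (ym ξ)) ∧
        (∀ K ⊆ Iio (0 : ℝ), IsCompact K → ∃ h₀ > 0,
          HasExpansion b c K h₀ ∧
          ∀ ε > 0, ∃ C : ℝ, ∀ h ∈ Ioc 0 h₀, ∀ ξ ∈ K, ∃ r : ℝ,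
            |r| ≤ C * Real.exp (ε / h - 3 * lineS0 ξ (yp ξ) (ym ξ) / h) ∧
            m h ξ = Real.sqrt h * b h ξ *
              (Real.exp (-lineS0 ξ (yp ξ) (ym ξ) / h) + r)) ∧
        (∀ C₀ > 0, ∃ h₀ > 0, ∃ C : ℝ, ∀ h ∈ Ioc 0 h₀, ∀ ξ : ℝ,
          ((-1 / C₀ ≤ ξ ∧ ξ ≤ -C₀ * h ^ (2 / 3 : ℝ)) ∨ ξ ≤ -C₀) →
          (∃ r : ℝ, |r| ≤ C * (h * |ξ| ^ (-(5 / 4) : ℝ)) ∧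
            m h ξ = Real.sqrt h * (amp linePhi ξ (yp ξ) (ym ξ) + r) *
              Real.exp (-lineS0 ξ (yp ξ) (ym ξ) / h)) ∧
          (∃ r : ℝ, |r| ≤ C * (h * |ξ| ^ (-(3 / 2) : ℝ)) ∧
            m h ξ = Real.sqrt (2 * h) * |ξ| ^ (1 / 4 : ℝ) / Real.sqrt Real.pi * (1 + r) *
              Real.exp (-(4 * |ξ| ^ (3 / 2 : ℝ)) / (3 * h))))) := by
  intro yp ym hcrit
  have hroot : ∀ ξ < 0, ∃ x : ℝ, 0 < x ∧ ξ = -x ^ 2 := fun ξ hξ =>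
    ⟨Real.sqrt (-ξ), Real.sqrt_pos.2 (by linarith), by rw [Real.sq_sqrt (by linarith)]; ring⟩
  have hroot' : ∀ {x : ℝ}, 0 < x → Real.sqrt (- -x ^ 2) = x := fun hx => by
    rw [neg_neg, Real.sqrt_sq hx.le]
  have hneg : ∀ {x : ℝ}, 0 < x → -x ^ 2 < 0 := fun hx => by nlinarith
  have hex : ∀ h ξ : ℝ, ∃ κ : ℝ, 0 < h → ξ < 0 →
      IsReducedNorm 128 0 (Real.sqrt (h / (2 * Real.sqrt (-ξ) ^ 3))) κ ∧
      ∀ m : ℝ, m = Real.sqrt h * (Real.sqrt 2 * Real.sqrt (Real.sqrt (-ξ)) / κ) *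
          Real.exp (-(4 * Real.sqrt (-ξ) ^ 3 / 3 / h)) →
      IsLeast (singularValues (lineP h ξ)) |m| ∧
        ∃ ePlus eMinus, IsSingularTriple (lineP h ξ) m ePlus eMinus := by
    intro h ξ
    by_cases hc : 0 < h ∧ ξ < 0
    · obtain ⟨x, hx, rfl⟩ := hroot ξ hc.2
      obtain ⟨κ, hκ⟩ := exists_singularValue_line hx hc.1
      exact ⟨κ, fun _ _ => by rwa [hroot' hx]⟩
    -- A dummy value outside the range of parameters, so that `κ` is a total function.
    · exact ⟨0, fun h1 h2 => absurd ⟨h1, h2⟩ hc⟩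
  choose κ hκ using hex
  set s : ℝ → ℝ := fun ξ => Real.sqrt 2 * Real.sqrt (Real.sqrt (-ξ)) with hs
  set ρ : ℝ → ℝ := fun ξ => 2 * Real.sqrt (-ξ) ^ 3 with hρ
  have hS0 : ∀ {x : ℝ}, 0 < x → lineS0 (-x ^ 2) (yp (-x ^ 2)) (ym (-x ^ 2)) = 4 * x ^ 3 / 3 ∧
      amp linePhi (-x ^ 2) (yp (-x ^ 2)) (ym (-x ^ 2)) =
        Real.sqrt 2 * Real.sqrt x / Real.sqrt Real.pi := fun {x} hx => by
    obtain ⟨h1, h2⟩ := (hcrit _ (hneg hx)).line hx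
    rw [h1, h2]
    exact ⟨lineS0_eq hx, amp_line hx⟩
  refine ⟨fun h ξ => Real.sqrt h * (s ξ / κ h ξ) * Real.exp (-(4 * Real.sqrt (-ξ) ^ 3 / 3 / h)),
    fun h ξ => s ξ / κ h ξ, fun j ξ => scaledCoeff 0 (s ξ) (ρ ξ) j,
    fun h hh ξ hξ => (hκ h ξ hh hξ).2 _ rfl, ?_, ?_, ?_⟩
  · intro ξ hξ
    obtain ⟨x, hx, rfl⟩ := hroot ξ hξ
    simp only [hs, hρ]
    rw [hroot' hx, scaledCoeff_line_zero hx, amp_line hx, (hS0 hx).2]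
  · intro Q hQ hQc
    obtain ⟨B₁, hB₁⟩ := hQc.exists_bound_of_continuousOn (f := s) (by fun_prop)
    have hρpos : ∀ ξ ∈ Q, 0 < ρ ξ := fun ξ hξ => by
      have : 0 < Real.sqrt (-ξ) := Real.sqrt_pos.2 (by have : ξ < 0 := hQ hξ; linarith)
      simp only [hρ]; positivity
    obtain ⟨B₂, hB₂⟩ := hQc.exists_bound_of_continuousOn (f := fun ξ => (ρ ξ)⁻¹)
      (ContinuousOn.inv₀ (by fun_prop) fun ξ hξ => (hρpos ξ hξ).ne')
    -- The remainder is exactly `0`: `b` was defined as `s/κ` with the true norm, so no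
    -- exponentially small correction is left.
    refine ⟨1, one_pos, ?_, fun ε _ => ⟨0, fun h hh ξ hξ => ⟨0, by simp, ?_⟩⟩⟩
    · exact hasExpansion_of_isReducedNorm (θ := fun _ => ⟨0, zero_mem_angle⟩) (K := 128)
        (fun ξ _ => by simp only [hs]; positivity)
        hρpos (fun ξ hξ => (le_abs_self _).trans (hB₁ ξ hξ)) (fun ξ hξ => (le_abs_self _).trans (hB₂ ξ hξ))
        (fun h hh ξ hξ => (hκ h ξ hh (hQ hξ)).1)
    · obtain ⟨x, hx, rfl⟩ := hroot ξ (hQ hξ)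
      simp only [hs]
      rw [(hS0 hx).1, hroot' hx, add_zero, neg_div]
  · intro C₀ hC₀
    -- Both ranges of `ξ` give `h ≤ C₀^{-3/2} x³`, the second one because `h ≤ 1`. So `ε²` is
    -- bounded, possibly by a large constant.
    obtain ⟨C, hC, hexp⟩ := scaled_expansion 128 (H := (C₀ ^ (3 / 2 : ℝ))⁻¹) (by positivity) 1
    have hpi := Real.pi_pos
    have hmC : 0 ≤ max (C * Real.sqrt 2) (C * Real.sqrt Real.pi) := le_max_of_le_left (by positivity)
    refine ⟨1, one_pos, max (C * Real.sqrt 2) (C * Real.sqrt Real.pi), fun h hh ξ hξ => ?_⟩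
    have hξ0 : ξ < 0 := by
      rcases hξ with h1 | h1
      · have : 0 < C₀ * h ^ (2 / 3 : ℝ) := mul_pos hC₀ (Real.rpow_pos_of_pos hh.1 _)
        have := h1.2
        linarith
      · linarith
    obtain ⟨x, hx, rfl⟩ := hroot ξ hξ0
    have hcube : C₀ ^ (3 / 2 : ℝ) * h ≤ x ^ 3 := by
      rcases hξ with h1 | h1
      · exact le_cube_of_rpow_le hC₀ hh.1 hx (by have := h1.2; linarith)
      · calc C₀ ^ (3 / 2 : ℝ) * h ≤ C₀ ^ (3 / 2 : ℝ) * 1 := by gcongr; exact hh.2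
          _ ≤ (x ^ 2) ^ (3 / 2 : ℝ) := by
            rw [mul_one]; exact Real.rpow_le_rpow hC₀.le (by linarith) (by norm_num)
          _ = _ := sq_rpow_three_halves hx.le
    have hle : h / (2 * x ^ 3) ≤ (C₀ ^ (3 / 2 : ℝ))⁻¹ := by
      have : 0 < C₀ ^ (3 / 2 : ℝ) := by positivity
      rw [div_le_iff₀ (by positivity), inv_mul_eq_div, le_div_iff₀ this]
      nlinarith [pow_pos hx 3]
    have hred := (hκ h _ hh.1 (hneg hx)).1
    rw [hroot' hx] at hred
    have hε : 0 < Real.sqrt (h / (2 * x ^ 3)) := Real.sqrt_pos.2 (div_pos hh.1 (by positivity))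
    have hκpos := IsReducedNorm.pos (θ := ⟨0, zero_mem_angle⟩) hε hred
    have hmain := fun s hs => hexp ⟨0, zero_mem_angle⟩ _ (by positivity) h hh.1 hle _ hred s hs
    have hsc : ∀ s, ∑ j ∈ Finset.range 1, scaledCoeff 0 s (2 * x ^ 3) j * h ^ j =
        s / Real.sqrt Real.pi := fun s => by
      rw [Finset.sum_range_one, scaledCoeff, invCoeff_zero, modelCoeff_zero, modelCurv_zero_right]
      simp [div_eq_mul_inv]
    have habs : |(-x ^ 2)| = x ^ 2 := by rw [abs_neg, abs_of_nonneg (by positivity)]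
    set k := κ h (-x ^ 2) with hk
    have hx3 : 0 < x ^ 3 := by positivity
    rw [(hS0 hx).1, (hS0 hx).2, habs]
    simp only [hs, ← hk]
    rw [hroot' hx]
    constructor
    · refine ⟨Real.sqrt 2 * Real.sqrt x / k - Real.sqrt 2 * Real.sqrt x / Real.sqrt Real.pi, ?_, ?_⟩
      · have h1 := hmain (Real.sqrt 2 * Real.sqrt x) (by positivity)
        rw [hsc] at h1
        refine h1.trans ?_
        rw [sq_rpow_neg_five_quarters hx, pow_one]
        calc C * (Real.sqrt 2 * Real.sqrt x * (h / (2 * x ^ 3))) =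
            C * Real.sqrt 2 * (h * (Real.sqrt x * (x ^ 3)⁻¹)) / 2 := by field_simp
          _ ≤ C * Real.sqrt 2 * (h * (Real.sqrt x * (x ^ 3)⁻¹)) := by
            have : 0 ≤ C * Real.sqrt 2 * (h * (Real.sqrt x * (x ^ 3)⁻¹)) := by
              have := hh.1
              positivity
            linarith
          _ ≤ _ := by
            refine mul_le_mul_of_nonneg_right (le_max_left _ _) ?_
            have := hh.1
            positivity
      · rw [add_sub_cancel, neg_div]
    · refine ⟨Real.sqrt Real.pi / k - 1, ?_, ?_⟩
      · have h1 := hmain (Real.sqrt Real.pi) (by positivity)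
        rw [hsc, div_self (by positivity)] at h1
        refine h1.trans ?_
        rw [Real.rpow_neg (by positivity), sq_rpow_three_halves hx.le, pow_one]
        calc C * (Real.sqrt Real.pi * (h / (2 * x ^ 3))) =
            C * Real.sqrt Real.pi * (h * (x ^ 3)⁻¹) / 2 := by field_simp
          _ ≤ C * Real.sqrt Real.pi * (h * (x ^ 3)⁻¹) := by
            have : 0 ≤ C * Real.sqrt Real.pi * (h * (x ^ 3)⁻¹) := by
              have := hh.1
              positivity
            linarith
          _ ≤ _ := by
            refine mul_le_mul_of_nonneg_right (le_max_right _ _) ?_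
            have := hh.1
            positivity
      · rw [sq_rpow_three_halves hx.le, sq_rpow_quarter hx.le, Real.sqrt_mul (by norm_num)]
        have e1 : -(4 * x ^ 3 / 3 / h) = -(4 * x ^ 3) / (3 * h) := by
          have := hh.1.ne'
          field_simp
        have : 0 < Real.sqrt Real.pi := by positivity
        rw [e1]; field_simp; ring

/-! ## The model on the circle -/

/-- The angle of the critical points is `π - θ` for `σ = 1` and `θ` for `σ = -1`; in both cases the
shorter arc has length `2 (sin θ - θ cos θ)` and the longer one exceeds it by `2π cos θ`. Hence the
difference of the two exponentials is `exp (-S₀/h)` times `1 - q`, with the sign `σ` telling which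
arc is the shorter. The factor `1 - q` is the one in the inverse operator. -/
theorem circ_geometry {ξ σ θ yp ym : ℝ} (hθ : θ ∈ Ioc 0 (Real.pi / 2)) (hσ : σ = 1 ∨ σ = -1)
    (hξ : ξ = σ * Real.cos θ) (h : IsCritPair circPhi ξ yp ym) (hp : yp ∈ Ioo (-Real.pi) 0)
    (hm : ym ∈ Ioo 0 Real.pi) :
    amp circPhi ξ yp ym = Real.sqrt (Real.sin θ / Real.pi) ∧
    circS0 ξ yp ym = 2 * (Real.sin θ - θ * Real.cos θ) ∧
    ∀ h : ℝ, Real.exp (-circDJ ξ ym yp (ym - 2 * Real.pi) / h) - Real.exp (-circDJ ξ ym yp ym / h) =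
      σ * ((1 - circMult (Real.cos θ) h) *
        Real.exp (-(2 * (Real.sin θ - θ * Real.cos θ) / h))) := by
  have hpi := Real.pi_pos
  have hcos : 0 ≤ Real.cos θ := Real.cos_nonneg_of_mem_Icc ⟨by linarith [hθ.1], hθ.2⟩
  have hq : ∀ h : ℝ, circMult (Real.cos θ) h * Real.exp (-(2 * (Real.sin θ - θ * Real.cos θ) / h)) =
      Real.exp (-(2 * (Real.sin θ - θ * Real.cos θ) + 2 * Real.pi * Real.cos θ) / h) := fun h => by
    unfold circMult; rw [← Real.exp_add]; congr 1; ring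
  rcases hσ with rfl | rfl
  · have hϑ : Real.pi - θ ∈ Icc 0 Real.pi := ⟨by linarith [hθ.2], by linarith [hθ.1]⟩
    have hξ' : ξ = -Real.cos (Real.pi - θ) := by rw [Real.cos_pi_sub, hξ]; ring
    subst hξ'
    obtain ⟨rfl, rfl⟩ := h.circ hϑ hp hm
    obtain ⟨d1, d2⟩ := circDJ_eq hϑ
    rw [amp_circ hϑ, circS0_eq hϑ, d1, d2, Real.sin_pi_sub, Real.cos_pi_sub]
    refine ⟨rfl, ?_, fun h => ?_⟩
    · rw [min_eq_right (by nlinarith)]; ring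
    · rw [one_mul, sub_mul, one_mul, hq h]
      refine congrArg₂ (· - ·) (congrArg Real.exp ?_) (congrArg Real.exp ?_) <;> ring
  · have hϑ : θ ∈ Icc 0 Real.pi := ⟨hθ.1.le, by linarith [hθ.2]⟩
    have hξ' : ξ = -Real.cos θ := by rw [hξ]; ring
    subst hξ'
    obtain ⟨rfl, rfl⟩ := h.circ hϑ hp hm
    obtain ⟨d1, d2⟩ := circDJ_eq hϑ
    rw [amp_circ hϑ, circS0_eq hϑ, d1, d2]
    refine ⟨rfl, ?_, fun h => ?_⟩
    · rw [min_eq_left (by positivity)]; ring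
    · rw [sub_mul, one_mul, hq h, neg_one_mul, neg_sub (Real.exp _)]
      refine congrArg₂ (· - ·) (congrArg Real.exp ?_) (congrArg Real.exp ?_) <;> ring

theorem mul_inv_modelCoeff_zero {θ : ℝ} (hθ : 0 < θ) :
    Real.sqrt θ * (modelCoeff θ 0)⁻¹ = Real.sqrt (Real.sin θ / Real.pi) := by
  rw [modelCoeff_zero, modelCurv_zero_right, if_neg hθ.ne', ← Real.sqrt_inv, ← Real.sqrt_mul hθ.le]
  congr 1; field_simp

/-- Here `cos θ ≥ 1 - 1/C₀ > 0`, so `q` is exponentially small and in particular `O(h)`. As `δ ≤ 1`,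
this is absorbed in `O(h δ^{-5/4})`. The expansion error `h θ^{-5/2}` is of that order because `δ ≤
θ²`. -/
theorem circ_amplitude_near_top {C₀ : ℝ} (hC₀ : 1 < C₀) : ∃ C : ℝ, ∀ h ∈ Ioc (0 : ℝ) 1,
    ∀ θ ∈ Ioo 0 (Real.pi / 2), C₀ * h ^ (2 / 3 : ℝ) ≤ 1 - Real.cos θ → 1 - Real.cos θ ≤ 1 / C₀ →
    ∀ κ, IsReducedNorm 128 θ (Real.sqrt (h / θ ^ 3)) κ →
      ∃ r : ℝ, |r| ≤ C * (h * (1 - Real.cos θ) ^ (-(5 / 4) : ℝ)) ∧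
        Real.sqrt θ / κ * (1 - circMult (Real.cos θ) h) = Real.sqrt (Real.sin θ / Real.pi) + r := by
  obtain ⟨C, hC, hexp⟩ := scaled_expansion 128 one_pos 1
  have hη : 0 < 1 - 1 / C₀ := by
    rw [sub_pos, div_lt_one (by linarith)]; exact hC₀
  set η := 1 - 1 / C₀ with hηd
  refine ⟨C + 2 * (1 + C) / η, fun h hh θ hθ hδ1 hδ2 κ hκ => ?_⟩
  have hh0 := hh.1
  have hθ0 := hθ.1
  have hpi := Real.pi_pos
  set δ := 1 - Real.cos θ with hδ
  have hδ0 : 0 < δ := lt_of_lt_of_le (by positivity) hδ1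
  have hδθ : δ ≤ θ ^ 2 := by
    have := Real.one_sub_sq_div_two_le_cos (x := θ)
    nlinarith [sq_nonneg θ]
  have hcos : η ≤ Real.cos θ := by rw [hηd]; linarith
  have hcube : h ≤ θ ^ 3 := by
    have h1 := le_cube_of_rpow_le (c := C₀) (by linarith) hh0 hθ0 (hδ1.trans hδθ)
    have h2 : 1 ≤ C₀ ^ (3 / 2 : ℝ) := Real.one_le_rpow hC₀.le (by norm_num)
    nlinarith
  have hle : h / θ ^ 3 ≤ 1 := by rw [div_le_one (by positivity)]; exact hcube
  have hΘ : θ ∈ Icc 0 (Real.pi / 2) := ⟨hθ.1.le, hθ.2.le⟩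
  have hmain := fun s hs => hexp ⟨θ, hΘ⟩ (θ ^ 3) (by positivity) h hh0 hle κ hκ s hs
  have hκpos := IsReducedNorm.pos (θ := ⟨θ, hΘ⟩) (by positivity) hκ
  have hsc : ∀ s, ∑ j ∈ Finset.range 1, scaledCoeff θ s (θ ^ 3) j * h ^ j =
      s * (modelCoeff θ 0)⁻¹ := fun s => by
    rw [Finset.sum_range_one, scaledCoeff, invCoeff_zero]; simp
  have hpow : Real.sqrt θ * (θ ^ 3)⁻¹ ≤ δ ^ (-(5 / 4) : ℝ) := by
    rw [← sq_rpow_neg_five_quarters hθ0]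
    exact Real.rpow_le_rpow_of_nonpos hδ0 hδθ (by norm_num)
  have hpow1 : 1 ≤ δ ^ (-(5 / 4) : ℝ) := by
    refine Real.one_le_rpow_of_pos_of_le_one_of_nonpos hδ0 ?_ (by norm_num)
    rw [hδ]; linarith
  have h1 := hmain (Real.sqrt θ) (by positivity)
  simp only at h1
  rw [hsc, mul_inv_modelCoeff_zero hθ0, pow_one] at h1
  have h1' : |Real.sqrt θ / κ - Real.sqrt (Real.sin θ / Real.pi)| ≤ C * (h * δ ^ (-(5 / 4) : ℝ)) := by
    refine h1.trans ?_
    rw [show Real.sqrt θ * (h / θ ^ 3) = h * (Real.sqrt θ * (θ ^ 3)⁻¹) by field_simp]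
    gcongr
  -- The same expansion with amplitude `s = 1`, its leading coefficient being at most `1`.
  have hκinv : 1 / κ ≤ 1 + C := by
    have h2 := hmain 1 zero_le_one
    simp only at h2
    rw [hsc, one_mul, pow_one, one_mul] at h2
    have h3 := one_le_modelCoeff_zero ⟨θ, hΘ⟩
    have h4 : (modelCoeff θ 0)⁻¹ ≤ 1 := inv_le_one_of_one_le₀ h3
    have h5 := (le_abs_self _).trans h2
    have h6 : C * (h / θ ^ 3) ≤ C * 1 := by gcongr
    linarith
  have hqle : circMult (Real.cos θ) h ≤ h / η := by
    unfold circMult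
    rw [Real.exp_neg, inv_le_comm₀ (Real.exp_pos _) (by positivity), inv_div]
    have h2 := Real.add_one_le_exp (2 * Real.pi * Real.cos θ / h)
    have h3 : η / h ≤ 2 * Real.pi * Real.cos θ / h := by
      gcongr
      nlinarith [Real.pi_gt_three]
    linarith
  have hsqrt : Real.sqrt θ ≤ 2 := by
    rw [Real.sqrt_le_left (by norm_num)]
    have := Real.pi_lt_four
    linarith [hθ.2]
  have hq0 := circMult_pos (Real.cos θ) h
  refine ⟨Real.sqrt θ / κ * (1 - circMult (Real.cos θ) h) - Real.sqrt (Real.sin θ / Real.pi), ?_, by ring⟩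
  have e : Real.sqrt θ / κ * (1 - circMult (Real.cos θ) h) - Real.sqrt (Real.sin θ / Real.pi) =
      (Real.sqrt θ / κ - Real.sqrt (Real.sin θ / Real.pi)) -
        Real.sqrt θ * (1 / κ) * circMult (Real.cos θ) h := by ring
  rw [e]
  refine (abs_sub _ _).trans ?_
  rw [abs_of_nonneg (a := Real.sqrt θ * (1 / κ) * circMult (Real.cos θ) h) (by positivity), add_mul]
  refine add_le_add h1' ?_
  calc Real.sqrt θ * (1 / κ) * circMult (Real.cos θ) h ≤ 2 * (1 + C) * (h / η) := by gcongr
    _ = 2 * (1 + C) / η * (h * 1) := by field_simp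
    _ ≤ _ := by gcongr

theorem circ_singular_values :
    (∀ yp ym : ℝ → ℝ,
      (∀ ξ ∈ Ioo (-1 : ℝ) 1, IsCritPair circPhi ξ (yp ξ) (ym ξ) ∧
        yp ξ ∈ Ioo (-Real.pi) 0 ∧ ym ξ ∈ Ioo 0 Real.pi) →
      ∃ (m b : ℝ → ℝ → ℝ) (c : ℕ → ℝ → ℝ),
        (∀ h > 0, ∀ ξ ∈ Ioo (-1 : ℝ) 1,
          IsLeast (singularValues (circP h ξ)) |m h ξ| ∧
          ∃ ePlus eMinus : L2 Circ, IsSingularTriple (circP h ξ) (m h ξ) ePlus eMinus) ∧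
        (∀ ξ ∈ Ioo (-1 : ℝ) 1, c 0 ξ = amp circPhi ξ (yp ξ) (ym ξ)) ∧
        (∀ K ⊆ Ioo (-1 : ℝ) 1, IsCompact K → ∃ h₀ > 0,
          HasExpansion b c K h₀ ∧
          ∀ ε > 0, ∃ C : ℝ, ∀ h ∈ Ioc 0 h₀, ∀ ξ ∈ K, ∃ r : ℝ,
            |r| ≤ C * Real.exp (ε / h - 3 * circS0 ξ (yp ξ) (ym ξ) / h) ∧
            m h ξ = Real.sqrt h * b h ξ *
              ((Real.exp (-circDJ ξ (ym ξ) (yp ξ) (ym ξ - 2 * Real.pi) / h)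
                - Real.exp (-circDJ ξ (ym ξ) (yp ξ) (ym ξ) / h)) + r)) ∧
        (∀ C₀ > 1, ∃ h₀ > 0, ∃ C : ℝ, ∀ h ∈ Ioc 0 h₀, ∀ ξ : ℝ,
          (C₀ * h ^ (2 / 3 : ℝ) ≤ 1 + ξ → 1 + ξ ≤ 1 / C₀ →
            ∃ r : ℝ, |r| ≤ C * (h * (1 + ξ) ^ (-(5 / 4) : ℝ)) ∧
              m h ξ = -(Real.sqrt h * (amp circPhi ξ (yp ξ) (ym ξ) + r) *
                Real.exp (-circS0 ξ (yp ξ) (ym ξ) / h))) ∧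
          (C₀ * h ^ (2 / 3 : ℝ) ≤ 1 - ξ → 1 - ξ ≤ 1 / C₀ →
            ∃ r : ℝ, |r| ≤ C * (h * (1 - ξ) ^ (-(5 / 4) : ℝ)) ∧
              m h ξ = Real.sqrt h * (amp circPhi ξ (yp ξ) (ym ξ) + r) *
                Real.exp (-circS0 ξ (yp ξ) (ym ξ) / h)))) := by
  intro yp ym hcrit
  have hpi := Real.pi_pos
  -- Folding by the sign of `ξ` keeps the angle in `[0, π/2]`. The sign assigned to `ξ = 0` is
  -- immaterial, since `1 - q = 0` there.
  set θ : ℝ → ℝ := fun ξ => Real.arccos |ξ| with hθd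
  set σ : ℝ → ℝ := fun ξ => if 0 ≤ ξ then 1 else -1 with hσd
  have hσ : ∀ ξ, σ ξ = 1 ∨ σ ξ = -1 := fun ξ => by simp only [hσd]; split_ifs <;> simp
  have hσabs : ∀ ξ, |σ ξ| = 1 := fun ξ => by rcases hσ ξ with h | h <;> rw [h] <;> simp
  have habs : ∀ ξ ∈ Ioo (-1 : ℝ) 1, |ξ| < 1 := fun ξ hξ => abs_lt.2 hξ
  have hcosθ : ∀ ξ ∈ Ioo (-1 : ℝ) 1, Real.cos (θ ξ) = |ξ| := fun ξ hξ =>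
    Real.cos_arccos (by linarith [abs_nonneg ξ]) (habs ξ hξ).le
  have hξσ : ∀ ξ ∈ Ioo (-1 : ℝ) 1, ξ = σ ξ * Real.cos (θ ξ) := fun ξ hξ => by
    rw [hcosθ ξ hξ]; simp only [hσd]
    split_ifs with h
    · rw [abs_of_nonneg h, one_mul]
    · rw [abs_of_neg (not_le.1 h)]; ring
  have hθ : ∀ ξ ∈ Ioo (-1 : ℝ) 1, θ ξ ∈ Ioc 0 (Real.pi / 2) := fun ξ hξ =>
    ⟨Real.arccos_pos.2 (habs ξ hξ), Real.arccos_le_pi_div_two.2 (abs_nonneg ξ)⟩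
  have hangle : ∀ ξ, θ ξ ∈ Icc 0 (Real.pi / 2) := fun ξ =>
    ⟨Real.arccos_nonneg _, Real.arccos_le_pi_div_two.2 (abs_nonneg ξ)⟩
  have hex : ∀ h ξ : ℝ, ∃ κ : ℝ, 0 < h → ξ ∈ Ioo (-1 : ℝ) 1 →
      IsReducedNorm 128 (θ ξ) (Real.sqrt (h / θ ξ ^ 3)) κ ∧
      ∀ m : ℝ, |m| = Real.sqrt h * (Real.sqrt (θ ξ) / κ) * ((1 - circMult (Real.cos (θ ξ)) h) *
        Real.exp (-(2 * (Real.sin (θ ξ) - θ ξ * Real.cos (θ ξ)) / h))) →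
      IsLeast (singularValues (circP h ξ)) |m| ∧
        ∃ ePlus eMinus, IsSingularTriple (circP h ξ) m ePlus eMinus := by
    intro h ξ
    by_cases hc : 0 < h ∧ ξ ∈ Ioo (-1 : ℝ) 1
    · by_cases h0 : ξ = 0
      -- At `ξ = 0` the inverse does not exist and `κ` is not determined by it; the model integral
      -- itself is chosen, so that `b` keeps its expansion uniformly on compact sets containing `0`.
      · refine ⟨modelInt (θ ξ) (Real.sqrt (h / θ ξ ^ 3)), fun _ _ => ⟨⟨le_rfl, ?_⟩, fun m hm => ?_⟩⟩
        · exact le_add_of_nonneg_right (by positivity)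
        · have : circMult (Real.cos (θ ξ)) h = 1 := by
            rw [hcosθ ξ hc.2, h0]; simp [circMult]
          rw [this, sub_self, zero_mul, mul_zero, abs_eq_zero] at hm
          rw [hm, h0]
          exact exists_singularTriple_circ_zero hc.1.ne'
      · have hlt : θ ξ < Real.pi / 2 := Real.arccos_lt_pi_div_two.2 (abs_pos.2 h0)
        obtain ⟨κ, hκ⟩ := exists_singularValue_circ (θ := θ ξ) ⟨(hθ ξ hc.2).1, hlt⟩ hc.1 (ξ := ξ) (by
          have := hξσ ξ hc.2
          rcases hσ ξ with h | h
          · left; rwa [h, one_mul] at this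
          · right; rwa [h, neg_one_mul] at this)
        exact ⟨κ, fun _ _ => hκ⟩
    · exact ⟨0, fun h1 h2 => absurd ⟨h1, h2⟩ hc⟩
  choose κ hκ using hex
  have hκpos : ∀ h > 0, ∀ ξ ∈ Ioo (-1 : ℝ) 1, 0 < κ h ξ := fun h hh ξ hξ => by
    have h0 := (hθ ξ hξ).1
    exact IsReducedNorm.pos (θ := ⟨θ ξ, hangle ξ⟩) (by positivity) (hκ h ξ hh hξ).1
  have hgeo := fun ξ (hξ : ξ ∈ Ioo (-1 : ℝ) 1) => circ_geometry (hθ ξ hξ) (hσ ξ) (hξσ ξ hξ)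
    (hcrit ξ hξ).1 (hcrit ξ hξ).2.1 (hcrit ξ hξ).2.2
  refine ⟨fun h ξ => Real.sqrt h * (Real.sqrt (θ ξ) / κ h ξ) *
      (σ ξ * ((1 - circMult (Real.cos (θ ξ)) h) *
        Real.exp (-(2 * (Real.sin (θ ξ) - θ ξ * Real.cos (θ ξ)) / h)))),
    fun h ξ => Real.sqrt (θ ξ) / κ h ξ,
    fun j ξ => scaledCoeff (θ ξ) (Real.sqrt (θ ξ)) (θ ξ ^ 3) j, ?_, ?_, ?_, ?_⟩
  · intro h hh ξ hξ
    refine (hκ h ξ hh hξ).2 _ ?_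
    have h1 := hκpos h hh ξ hξ
    have h2 : circMult (Real.cos (θ ξ)) h ≤ 1 := by
      unfold circMult
      rw [hcosθ ξ hξ, Real.exp_le_one_iff, neg_nonpos]
      positivity
    have h3 : 0 ≤ 1 - circMult (Real.cos (θ ξ)) h := by linarith
    rw [abs_mul, abs_mul (σ ξ), hσabs, one_mul, abs_of_nonneg (by positivity), abs_of_nonneg (by positivity)]
  · intro ξ hξ
    show scaledCoeff (θ ξ) (Real.sqrt (θ ξ)) (θ ξ ^ 3) 0 = _
    rw [(hgeo ξ hξ).1, scaledCoeff, invCoeff_zero, pow_zero, mul_one,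
      mul_inv_modelCoeff_zero (hθ ξ hξ).1]
  · intro Q hQ hQc
    have hθc : Continuous θ := Real.continuous_arccos.comp continuous_abs
    obtain ⟨B₁, hB₁⟩ := hQc.exists_bound_of_continuousOn (f := fun ξ => Real.sqrt (θ ξ)) (by fun_prop)
    -- On a compact subset of the open interval the angle is bounded away from `0`, so the scale
    -- `θ³` does not degenerate and powers of `ε²` are comparable with powers of `h`.
    have hρpos : ∀ ξ ∈ Q, 0 < θ ξ ^ 3 := fun ξ hξ => pow_pos (hθ ξ (hQ hξ)).1 3
    obtain ⟨B₂, hB₂⟩ := hQc.exists_bound_of_continuousOn (f := fun ξ => (θ ξ ^ 3)⁻¹)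
      (ContinuousOn.inv₀ (by fun_prop) fun ξ hξ => (hρpos ξ hξ).ne')
    refine ⟨1, one_pos, ?_, fun ε _ => ⟨0, fun h hh ξ hξ => ⟨0, by simp, ?_⟩⟩⟩
    · exact hasExpansion_of_isReducedNorm (θ := fun ξ => ⟨θ ξ, hangle ξ⟩) (K := 128)
        (fun ξ _ => Real.sqrt_nonneg _)
        hρpos (fun ξ hξ => (le_abs_self _).trans (hB₁ ξ hξ)) (fun ξ hξ => (le_abs_self _).trans (hB₂ ξ hξ))
        (fun h hh ξ hξ => (hκ h ξ hh (hQ hξ)).1)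
    · rw [add_zero, (hgeo ξ (hQ hξ)).2.2 h]
  · intro C₀ hC₀
    obtain ⟨C, hC⟩ := circ_amplitude_near_top hC₀
    refine ⟨1, one_pos, C, fun h hh ξ => ?_⟩
    have hpos : 0 < C₀ * h ^ (2 / 3 : ℝ) := mul_pos (by linarith) (Real.rpow_pos_of_pos hh.1 _)
    have hC1 : 1 / C₀ < 1 := by rw [div_lt_one (by linarith)]; exact hC₀
    -- Both ends are treated at once in terms of `|ξ|`. The condition `δ ≤ 1/C₀ < 1` fixes the sign
    -- of `ξ` and excludes `ξ = 0`.
    have main : ∀ τ : ℝ, σ ξ = τ → ξ ∈ Ioo (-1 : ℝ) 1 → ξ ≠ 0 → C₀ * h ^ (2 / 3 : ℝ) ≤ 1 - |ξ| →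
        1 - |ξ| ≤ 1 / C₀ → ∃ r : ℝ, |r| ≤ C * (h * (1 - |ξ|) ^ (-(5 / 4) : ℝ)) ∧
          Real.sqrt h * (Real.sqrt (θ ξ) / κ h ξ) * (σ ξ * ((1 - circMult (Real.cos (θ ξ)) h) *
            Real.exp (-(2 * (Real.sin (θ ξ) - θ ξ * Real.cos (θ ξ)) / h)))) =
          τ * (Real.sqrt h * (amp circPhi ξ (yp ξ) (ym ξ) + r) *
                Real.exp (-circS0 ξ (yp ξ) (ym ξ) / h)) := by
      intro τ hτ hξ h0 h1 h2
      have hlt : θ ξ < Real.pi / 2 := Real.arccos_lt_pi_div_two.2 (abs_pos.2 h0)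
      rw [← hcosθ ξ hξ] at h1 h2 ⊢
      obtain ⟨r, hr, he⟩ := hC h hh (θ ξ) ⟨(hθ ξ hξ).1, hlt⟩ h1 h2 _ (hκ h ξ hh.1 hξ).1
      refine ⟨r, hr, ?_⟩
      rw [(hgeo ξ hξ).1, (hgeo ξ hξ).2.1, ← he, hτ, neg_div]
      ring
    constructor
    · intro h1 h2
      have hξ0 : ξ < 0 := by linarith
      have e : 1 - |ξ| = 1 + ξ := by rw [abs_of_neg hξ0]; ring
      obtain ⟨r, hr, he⟩ := main (-1) (if_neg (not_le.2 hξ0)) ⟨by linarith, by linarith⟩ hξ0.ne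
        (by rwa [e]) (by rwa [e])
      rw [e] at hr
      exact ⟨r, hr, he.trans (neg_one_mul _)⟩
    · intro h1 h2
      have hξ0 : 0 < ξ := by linarith
      have e : 1 - |ξ| = 1 - ξ := by rw [abs_of_pos hξ0]
      obtain ⟨r, hr, he⟩ := main 1 (if_pos hξ0.le) ⟨by linarith, by linarith⟩ hξ0.ne'
        (by rwa [e]) (by rwa [e])
      rw [e] at hr
      exact ⟨r, hr, he.trans (one_mul _)⟩

theorem theorem2p4 :
    -- `Y = ℝ`
    (∀ yp ym : ℝ → ℝ, (∀ ξ < 0, IsCritPair linePhi ξ (yp ξ) (ym ξ)) →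
      ∃ (m b : ℝ → ℝ → ℝ) (c : ℕ → ℝ → ℝ),
        (∀ h > 0, ∀ ξ < 0,
          IsLeast (singularValues (lineP h ξ)) |m h ξ| ∧
          ∃ ePlus eMinus : L2 ℝ, IsSingularTriple (lineP h ξ) (m h ξ) ePlus eMinus) ∧
        (∀ ξ < 0, c 0 ξ = amp linePhi ξ (yp ξ) (ym ξ)) ∧
        (∀ K ⊆ Iio (0 : ℝ), IsCompact K → ∃ h₀ > 0,
          HasExpansion b c K h₀ ∧
          ∀ ε > 0, ∃ C : ℝ, ∀ h ∈ Ioc 0 h₀, ∀ ξ ∈ K, ∃ r : ℝ,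
            |r| ≤ C * Real.exp (ε / h - 3 * lineS0 ξ (yp ξ) (ym ξ) / h) ∧
            m h ξ = Real.sqrt h * b h ξ *
              (Real.exp (-lineS0 ξ (yp ξ) (ym ξ) / h) + r)) ∧
        (∀ C₀ > 0, ∃ h₀ > 0, ∃ C : ℝ, ∀ h ∈ Ioc 0 h₀, ∀ ξ : ℝ,
          ((-1 / C₀ ≤ ξ ∧ ξ ≤ -C₀ * h ^ (2 / 3 : ℝ)) ∨ ξ ≤ -C₀) →
          (∃ r : ℝ, |r| ≤ C * (h * |ξ| ^ (-(5 / 4) : ℝ)) ∧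
            m h ξ = Real.sqrt h * (amp linePhi ξ (yp ξ) (ym ξ) + r) *
              Real.exp (-lineS0 ξ (yp ξ) (ym ξ) / h)) ∧
          (∃ r : ℝ, |r| ≤ C * (h * |ξ| ^ (-(3 / 2) : ℝ)) ∧
            m h ξ = Real.sqrt (2 * h) * |ξ| ^ (1 / 4 : ℝ) / Real.sqrt Real.pi * (1 + r) *
              Real.exp (-(4 * |ξ| ^ (3 / 2 : ℝ)) / (3 * h))))) ∧
    -- `Y = ℝ / 2πℤ`
    (∀ yp ym : ℝ → ℝ,
      (∀ ξ ∈ Ioo (-1 : ℝ) 1, IsCritPair circPhi ξ (yp ξ) (ym ξ) ∧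
        yp ξ ∈ Ioo (-Real.pi) 0 ∧ ym ξ ∈ Ioo 0 Real.pi) →
      ∃ (m b : ℝ → ℝ → ℝ) (c : ℕ → ℝ → ℝ),
        (∀ h > 0, ∀ ξ ∈ Ioo (-1 : ℝ) 1,
          IsLeast (singularValues (circP h ξ)) |m h ξ| ∧
          ∃ ePlus eMinus : L2 Circ, IsSingularTriple (circP h ξ) (m h ξ) ePlus eMinus) ∧
        (∀ ξ ∈ Ioo (-1 : ℝ) 1, c 0 ξ = amp circPhi ξ (yp ξ) (ym ξ)) ∧
        (∀ K ⊆ Ioo (-1 : ℝ) 1, IsCompact K → ∃ h₀ > 0,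
          HasExpansion b c K h₀ ∧
          ∀ ε > 0, ∃ C : ℝ, ∀ h ∈ Ioc 0 h₀, ∀ ξ ∈ K, ∃ r : ℝ,
            |r| ≤ C * Real.exp (ε / h - 3 * circS0 ξ (yp ξ) (ym ξ) / h) ∧
            m h ξ = Real.sqrt h * b h ξ *
              ((Real.exp (-circDJ ξ (ym ξ) (yp ξ) (ym ξ - 2 * Real.pi) / h)
                - Real.exp (-circDJ ξ (ym ξ) (yp ξ) (ym ξ) / h)) + r)) ∧
        (∀ C₀ > 1, ∃ h₀ > 0, ∃ C : ℝ, ∀ h ∈ Ioc 0 h₀, ∀ ξ : ℝ,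
          (C₀ * h ^ (2 / 3 : ℝ) ≤ 1 + ξ → 1 + ξ ≤ 1 / C₀ →
            ∃ r : ℝ, |r| ≤ C * (h * (1 + ξ) ^ (-(5 / 4) : ℝ)) ∧
              m h ξ = -(Real.sqrt h * (amp circPhi ξ (yp ξ) (ym ξ) + r) *
                Real.exp (-circS0 ξ (yp ξ) (ym ξ) / h))) ∧
          (C₀ * h ^ (2 / 3 : ℝ) ≤ 1 - ξ → 1 - ξ ≤ 1 / C₀ →
            ∃ r : ℝ, |r| ≤ C * (h * (1 - ξ) ^ (-(5 / 4) : ℝ)) ∧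
              m h ξ = Real.sqrt h * (amp circPhi ξ (yp ξ) (ym ξ) + r) *
                Real.exp (-circS0 ξ (yp ξ) (ym ξ) / h)))) := by
  exact ⟨line_singular_values, circ_singular_values⟩
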